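/- Let $\Bbbk$ be a field of characteristic zero and let $\mathfrak g=\mathrm{sl}(2)\otimes\Bbbk[t^{\pm1}]$ be the loop algebra, with bracket $[x(k),y(l)]=[x,y](k+l)$, where $x(k)=x\otimes t^k$, graded by the degree in $t$. Let $e,h,f$ be the standard basis of $\mathrm{sl}(2)$ and put $E=\bigoplus_{k\in\mathbb Z}\Bbbk\,e(k)$ and $H=\bigoplus_{k\in\mathbb Z}\Bbbk\,h(k)$. All modules are $\mathbb Z$-graded compatibly with the grading of $\mathfrak g$; submodules and subquotients are graded, and a module is irreducible if it is non-zero and has no graded submodules other than zero and itself. Let $\bar M(0)=\mathrm{Ind}_{H\oplus E}^{\mathfrak g}\,\Bbbk v$, where $(H\oplus E)\cdot v=0$ and $v$ has degree $0$. For $\varphi:\mathbb Z\to\Bbbk$ let $\tilde\varphi:U(H)\to\Bbbk[t^{\pm1}]$ be the homomorphism of graded algebras with $\tilde\varphi(h(k))=\varphi(k)t^k$ for all $k\in\mathbb Z$, and let $P(\varphi)$ be the image of $\tilde\varphi$, on which $H$ acts through $\tilde\varphi$ by multiplication. Let $E$ act on $P(\varphi)$ by zero, and let $F(\varphi)$ be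 the quotient of the graded $\mathfrak g$-module $\mathrm{Ind}_{H\oplus E}^{\mathfrak g}P(\varphi)$ by its largest submodule that has trivial intersection with $P(\varphi)$. Let $\mathrm{Exp}$ be the set of all functions $\varphi:\mathbb Z\to\Bbbk$ of the form $\varphi(k)=-2\sum_{i=1}^n\alpha_i^k$, where $n\ge 0$ and $\alpha_1,\dots,\alpha_n\in\Bbbk$ are non-zero. **Theorem.** For every $\varphi\in\mathrm{Exp}$, the graded $\mathfrak g$-module $F(\varphi)$ is irreducible and is isomorphic, by an isomorphism that preserves degrees, to a subquotient $A/B$ of $\bar M(0)$, where $B\subseteq A\subseteq\bar M(0)$ are graded submodules. Conversely, if $\Bbbk$ is algebraically closed, then every irreducible subquotient of $\bar M(0)$ is isomorphic to $F(\varphi)$ for some $\varphi\in\mathrm{Exp}$, up to a shift of the grading. -/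

import Mathlib

open scoped TensorProduct LaurentPolynomial

noncomputable section

namespace LoopSl2

section LieAlgebras

attribute [local instance 100] LieRing.ofAssociativeRing

variable (𝕜 : Type*) [Field 𝕜]

/-- The Lie algebra `sl(2)` of traceless `2 × 2` matrices. -/
abbrev Sl2 : Type _ := LieAlgebra.SpecialLinear.sl (Fin 2) 𝕜

/-- The standard basis vector `e` of `sl(2)`. -/
def e : Sl2 𝕜 := LieAlgebra.SpecialLinear.single 0 1 (by decide) 1

/-- The standard basis vector `f` of `sl(2)`. -/
def f : Sl2 𝕜 := LieAlgebra.SpecialLinear.single 1 0 (by decide) 1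

/-- The standard basis vector `h` of `sl(2)`. -/
def h : Sl2 𝕜 := LieAlgebra.SpecialLinear.singleSubSingle 0 1 1

/-- The loop algebra `𝔤 = sl(2) ⊗ 𝕜[t, t⁻¹]`. -/
abbrev G : Type _ := LieAlgebra.loopAlgebra 𝕜 ℤ (Sl2 𝕜)

variable {𝕜}

/-- The element `x(k) = x ⊗ tᵏ` of the loop algebra. -/
def loop (x : Sl2 𝕜) (k : ℤ) : G 𝕜 := (LaurentPolynomial.T k : 𝕜[T;T⁻¹]) ⊗ₜ[𝕜] x

/-- For `x ∈ sl(2)`, the abelian subalgebra `⨁ₖ 𝕜 x(k) = x ⊗ 𝕜[t, t⁻¹]` of `𝔤`. -/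
def line (x : Sl2 𝕜) : LieSubalgebra 𝕜 (G 𝕜) where
  toSubmodule := LinearMap.range ((TensorProduct.mk 𝕜 𝕜[T;T⁻¹] (Sl2 𝕜)).flip x)
  lie_mem' := by
    rintro _ _ ⟨p, rfl⟩ ⟨q, rfl⟩
    exact ⟨0, by simp⟩

variable (𝕜)

/-- The subalgebra `E = ⨁ₖ 𝕜 e(k)`. -/
def E : LieSubalgebra 𝕜 (G 𝕜) := line (e 𝕜)

/-- The subalgebra `H = ⨁ₖ 𝕜 h(k)`. -/
def H : LieSubalgebra 𝕜 (G 𝕜) := line (h 𝕜)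

/-- The universal enveloping algebra of the loop algebra; `𝔤`-modules are modules over it. -/
abbrev UG : Type _ := UniversalEnvelopingAlgebra 𝕜 (G 𝕜)

/-- The universal enveloping algebra of `H`; `H`-modules are modules over it. -/
abbrev UH : Type _ := UniversalEnvelopingAlgebra 𝕜 (H 𝕜)

variable {𝕜}

/-- The element `h(k)`, as an element of `H`. -/
def hH (k : ℤ) : H 𝕜 := ⟨loop (h 𝕜) k, ⟨LaurentPolynomial.T k, rfl⟩⟩

/-- The canonical map `𝔤 → U(𝔤)`. -/
def toUG (x : G 𝕜) : UG 𝕜 := UniversalEnvelopingAlgebra.ι 𝕜 x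

/-- The canonical map `H → U(H)`. -/
def toUH (x : H 𝕜) : UH 𝕜 := UniversalEnvelopingAlgebra.ι 𝕜 x

/-- The linear map `H → 𝕜[t, t⁻¹]`, `h(k) ↦ φ(k) tᵏ`, where the coefficient of `h` in an element
of `sl(2)` is read off as the upper left matrix entry. -/
def twist (φ : ℤ → 𝕜) : H 𝕜 →ₗ[𝕜] 𝕜[T;T⁻¹] :=
  ((AddMonoidAlgebra.basis ℤ 𝕜).constr 𝕜 fun k : ℤ => φ k • (LaurentPolynomial.T k : 𝕜[T;T⁻¹])) ∘ₗ
    (TensorProduct.rid 𝕜 𝕜[T;T⁻¹]).toLinearMap ∘ₗ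
      ((Matrix.entryLinearMap 𝕜 𝕜 (0 : Fin 2) (0 : Fin 2) ∘ₗ
        (LieAlgebra.SpecialLinear.sl (Fin 2) 𝕜).toSubmodule.subtype).lTensor 𝕜[T;T⁻¹]) ∘ₗ
        (H 𝕜).toSubmodule.subtype

theorem lie_eq_zero (x y : H 𝕜) : ⁅x, y⁆ = 0 := by
  obtain ⟨_, p, rfl⟩ := x
  obtain ⟨_, q, rfl⟩ := y
  apply Subtype.ext
  simp

/-- The algebra homomorphism `φ̃ : U(H) → 𝕜[t, t⁻¹]`, `h(k) ↦ φ(k) tᵏ`. -/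
def tilde (φ : ℤ → 𝕜) : UH 𝕜 →ₐ[𝕜] 𝕜[T;T⁻¹] :=
  UniversalEnvelopingAlgebra.lift 𝕜
    { twist φ with
      map_lie' := by
        intro x y
        have h1 : (twist φ) ⁅x, y⁆ = 0 := by rw [lie_eq_zero, map_zero]
        have h2 : ⁅twist φ x, twist φ y⁆ = 0 := by
          rw [LieRing.of_associative_ring_bracket, mul_comm, sub_self]
        exact h1.trans h2.symm }

theorem tilde_h (φ : ℤ → 𝕜) (k : ℤ) :
    tilde φ (toUH (hH k)) = φ k • (LaurentPolynomial.T k : 𝕜[T;T⁻¹]) := by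
  have h1 : tilde φ (toUH (hH k)) = twist φ (hH k) :=
    UniversalEnvelopingAlgebra.lift_ι_apply 𝕜 _ _
  have h2 : (AddMonoidAlgebra.basis ℤ 𝕜 k : 𝕜[T;T⁻¹]) = LaurentPolynomial.T k :=
    AddMonoidAlgebra.basis_apply 𝕜 k
  have h3 : twist φ (hH k) = (AddMonoidAlgebra.basis ℤ 𝕜).constr 𝕜
      (fun k : ℤ => φ k • (LaurentPolynomial.T k : 𝕜[T;T⁻¹]))
      ((h 𝕜).val 0 0 • (LaurentPolynomial.T k : 𝕜[T;T⁻¹])) := rfl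
  have h4 : (h 𝕜).val 0 0 = 1 := by simp [h]
  rw [h1, h3, h4, one_smul, ← h2, Module.Basis.constr_basis, h2]

/-- The trivial one-dimensional representation of `H`. -/
def trivialRep : UH 𝕜 →ₐ[𝕜] Module.End 𝕜 𝕜 := UniversalEnvelopingAlgebra.lift 𝕜 0

/-- The `H`-module `P(φ)`: the underlying space is the image of `φ̃`. -/
abbrev P (φ : ℤ → 𝕜) : Type _ := (tilde φ).range

/-- The `H`-module `P(φ)`: `u ∈ U(H)` acts on the image of `φ̃` as multiplication by `φ̃(u)`. -/
def pRep (φ : ℤ → 𝕜) : UH 𝕜 →ₐ[𝕜] Module.End 𝕜 (P φ) :=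
  (Algebra.lmul 𝕜 (P φ)).comp (tilde φ).rangeRestrict

/-- The grading of `P(φ) ⊆ 𝕜[t, t⁻¹]` by the degree in `t`. -/
def pGrading (φ : ℤ → 𝕜) (d : ℤ) : Submodule 𝕜 (P φ) :=
  (Submodule.span 𝕜 {(LaurentPolynomial.T d : 𝕜[T;T⁻¹])}).comap (tilde φ).range.val.toLinearMap

end LieAlgebras

section Graded

variable {𝕜 : Type*} [Field 𝕜]
variable {M N : Type*} [AddCommGroup M] [Module 𝕜 M] [Module (UG 𝕜) M] [IsScalarTower 𝕜 (UG 𝕜) M]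
  [AddCommGroup N] [Module 𝕜 N] [Module (UG 𝕜) N] [IsScalarTower 𝕜 (UG 𝕜) N]

/-- A `ℤ`-grading `M = ⨁ M_d` of a `𝔤`-module compatible with the grading of `𝔤` by degree in `t`:
`x(k) M_d ⊆ M_{d+k}`. -/
structure IsGrading (𝓜 : ℤ → Submodule 𝕜 M) : Prop where
  isInternal : DirectSum.IsInternal 𝓜
  smul_mem : ∀ (x : Sl2 𝕜) (k d : ℤ), ∀ m ∈ 𝓜 d, toUG (loop x k) • m ∈ 𝓜 (d + k)

/-- A submodule `Q` is graded if it is the sum of the `Q ∩ M_d`. -/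
def IsGradedSubmodule (𝓜 : ℤ → Submodule 𝕜 M) (Q : Submodule (UG 𝕜) M) : Prop :=
  Q.restrictScalars 𝕜 = ⨆ d, Q.restrictScalars 𝕜 ⊓ 𝓜 d

/-- An irreducible graded `𝔤`-module: a non-zero graded module whose only graded submodules are
zero and itself. -/
structure IsGradedIrreducible (𝓜 : ℤ → Submodule 𝕜 M) : Prop where
  isGrading : IsGrading 𝓜
  nontrivial : Nontrivial M
  eq_bot_or_eq_top : ∀ Q : Submodule (UG 𝕜) M, IsGradedSubmodule 𝓜 Q → Q = ⊥ ∨ Q = ⊤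

/-- Isomorphism of graded `𝔤`-modules which raises degrees by `s`. -/
def GradedIso (s : ℤ) (𝓜 : ℤ → Submodule 𝕜 M) (𝓝 : ℤ → Submodule 𝕜 N) : Prop :=
  ∃ F : M ≃ₗ[UG 𝕜] N, ∀ d m, m ∈ 𝓜 d ↔ F m ∈ 𝓝 (d + s)

/-- The grading on the subquotient `A / B` of `M`, for `B ⊆ A ⊆ M`, induced by that of `M`. -/
def subquotientGrading (𝓜 : ℤ → Submodule 𝕜 M) (A B : Submodule (UG 𝕜) M) (d : ℤ) :
    Submodule 𝕜 (A ⧸ B.submoduleOf A) :=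
  ((𝓜 d).comap (A.subtype.restrictScalars 𝕜)).map ((B.submoduleOf A).mkQ.restrictScalars 𝕜)

/-- `N` is a subquotient of `M`, as graded `𝔤`-modules: `N ≅ A / B` for graded submodules
`B ⊆ A ⊆ M`, by an isomorphism which preserves degrees. -/
def IsGradedSubquotient (𝓝 : ℤ → Submodule 𝕜 N) (𝓜 : ℤ → Submodule 𝕜 M) : Prop :=
  ∃ A B : Submodule (UG 𝕜) M, B ≤ A ∧ IsGradedSubmodule 𝓜 A ∧ IsGradedSubmodule 𝓜 B ∧
    GradedIso 0 𝓝 (subquotientGrading 𝓜 A B)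

end Graded

section Induced

variable {𝕜 : Type*} [Field 𝕜]
variable {Λ : Type*} [AddCommGroup Λ] [Module 𝕜 Λ] (σ : UH 𝕜 →ₐ[𝕜] Module.End 𝕜 Λ)

/-- The relations `y ⊗ v = 1 ⊗ y v` for `y ∈ H` and `y ⊗ v = 0` for `y ∈ E`. -/
def inducedRel : Submodule (UG 𝕜) (UG 𝕜 ⊗[𝕜] Λ) :=
  Submodule.span (UG 𝕜)
    ({z | ∃ (y : H 𝕜) (v : Λ), z = toUG (y : G 𝕜) ⊗ₜ[𝕜] v - 1 ⊗ₜ[𝕜] (σ (toUH y) v)} ∪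
      {z | ∃ (y : E 𝕜) (v : Λ), z = toUG (y : G 𝕜) ⊗ₜ[𝕜] v})

/-- The `𝔤`-module induced from the `(H ⊕ E)`-module `Λ` with `E Λ = 0`, i.e. the tensor product
`U(𝔤) ⊗ Λ` over `U(H ⊕ E)`. -/
abbrev Induced : Type _ := (UG 𝕜 ⊗[𝕜] Λ) ⧸ inducedRel σ

/-- The canonical map `Λ → Ind Λ`, `v ↦ 1 ⊗ v`. -/
def inducedInc : Λ →ₗ[𝕜] Induced σ :=
  (inducedRel σ).mkQ.restrictScalars 𝕜 ∘ₗ TensorProduct.mk 𝕜 (UG 𝕜) Λ 1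

/-- The grading of `U(𝔤)`: the degree `d` component is spanned by the products
`x₁(k₁) ⋯ xᵣ(kᵣ)` with `k₁ + ⋯ + kᵣ = d`. -/
def ugGrading (d : ℤ) : Submodule 𝕜 (UG 𝕜) :=
  Submodule.span 𝕜 {u | ∃ l : List (Sl2 𝕜 × ℤ),
    (l.map Prod.snd).sum = d ∧ u = (l.map fun p => toUG (loop p.1 p.2)).prod}

/-- The grading of the induced module of a graded `H`-module: `U(𝔤)ᵢ ⊗ Λⱼ` has degree `i + j`. -/
def inducedGrading (𝓛 : ℤ → Submodule 𝕜 Λ) (d : ℤ) : Submodule 𝕜 (Induced σ) :=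
  Submodule.span 𝕜 {z | ∃ i j : ℤ, i + j = d ∧ ∃ u ∈ ugGrading (𝕜 := 𝕜) i, ∃ v ∈ 𝓛 j,
    z = u • inducedInc σ v}

/-- The largest submodule of `Ind Λ` that has trivial intersection with `Λ`, as the sum of all
submodules that have trivial intersection with `Λ`. -/
def maxSub : Submodule (UG 𝕜) (Induced σ) :=
  sSup {Q | Q.restrictScalars 𝕜 ⊓ LinearMap.range (inducedInc σ) = ⊥}

/-- The `𝔤`-module `F(Λ)`, the quotient of `Ind Λ` by its largest submodule that has trivial
intersection with `Λ`. -/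
abbrev FMod : Type _ := Induced σ ⧸ maxSub σ

/-- The grading of `F(Λ)` as a quotient of `Ind Λ`. -/
def fGrading (𝓛 : ℤ → Submodule 𝕜 Λ) (d : ℤ) : Submodule 𝕜 (FMod σ) :=
  (inducedGrading σ 𝓛 d).map ((maxSub σ).mkQ.restrictScalars 𝕜)

end Induced

section Objects

variable (𝕜 : Type*) [Field 𝕜]

/-- The `𝔤`-module `M̄(0)`, induced from the trivial one-dimensional `(H ⊕ E)`-module. -/
abbrev MBar : Type _ := Induced (trivialRep (𝕜 := 𝕜))

/-- The one-dimensional space, placed in degree zero. -/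
def trivialGrading (d : ℤ) : Submodule 𝕜 𝕜 := if d = 0 then ⊤ else ⊥

/-- The grading of `M̄(0)` in which the generating vector has degree zero. -/
def mBarGrading (d : ℤ) : Submodule 𝕜 (MBar 𝕜) :=
  inducedGrading (trivialRep (𝕜 := 𝕜)) (trivialGrading 𝕜) d

variable {𝕜}

/-- The `𝔤`-module `F(φ) = F(P(φ))`. -/
abbrev FPhi (φ : ℤ → 𝕜) : Type _ := FMod (pRep φ)

/-- The grading of `F(φ)`. -/
def fPhiGrading (φ : ℤ → 𝕜) : ℤ → Submodule 𝕜 (FPhi φ) := fGrading (pRep φ) (pGrading φ)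

variable (𝕜)

/-- The functions `φ(k) = -2 (α₁ᵏ + ⋯ + αₙᵏ)` with `n ≥ 0` and `αᵢ ∈ 𝕜` non-zero. -/
def Exp : Set (ℤ → 𝕜) :=
  {φ | ∃ (n : ℕ) (α : Fin n → 𝕜), (∀ i, α i ≠ 0) ∧ ∀ k : ℤ, φ k = -2 * ∑ i, α i ^ k}

end Objects

end LoopSl2

end

open scoped TensorProduct LaurentPolynomial

noncomputable section

namespace LoopSl2

attribute [local instance 100] LieRing.ofAssociativeRing

variable {𝕜 : Type*} [Field 𝕜]

/-! In `M̄(0)` the vectors of weight `-2n` are spanned by `f(l₁) ⋯ f(lₙ) v`, so they form an image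
of the Laurent polynomials in `n` variables. Since `[h(k), f(l)] = -2 f(k+l)` and `H v = 0`, the
element `h(k)` acts there as multiplication by `-2(z₁ᵏ + ⋯ + zₙᵏ)`; thus `U(H)` acts through `psi 𝕜
n`. For `φ(k) = -2 ∑ αᵢᵏ` the map `φ̃` is `psi 𝕜 n` followed by the substitution `zᵢ = αᵢ t`
(`tilde_eq`).

Existence. The discriminant in `n` variables yields a vector of weight `-2n` and degree `0`. It is
studied in a concrete module of functions on finite multisets: there `e(k)` only evaluates a
function at multisets with a repeated point, so it kills the discriminant, and the annihilator of
the discriminant in `U(H)` lies in the kernel of `psi 𝕜 n`, hence in that of `φ̃`. By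
`smul_incF_eq_zero`, such a containment of annihilators in `U(H)` implies the containment in `U(𝔤)`,
because every non-zero submodule of `F(φ)` meets `P(φ)`. So the cyclic module of the discriminant
vector maps onto `F(φ)`.

Irreducibility. A non-zero graded submodule of `F(φ)` contains a homogeneous element of `P(φ)`, that
is, some `tᵈ` up to a scalar. By Newton's identities `P(φ)` contains `∏ (αᵢ t)ʳ` for every integer
`r`, so it contains `t⁻ᵈ` (`T_neg_mem_range`), and the submodule contains the generator.

Converse. An irreducible subquotient has a homogeneous vector `x` of highest weight `-2n`. Its
annihilator in `U(H)` contains the kernel of `psi 𝕜 n` and gives a proper ideal of the image. The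
Laurent polynomials are integral over this image, so lying over and the Nullstellensatz give a
character that kills the ideal, hence a point `(α₁, …, αₙ)` and a function `φ`. Homogeneity of `x`
passes from the character to `φ̃` (`tilde_eq_zero_of_smul`), and `smul_incF_eq_zero` applies again.

Two devices avoid bases of induced modules: gradings are shown to be direct by an operator with
eigenvalue `2ᵈ` in degree `d`, and `U(𝔤) C` has only `C` in its top weight
(`IsHighest.mem_of_mem_wt`). -/

/-- A subspace stable under an operator contains the summands of a sum of eigenvectors with
distinct eigenvalues, as soon as it contains the sum. -/
theorem mem_of_sum_eigenvectors {K V ι : Type*} [Field K] [AddCommGroup V] [Module K V]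
    (D : Module.End K V) (p : Submodule K V) (hp : ∀ x ∈ p, D x ∈ p) {μ : ι → K}
    (hμ : Function.Injective μ) (s : Finset ι) :
    ∀ x : ι → V, (∀ i ∈ s, D (x i) = μ i • x i) → ∑ i ∈ s, x i ∈ p → ∀ i ∈ s, x i ∈ p := by
  classical
  induction s using Finset.induction_on with
  | empty => simp
  | insert a s ha ih =>
    intro x hx hsum
    -- Applying `D - μ a` removes the summand `x a` and rescales the others by non-zero scalars.
    have h1 : ∑ i ∈ s, (μ i - μ a) • x i ∈ p := by
      have h2 := p.sub_mem (hp _ hsum) (p.smul_mem (μ a) hsum)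
      rw [map_sum, Finset.smul_sum, ← Finset.sum_sub_distrib, Finset.sum_insert ha,
        hx a (Finset.mem_insert_self a s), sub_self, zero_add] at h2
      refine (Finset.sum_congr rfl fun i hi => ?_).subst (motive := fun z => z ∈ p) h2
      rw [hx i (Finset.mem_insert_of_mem hi), sub_smul]
    have h3 : ∀ i ∈ s, x i ∈ p := by
      intro i hi
      have h4 := ih (fun i => (μ i - μ a) • x i) (fun i hi => by
        rw [map_smul, hx i (Finset.mem_insert_of_mem hi), smul_comm]) h1 i hi
      have hne : μ i - μ a ≠ 0 := sub_ne_zero.2 fun h => ha (hμ h ▸ hi)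
      exact (p.smul_mem_iff hne).1 h4
    intro i hi
    rcases Finset.mem_insert.1 hi with rfl | hi
    · rw [Finset.sum_insert ha] at hsum
      exact (p.add_mem_iff_left (p.sum_mem h3)).1 hsum
    · exact h3 i hi

/-! ### Generation of enveloping algebras. -/

section Enveloping

/-- A subalgebra of an enveloping algebra that contains the Lie algebra is everything. -/
theorem enveloping_subalgebra_eq_top {R L : Type*} [CommRing R] [LieRing L] [LieAlgebra R L]
    (A : Subalgebra R (UniversalEnvelopingAlgebra R L))
    (hA : ∀ x, UniversalEnvelopingAlgebra.ι R x ∈ A) : A = ⊤ := by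
  let g : L →ₗ⁅R⁆ A :=
    { toFun := fun x => ⟨UniversalEnvelopingAlgebra.ι R x, hA x⟩
      map_add' := fun x y => Subtype.ext (map_add _ _ _)
      map_smul' := fun c x => Subtype.ext (map_smul _ _ _)
      map_lie' := by
        intro x y
        exact Subtype.ext (LieHom.map_lie _ _ _) }
  have h1 : A.val.comp (UniversalEnvelopingAlgebra.lift R g) = AlgHom.id R _ := by
    apply UniversalEnvelopingAlgebra.hom_ext
    ext x
    change (UniversalEnvelopingAlgebra.lift R g (UniversalEnvelopingAlgebra.ι R x)).val =
      UniversalEnvelopingAlgebra.ι R x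
    rw [UniversalEnvelopingAlgebra.lift_ι_apply]
    rfl
  refine eq_top_iff.2 fun u _ => ?_
  have h2 := DFunLike.congr_fun h1 u
  rw [AlgHom.id_apply] at h2
  rw [← h2]
  exact (UniversalEnvelopingAlgebra.lift R g u).2

end Enveloping

/-! ### Generators and commutation relations in `U(𝔤)` and `U(H)`. -/

variable {𝕜 : Type*} [Field 𝕜]

/-- The element `e(k)` of `U(𝔤)`. -/
def uE (k : ℤ) : UG 𝕜 := toUG (loop (e 𝕜) k)

/-- The element `h(k)` of `U(𝔤)`. -/
def uH (k : ℤ) : UG 𝕜 := toUG (loop (h 𝕜) k)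

/-- The element `f(k)` of `U(𝔤)`. -/
def uF (k : ℤ) : UG 𝕜 := toUG (loop (f 𝕜) k)

theorem sl2_eq (x : Sl2 𝕜) :
    x = x.val 0 1 • e 𝕜 + x.val 0 0 • h 𝕜 + x.val 1 0 • f 𝕜 := by
  have htr : x.val 0 0 + x.val 1 1 = 0 := by
    have h1 : Matrix.trace x.val = 0 := (LinearMap.mem_ker).1 x.2
    simpa [Matrix.trace_fin_two] using h1
  apply Subtype.ext
  ext i j
  fin_cases i <;> fin_cases j <;> simp [e, f, h, Matrix.single]
  linear_combination htr

theorem toUG_add (x y : G 𝕜) : toUG (x + y) = toUG x + toUG y :=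
  map_add (UniversalEnvelopingAlgebra.ι 𝕜) x y

theorem toUG_smul (c : 𝕜) (x : G 𝕜) : toUG (c • x) = c • toUG x :=
  map_smul (UniversalEnvelopingAlgebra.ι 𝕜) c x

theorem toUG_lie (x y : G 𝕜) : toUG ⁅x, y⁆ = toUG x * toUG y - toUG y * toUG x :=
  LieHom.map_lie (UniversalEnvelopingAlgebra.ι 𝕜) x y

theorem toUG_loop (x : Sl2 𝕜) (k : ℤ) :
    toUG (loop x k) = x.val 0 1 • uE k + x.val 0 0 • uH k + x.val 1 0 • uF k := by
  conv_lhs => rw [sl2_eq x]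
  simp only [loop, TensorProduct.tmul_add, TensorProduct.tmul_smul, toUG_add, toUG_smul]
  rfl

theorem loop_lie (x y : Sl2 𝕜) (k l : ℤ) : ⁅loop x k, loop y l⁆ = loop ⁅x, y⁆ (k + l) := by
  rw [loop, loop, LieAlgebra.ExtendScalars.bracket_tmul, ← LaurentPolynomial.T_add, loop]

theorem toUG_loop_commutator (x y : Sl2 𝕜) (k l : ℤ) :
    toUG (loop x k) * toUG (loop y l) = toUG (loop y l) * toUG (loop x k) +
      toUG (loop ⁅x, y⁆ (k + l)) := by
  rw [← loop_lie, toUG_lie]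
  abel

theorem lie_h_f : ⁅h 𝕜, f 𝕜⁆ = -((2 : 𝕜) • f 𝕜) := by
  apply Subtype.ext
  rw [LieAlgebra.SpecialLinear.sl_bracket]
  ext i j
  fin_cases i <;> fin_cases j <;> norm_num [h, f, Matrix.mul_apply, Matrix.single]

theorem lie_h_e : ⁅h 𝕜, e 𝕜⁆ = (2 : 𝕜) • e 𝕜 := by
  apply Subtype.ext
  rw [LieAlgebra.SpecialLinear.sl_bracket]
  ext i j
  fin_cases i <;> fin_cases j <;> norm_num [h, e, Matrix.mul_apply, Matrix.single]

theorem lie_e_f : ⁅e 𝕜, f 𝕜⁆ = h 𝕜 := by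
  apply Subtype.ext
  rw [LieAlgebra.SpecialLinear.sl_bracket]
  ext i j
  fin_cases i <;> fin_cases j <;> norm_num [h, e, f, Matrix.mul_apply, Matrix.single]

theorem loop_smul (c : 𝕜) (x : Sl2 𝕜) (k : ℤ) : loop (c • x) k = c • loop x k :=
  TensorProduct.tmul_smul _ _ _

theorem uH_mul_uF (k l : ℤ) : (uH k * uF l : UG 𝕜) = uF l * uH k - (2 : 𝕜) • uF (k + l) := by
  rw [uH, uF, toUG_loop_commutator, lie_h_f, ← neg_smul, loop_smul, toUG_smul, neg_smul,
    ← sub_eq_add_neg, uF]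

theorem uH_mul_uE (k l : ℤ) : (uH k * uE l : UG 𝕜) = uE l * uH k + (2 : 𝕜) • uE (k + l) := by
  rw [uH, uE, toUG_loop_commutator, lie_h_e, loop_smul, toUG_smul, uE]

theorem uE_mul_uF (k l : ℤ) : (uE k * uF l : UG 𝕜) = uF l * uE k + uH (k + l) := by
  rw [uE, uF, toUG_loop_commutator, lie_e_f, uH]

theorem uH_mul_uH (k l : ℤ) : (uH k * uH l : UG 𝕜) = uH l * uH k := by
  rw [uH, uH, toUG_loop_commutator, lie_self]
  simp [loop, toUG]

theorem toUG_tmul (p : 𝕜[T;T⁻¹]) (x : Sl2 𝕜) (A : Submodule 𝕜 (UG 𝕜))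
    (hA : ∀ k, toUG (loop x k) ∈ A) : toUG (p ⊗ₜ[𝕜] x) ∈ A := by
  induction p using LaurentPolynomial.induction_on' with
  | add p q hp hq => rw [TensorProduct.add_tmul, toUG_add]; exact A.add_mem hp hq
  | C_mul_T k a =>
    rw [← LaurentPolynomial.smul_eq_C_mul, ← TensorProduct.smul_tmul', toUG_smul]
    exact A.smul_mem _ (hA k)

/-- A subalgebra of `U(𝔤)` containing all `x(k)` is everything. -/
theorem ug_subalgebra_eq_top (A : Subalgebra 𝕜 (UG 𝕜)) (hA : ∀ x k, toUG (loop x k) ∈ A) :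
    A = ⊤ := by
  refine enveloping_subalgebra_eq_top A fun x => ?_
  induction x using TensorProduct.induction_on with
  | zero => rw [map_zero]; exact A.zero_mem
  | tmul p x => exact toUG_tmul p x A.toSubmodule (hA x)
  | add x y hx hy => rw [map_add]; exact A.add_mem hx hy

/-- A subspace of `U(𝔤)` which contains `1` and is stable under left multiplication by
`e(k)`, `h(k)`, `f(k)` is everything. -/
theorem ug_eq_top (S : Submodule 𝕜 (UG 𝕜)) (h1 : 1 ∈ S)
    (hx : ∀ x k, ∀ u ∈ S, toUG (loop x k) * u ∈ S) : S = ⊤ := by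
  -- The elements whose left multiplication preserves `S` form a subalgebra; it contains the
  -- generators, and applying it to `1` fills `S`.
  let A : Subalgebra 𝕜 (UG 𝕜) :=
    { carrier := {a | ∀ u ∈ S, a * u ∈ S}
      mul_mem' := fun {a b} ha hb u hu => by rw [mul_assoc]; exact ha _ (hb _ hu)
      add_mem' := fun {a b} ha hb u hu => by rw [add_mul]; exact S.add_mem (ha _ hu) (hb _ hu)
      algebraMap_mem' := fun r u hu => by rw [← Algebra.smul_def]; exact S.smul_mem r hu }
  have hA : A = ⊤ := ug_subalgebra_eq_top A hx
  refine eq_top_iff.2 fun u _ => ?_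
  have h2 : u ∈ A := hA ▸ Algebra.mem_top
  simpa using h2 1 h1

theorem hH_induction {p : H 𝕜 → Prop} (hadd : ∀ x y, p x → p y → p (x + y))
    (hsmul : ∀ (c : 𝕜) x, p x → p (c • x)) (hh : ∀ k, p (hH k)) (y : H 𝕜) : p y := by
  obtain ⟨_, q, rfl⟩ := y
  induction q using LaurentPolynomial.induction_on' with
  | add q r hq hr =>
    refine (congrArg p (Subtype.ext ?_)).mp (hadd _ _ hq hr)
    exact (map_add ((TensorProduct.mk 𝕜 𝕜[T;T⁻¹] (Sl2 𝕜)).flip (h 𝕜)) q r).symm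
  | C_mul_T k a =>
    refine (congrArg p (Subtype.ext ?_)).mp (hsmul a _ (hh k))
    rw [← LaurentPolynomial.smul_eq_C_mul]
    exact (map_smul ((TensorProduct.mk 𝕜 𝕜[T;T⁻¹] (Sl2 𝕜)).flip (h 𝕜)) a _).symm

/-- The element `h(k)` of `U(H)`. -/
def yH (k : ℤ) : UH 𝕜 := toUH (hH k)

/-- A subalgebra of `U(H)` containing all `h(k)` is everything. -/
theorem uh_subalgebra_eq_top (A : Subalgebra 𝕜 (UH 𝕜)) (hA : ∀ k, yH k ∈ A) : A = ⊤ := by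
  refine enveloping_subalgebra_eq_top A fun y => ?_
  induction y using hH_induction with
  | hadd x y hx hy => rw [map_add]; exact A.add_mem hx hy
  | hsmul c x hx => rw [map_smul]; exact A.smul_mem hx c
  | hh k => exact hA k

/-- A subspace of `U(H)` which contains `1` and is stable under left multiplication by the `h(k)`
is everything. -/
theorem uh_eq_top (S : Submodule 𝕜 (UH 𝕜)) (h1 : 1 ∈ S)
    (hx : ∀ k, ∀ u ∈ S, yH k * u ∈ S) : S = ⊤ := by
  let A : Subalgebra 𝕜 (UH 𝕜) :=
    { carrier := {a | ∀ u ∈ S, a * u ∈ S}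
      mul_mem' := fun {a b} ha hb u hu => by rw [mul_assoc]; exact ha _ (hb _ hu)
      add_mem' := fun {a b} ha hb u hu => by rw [add_mul]; exact S.add_mem (ha _ hu) (hb _ hu)
      algebraMap_mem' := fun r u hu => by rw [← Algebra.smul_def]; exact S.smul_mem r hu }
  have hA : A = ⊤ := uh_subalgebra_eq_top A hx
  refine eq_top_iff.2 fun u _ => ?_
  have h2 : u ∈ A := hA ▸ Algebra.mem_top
  simpa using h2 1 h1

/-- Algebra homomorphisms from `U(H)` are determined by the images of the `h(k)`. -/
theorem uh_hom_ext {A : Type*} [Ring A] [Algebra 𝕜 A] {g₁ g₂ : UH 𝕜 →ₐ[𝕜] A}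
    (hg : ∀ k, g₁ (yH k) = g₂ (yH k)) : g₁ = g₂ := by
  have h1 := uh_subalgebra_eq_top (AlgHom.equalizer g₁ g₂) hg
  ext1
  ext y
  have : UniversalEnvelopingAlgebra.ι 𝕜 y ∈ AlgHom.equalizer g₁ g₂ := h1 ▸ Algebra.mem_top
  exact this

/-- The inclusion `U(H) → U(𝔤)`. -/
def incUH : UH 𝕜 →ₐ[𝕜] UG 𝕜 :=
  UniversalEnvelopingAlgebra.lift 𝕜 ((UniversalEnvelopingAlgebra.ι 𝕜).comp (H 𝕜).incl)

theorem incUH_toUH (y : H 𝕜) : incUH (toUH y) = toUG (y : G 𝕜) :=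
  UniversalEnvelopingAlgebra.lift_ι_apply 𝕜 _ _

@[simp]
theorem incUH_yH (k : ℤ) : incUH (yH k : UH 𝕜) = uH k := incUH_toUH _

/-! ### The grading of `U(𝔤)` by degree in `t`. -/

section UGGrading

theorem toUG_mem_ugGrading (x : Sl2 𝕜) (k : ℤ) : toUG (loop x k) ∈ ugGrading (𝕜 := 𝕜) k :=
  Submodule.subset_span ⟨[(x, k)], by simp, by simp⟩

theorem one_mem_ugGrading : (1 : UG 𝕜) ∈ ugGrading (𝕜 := 𝕜) 0 :=
  Submodule.subset_span ⟨[], by simp, by simp⟩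

theorem mul_mem_ugGrading {i j : ℤ} {u v : UG 𝕜} (hu : u ∈ ugGrading (𝕜 := 𝕜) i)
    (hv : v ∈ ugGrading (𝕜 := 𝕜) j) : u * v ∈ ugGrading (𝕜 := 𝕜) (i + j) := by
  have h1 := Submodule.mul_mem_mul hu hv
  rw [ugGrading, ugGrading, Submodule.span_mul_span] at h1
  refine Submodule.span_mono ?_ h1
  rintro _ ⟨_, ⟨l, rfl, rfl⟩, _, ⟨l', rfl, rfl⟩, rfl⟩
  exact ⟨l ++ l', by simp, by simp⟩

theorem iSup_ugGrading : ⨆ d, ugGrading (𝕜 := 𝕜) d = ⊤ := by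
  refine ug_eq_top _ (Submodule.mem_iSup_of_mem 0 one_mem_ugGrading) fun x k u hu => ?_
  induction hu using Submodule.iSup_induction' with
  | mem i u hu => exact Submodule.mem_iSup_of_mem _ (mul_mem_ugGrading (toUG_mem_ugGrading x k) hu)
  | zero => rw [mul_zero]; exact Submodule.zero_mem _
  | add u v _ _ hu hv => rw [mul_add]; exact Submodule.add_mem _ hu hv

end UGGrading

/-! ### Graded modules and homogeneous components. -/

section Modules

variable {M : Type*} [AddCommGroup M] [Module 𝕜 M] [Module (UG 𝕜) M] [IsScalarTower 𝕜 (UG 𝕜) M]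

theorem IsGrading.ug_smul_mem {𝓜 : ℤ → Submodule 𝕜 M} (hM : IsGrading 𝓜) {i d : ℤ} {u : UG 𝕜}
    (hu : u ∈ ugGrading (𝕜 := 𝕜) i) {m : M} (hm : m ∈ 𝓜 d) : u • m ∈ 𝓜 (d + i) := by
  induction hu using Submodule.span_induction with
  | mem u hu =>
    obtain ⟨l, rfl, rfl⟩ := hu
    induction l with
    | nil => simpa using hm
    | cons p l ih =>
      have h1 := hM.smul_mem p.1 p.2 _ _ ih
      rw [List.map_cons, List.sum_cons, add_comm p.2, ← add_assoc, List.map_cons, List.prod_cons,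
        mul_smul]
      exact h1
  | zero => rw [zero_smul]; exact Submodule.zero_mem _
  | add u v _ _ hu hv => rw [add_smul]; exact Submodule.add_mem _ hu hv
  | smul a u _ hu => rw [smul_assoc]; exact Submodule.smul_mem _ a hu

theorem IsGrading.bijective {𝓜 : ℤ → Submodule 𝕜 M} (hM : IsGrading 𝓜) :
    Function.Bijective (DirectSum.coeLinearMap 𝓜) := hM.isInternal

/-- The projection onto the component of degree `d`. -/
def comp {𝓜 : ℤ → Submodule 𝕜 M} (hM : IsGrading 𝓜) (d : ℤ) : M →ₗ[𝕜] M :=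
  (𝓜 d).subtype ∘ₗ DirectSum.component 𝕜 ℤ (fun i => 𝓜 i) d ∘ₗ
    (LinearEquiv.ofBijective (DirectSum.coeLinearMap 𝓜) hM.bijective).symm.toLinearMap

section Comp

variable {𝓜 : ℤ → Submodule 𝕜 M} (hM : IsGrading 𝓜)

theorem comp_mem (d : ℤ) (m : M) : comp hM d m ∈ 𝓜 d := Subtype.property _

theorem comp_of_mem_aux {d : ℤ} {m : M} (hm : m ∈ 𝓜 d) :
    (LinearEquiv.ofBijective (DirectSum.coeLinearMap 𝓜) hM.bijective).symm m =
      DirectSum.lof 𝕜 ℤ (fun i => 𝓜 i) d ⟨m, hm⟩ := by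
  rw [LinearEquiv.symm_apply_eq]
  simp

theorem comp_of_mem {d : ℤ} {m : M} (hm : m ∈ 𝓜 d) : comp hM d m = m := by
  simp [comp, comp_of_mem_aux hM hm, DirectSum.component.of]

theorem comp_of_mem_ne {d d' : ℤ} {m : M} (hm : m ∈ 𝓜 d) (hd : d ≠ d') : comp hM d' m = 0 := by
  simp [comp, comp_of_mem_aux hM hm, DirectSum.component.of, hd]

include hM in
theorem iSup_eq_top_of_isGrading : ⨆ d, 𝓜 d = ⊤ :=
  hM.isInternal.submodule_iSup_eq_top

theorem exists_sum_comp (m : M) : ∃ s : Finset ℤ, m = ∑ d ∈ s, comp hM d m := by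
  obtain ⟨g, hg, rfl⟩ := (Submodule.mem_iSup_iff_exists_finsupp 𝓜 m).1
    (iSup_eq_top_of_isGrading hM ▸ Submodule.mem_top)
  refine ⟨g.support, ?_⟩
  rw [Finsupp.sum]
  refine Finset.sum_congr rfl fun d hd => ?_
  rw [map_sum, Finset.sum_eq_single d, comp_of_mem hM (hg d)]
  · intro i _ hi
    exact comp_of_mem_ne hM (hg i) hi
  · intro h
    rw [Finsupp.notMem_support_iff.1 h, map_zero]

include hM in
theorem eq_zero_of_comp {m : M} (hm : ∀ d, comp hM d m = 0) : m = 0 := by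
  obtain ⟨s, hs⟩ := exists_sum_comp hM m
  rw [hs]
  exact Finset.sum_eq_zero fun d _ => hm d

theorem comp_smul {j : ℤ} {u : UG 𝕜} (hu : u ∈ ugGrading (𝕜 := 𝕜) j) (d : ℤ) (m : M) :
    comp hM (d + j) (u • m) = u • comp hM d m := by
  have hm : m ∈ ⨆ i, 𝓜 i := iSup_eq_top_of_isGrading hM ▸ Submodule.mem_top
  induction hm using Submodule.iSup_induction' with
  | mem i m hm =>
    have h1 := hM.ug_smul_mem hu hm
    by_cases hi : i = d
    · subst hi
      rw [comp_of_mem hM hm, comp_of_mem hM h1]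
    · rw [comp_of_mem_ne hM hm hi, comp_of_mem_ne hM h1 (by omega), smul_zero]
  | zero => simp
  | add x y _ _ hx hy => rw [smul_add, map_add, hx, hy, map_add, smul_add]

theorem isGradedSubmodule_iff {Q : Submodule (UG 𝕜) M} :
    IsGradedSubmodule 𝓜 Q ↔ ∀ m ∈ Q, ∀ d, comp hM d m ∈ Q := by
  constructor
  · intro hQ m hm d
    have h1 : m ∈ ⨆ d, Q.restrictScalars 𝕜 ⊓ 𝓜 d := by rw [← hQ]; exact hm
    clear hm
    induction h1 using Submodule.iSup_induction' with
    | mem i m hm =>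
      by_cases hi : i = d
      · subst hi
        rw [comp_of_mem hM hm.2]
        exact hm.1
      · rw [comp_of_mem_ne hM hm.2 hi]
        exact Q.zero_mem
    | zero => rw [map_zero]; exact Q.zero_mem
    | add x y _ _ hx hy => rw [map_add]; exact Q.add_mem hx hy
  · intro hQ
    refine le_antisymm (fun m hm => ?_) (iSup_le fun d => inf_le_left)
    obtain ⟨s, hs⟩ := exists_sum_comp hM m
    rw [hs]
    exact Submodule.sum_mem _ fun d _ => Submodule.mem_iSup_of_mem d ⟨hQ m hm d, comp_mem hM d m⟩

/-- Homogeneous components of an element of a cyclic module generated by a homogeneous vector. -/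
theorem exists_comp_smul_eq {s : ℤ} {w : M} (hw : w ∈ 𝓜 s) (u : UG 𝕜) (d : ℤ) :
    ∃ u' ∈ ugGrading (𝕜 := 𝕜) (d - s), comp hM d (u • w) = u' • w := by
  have hu : u ∈ ⨆ i, ugGrading (𝕜 := 𝕜) i := iSup_ugGrading (𝕜 := 𝕜) ▸ Submodule.mem_top
  induction hu using Submodule.iSup_induction' with
  | mem i u hu =>
    have h1 := hM.ug_smul_mem hu hw
    by_cases hi : s + i = d
    · subst hi
      exact ⟨u, by simpa using hu, comp_of_mem hM h1⟩
    · exact ⟨0, Submodule.zero_mem _, by rw [comp_of_mem_ne hM h1 hi, zero_smul]⟩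
  | zero => exact ⟨0, Submodule.zero_mem _, by simp⟩
  | add u v _ _ hu hv =>
    obtain ⟨u', hu', hu⟩ := hu
    obtain ⟨v', hv', hv⟩ := hv
    exact ⟨u' + v', Submodule.add_mem _ hu' hv', by rw [add_smul, map_add, hu, hv, add_smul]⟩

end Comp

/-- In characteristic zero the scalars `2 ^ d` are distinct, so the components lie in different
eigenspaces of `D` and are independent. -/
theorem isGrading_of_eigen [CharZero 𝕜] {𝓜 : ℤ → Submodule 𝕜 M} (D : Module.End 𝕜 M)
    (hD : ∀ d, ∀ m ∈ 𝓜 d, D m = (2 : 𝕜) ^ d • m) (htop : ⨆ d, 𝓜 d = ⊤)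
    (hsmul : ∀ (x : Sl2 𝕜) (k d : ℤ), ∀ m ∈ 𝓜 d, toUG (loop x k) • m ∈ 𝓜 (d + k)) :
    IsGrading 𝓜 := by
  refine ⟨(DirectSum.isInternal_submodule_iff_iSupIndep_and_iSup_eq_top 𝓜).2 ⟨?_, htop⟩, hsmul⟩
  have hinj : Function.Injective fun d : ℤ => (2 : 𝕜) ^ d := by
    intro a b hab
    have h1 : (((2 : ℚ) ^ a : ℚ) : 𝕜) = (((2 : ℚ) ^ b : ℚ) : 𝕜) := by push_cast; exact hab
    exact zpow_right_injective₀ (by norm_num) (by norm_num) (Rat.cast_injective h1)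
  refine ((Module.End.eigenspaces_iSupIndep D).comp hinj).mono fun d m hm => ?_
  exact Module.End.mem_eigenspace_iff.2 (hD d m hm)

/-! ### Weight spaces and modules generated by highest weight vectors. -/

variable (M) in
/-- The eigenspaces of `h(0)`. -/
def wt (c : 𝕜) : Submodule 𝕜 M where
  carrier := {m | (uH 0 : UG 𝕜) • m = c • m}
  add_mem' := fun {a b} ha hb => by
    change _ = _ at ha hb ⊢
    rw [smul_add, smul_add, ha, hb]
  zero_mem' := by simp
  smul_mem' := fun a m hm => by
    change _ = _ at hm ⊢
    rw [smul_comm, hm, smul_comm]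

theorem mem_wt {c : 𝕜} {m : M} : m ∈ wt M c ↔ (uH 0 : UG 𝕜) • m = c • m := Iff.rfl

theorem uH_smul_mem_wt {c : 𝕜} {m : M} (k : ℤ) (hm : m ∈ wt M c) :
    (uH k : UG 𝕜) • m ∈ wt M c := by
  rw [mem_wt] at *
  rw [← mul_smul, uH_mul_uH, mul_smul, hm, smul_comm]

theorem uF_smul_mem_wt {c : 𝕜} {m : M} (k : ℤ) (hm : m ∈ wt M c) :
    (uF k : UG 𝕜) • m ∈ wt M (c - 2) := by
  rw [mem_wt] at *
  rw [← mul_smul, uH_mul_uF, zero_add, sub_smul, mul_smul, hm, smul_comm, sub_smul, smul_assoc]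

theorem uE_smul_mem_wt {c : 𝕜} {m : M} (k : ℤ) (hm : m ∈ wt M c) :
    (uE k : UG 𝕜) • m ∈ wt M (c + 2) := by
  rw [mem_wt] at *
  rw [← mul_smul, uH_mul_uE, zero_add, add_smul, mul_smul, hm, smul_comm, add_smul, smul_assoc]

/-- `h(0)` has degree zero, so it commutes with the homogeneous projections. -/
theorem comp_mem_wt {𝓜 : ℤ → Submodule 𝕜 M} (hM : IsGrading 𝓜) {c : 𝕜} {m : M}
    (hm : m ∈ wt M c) (d : ℤ) : comp hM d m ∈ wt M c := by
  rw [mem_wt] at *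
  rw [uH, ← comp_smul hM (toUG_mem_ugGrading (h 𝕜) 0), add_zero]
  exact (congrArg (comp hM d) hm).trans (map_smul _ _ _)

theorem toUG_smul_mem {S : Submodule 𝕜 M} {m : M} {k : ℤ} (he : (uE k : UG 𝕜) • m ∈ S)
    (hh : (uH k : UG 𝕜) • m ∈ S) (hf : (uF k : UG 𝕜) • m ∈ S) (x : Sl2 𝕜) :
    toUG (loop x k) • m ∈ S := by
  rw [toUG_loop, add_smul, add_smul, smul_assoc, smul_assoc, smul_assoc]
  exact S.add_mem (S.add_mem (S.smul_mem _ he) (S.smul_mem _ hh)) (S.smul_mem _ hf)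

/-- A subspace stable under the `x(k)` is stable under `U(𝔤)`. -/
theorem ug_smul_mem {S : Submodule 𝕜 M} (hS : ∀ (x : Sl2 𝕜) (k : ℤ), ∀ m ∈ S, toUG (loop x k) • m ∈ S)
    (u : UG 𝕜) {m : M} (hm : m ∈ S) : u • m ∈ S := by
  have h1 : S.comap ((Algebra.lsmul 𝕜 𝕜 M).toLinearMap.flip m) = ⊤ :=
    ug_eq_top _ (by simpa using hm) fun x k u hu => by
      have := hS x k _ hu
      simpa [mul_smul] using this
  have h2 : u ∈ S.comap ((Algebra.lsmul 𝕜 𝕜 M).toLinearMap.flip m) := h1 ▸ Submodule.mem_top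
  simpa using h2

/-- An `H`-submodule of weight `c` annihilated by `E`. -/
structure IsHighest (C : Submodule 𝕜 M) (c : 𝕜) : Prop where
  uH_mem : ∀ k, ∀ m ∈ C, (uH k : UG 𝕜) • m ∈ C
  uE_eq_zero : ∀ k, ∀ m ∈ C, (uE k : UG 𝕜) • m = 0
  le_wt : C ≤ wt M c

/-- The span of the vectors `f(k₁) ⋯ f(kᵣ) x` with `x ∈ C`. -/
def layer (C : Submodule 𝕜 M) : ℕ → Submodule 𝕜 M
  | 0 => C
  | r + 1 => Submodule.span 𝕜 {m | ∃ k : ℤ, ∃ x ∈ layer C r, m = (uF k : UG 𝕜) • x}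

theorem uF_smul_mem_layer {C : Submodule 𝕜 M} {r : ℕ} {m : M} (k : ℤ) (hm : m ∈ layer C r) :
    (uF k : UG 𝕜) • m ∈ layer C (r + 1) :=
  Submodule.subset_span ⟨k, m, hm, rfl⟩

theorem layer_succ_induction {C S : Submodule 𝕜 M} {r : ℕ} (u : UG 𝕜)
    (hS : ∀ k : ℤ, ∀ x ∈ layer C r, u • (uF k : UG 𝕜) • x ∈ S) {m : M}
    (hm : m ∈ layer C (r + 1)) : u • m ∈ S := by
  induction hm using Submodule.span_induction with
  | mem m hm => obtain ⟨k, x, hx, rfl⟩ := hm; exact hS k x hx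
  | zero => rw [smul_zero]; exact S.zero_mem
  | add x y _ _ hx hy => rw [smul_add]; exact S.add_mem hx hy
  | smul a x _ hx => rw [smul_comm]; exact S.smul_mem a hx

namespace IsHighest

variable {C : Submodule 𝕜 M} {c : 𝕜} (hC : IsHighest C c)
include hC

theorem uH_smul_mem_layer (r : ℕ) : ∀ k : ℤ, ∀ m ∈ layer C r, (uH k : UG 𝕜) • m ∈ layer C r := by
  induction r with
  | zero => exact hC.uH_mem
  | succ r ih =>
    intro k m hm
    refine layer_succ_induction _ (fun l x hx => ?_) hm
    rw [← mul_smul, uH_mul_uF, sub_smul, mul_smul, smul_assoc]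
    exact Submodule.sub_mem _ (uF_smul_mem_layer _ (ih k x hx))
      (Submodule.smul_mem _ _ (uF_smul_mem_layer _ hx))

/-- Moving `e(k)` past the leading `f(l)` costs `h(k+l)`, which preserves each layer; at the bottom
`e(k)` kills `C`. -/
theorem uE_smul_mem_layer (r : ℕ) :
    ∀ k : ℤ, ∀ m ∈ layer C (r + 1), (uE k : UG 𝕜) • m ∈ layer C r := by
  induction r with
  | zero =>
    intro k m hm
    refine layer_succ_induction _ (fun l x hx => ?_) hm
    rw [← mul_smul, uE_mul_uF, add_smul, mul_smul, hC.uE_eq_zero k x hx, smul_zero, zero_add]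
    exact hC.uH_mem _ x hx
  | succ r ih =>
    intro k m hm
    refine layer_succ_induction _ (fun l x hx => ?_) hm
    rw [← mul_smul, uE_mul_uF, add_smul, mul_smul]
    exact Submodule.add_mem _ (uF_smul_mem_layer _ (ih k x hx))
      (hC.uH_smul_mem_layer _ _ x hx)

theorem layer_le_wt (r : ℕ) : layer C r ≤ wt M (c - 2 * r) := by
  induction r with
  | zero => simpa [layer] using hC.le_wt
  | succ r ih =>
    refine Submodule.span_le.2 ?_
    rintro _ ⟨k, x, hx, rfl⟩
    have h1 := uF_smul_mem_wt k (ih hx)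
    rw [show c - 2 * ((r + 1 : ℕ) : 𝕜) = c - 2 * r - 2 by push_cast; ring]
    exact h1

theorem span_le_iSup_layer :
    (Submodule.span (UG 𝕜) (C : Set M)).restrictScalars 𝕜 ≤ ⨆ r, layer C r := by
  have hS : ∀ (x : Sl2 𝕜) (k : ℤ), ∀ m ∈ ⨆ r, layer C r,
      toUG (loop x k) • m ∈ ⨆ r, layer C r := by
    intro x k m hm
    induction hm using Submodule.iSup_induction' with
    | mem r m hm =>
      refine toUG_smul_mem ?_ (Submodule.mem_iSup_of_mem r (hC.uH_smul_mem_layer r k m hm))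
        (Submodule.mem_iSup_of_mem _ (uF_smul_mem_layer k hm)) x
      cases r with
      | zero => rw [hC.uE_eq_zero k m hm]; exact Submodule.zero_mem _
      | succ r => exact Submodule.mem_iSup_of_mem r (hC.uE_smul_mem_layer r k m hm)
    | zero => rw [smul_zero]; exact Submodule.zero_mem _
    | add x y _ _ hx hy => rw [smul_add]; exact Submodule.add_mem _ hx hy
  intro m hm
  induction hm using Submodule.span_induction with
  | mem m hm => exact Submodule.mem_iSup_of_mem 0 hm
  | zero => exact Submodule.zero_mem _
  | add x y _ _ hx hy => exact Submodule.add_mem _ hx hy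
  | smul u m _ hm => exact ug_smul_mem hS u hm

theorem exists_sum {m : M} (hm : m ∈ Submodule.span (UG 𝕜) (C : Set M)) :
    ∃ g : ℕ →₀ M, (∀ r, g r ∈ layer C r) ∧ g.sum (fun _ x => x) = m :=
  (Submodule.mem_iSup_iff_exists_finsupp _ m).1 (hC.span_le_iSup_layer hm)

end IsHighest

/-! ### Separation of weights in characteristic zero. -/

section Weights

variable [CharZero 𝕜]

theorem weight_injective (c : 𝕜) : Function.Injective fun r : ℕ => c - 2 * (r : 𝕜) := by
  intro a b hab
  have h1 : (2 : 𝕜) * a = 2 * b := sub_right_injective hab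
  exact Nat.cast_injective (mul_left_cancel₀ two_ne_zero h1)

/-- A submodule contains the weight components of its elements. -/
theorem weight_component_mem {Q : Submodule (UG 𝕜) M} {c : 𝕜} {g : ℕ →₀ M}
    (hg : ∀ r : ℕ, g r ∈ wt M (c - 2 * (r : 𝕜))) (hQ : g.sum (fun _ x => x) ∈ Q) (r : ℕ) :
    g r ∈ Q := by
  by_cases hr : r ∈ g.support
  · exact mem_of_sum_eigenvectors (Algebra.lsmul 𝕜 𝕜 M (uH 0 : UG 𝕜)) (Q.restrictScalars 𝕜)
      (fun x hx => Q.smul_mem _ hx) (weight_injective c) g.support g (fun i _ => hg i) hQ r hr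
  · rw [Finsupp.notMem_support_iff.1 hr]
    exact Q.zero_mem

theorem eq_component_of_mem_wt {c : 𝕜} {g : ℕ →₀ M}
    (hg : ∀ r : ℕ, g r ∈ wt M (c - 2 * (r : 𝕜))) {r : ℕ}
    (hm : g.sum (fun _ x => x) ∈ wt M (c - 2 * (r : 𝕜))) : g.sum (fun _ x => x) = g r := by
  classical
  have h1 : ∀ i : ℕ, (g - Finsupp.single r (g.sum fun _ x => x)) i ∈ wt M (c - 2 * (i : 𝕜)) := by
    intro i
    rw [Finsupp.sub_apply, Finsupp.single_apply]
    split_ifs with h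
    · subst h
      exact Submodule.sub_mem _ (hg _) hm
    · rw [sub_zero]
      exact hg i
  -- Subtracting the total from the component of index `r` gives weight vectors with sum zero; over
  -- the submodule `⊥` each of them vanishes.
  have h2 := weight_component_mem (Q := (⊥ : Submodule (UG 𝕜) M)) h1 (by
    rw [Finsupp.sum_sub_index (fun _ _ _ => rfl), Finsupp.sum_single_index rfl, sub_self]
    exact Submodule.zero_mem _) r
  rw [Submodule.mem_bot, Finsupp.sub_apply, Finsupp.single_eq_same, sub_eq_zero] at h2
  exact h2.symm

/-- The part of weight `c - 2r` of the module generated by `C`. -/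
theorem IsHighest.mem_layer {C : Submodule 𝕜 M} {c : 𝕜} (hC : IsHighest C c) {m : M} {r : ℕ}
    (hm : m ∈ Submodule.span (UG 𝕜) (C : Set M)) (hw : m ∈ wt M (c - 2 * (r : 𝕜))) :
    m ∈ layer C r := by
  obtain ⟨g, hg, rfl⟩ := hC.exists_sum hm
  rw [eq_component_of_mem_wt (fun r => hC.layer_le_wt r (hg r)) hw]
  exact hg r

/-- The layers below `C` have smaller weights. This turns an element of `U(𝔤) C` of top weight into
one of `C`, and, for `C = U(H) w`, an element of `U(𝔤)` into one of `U(H)`. -/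
theorem IsHighest.mem_of_mem_wt {C : Submodule 𝕜 M} {c : 𝕜} (hC : IsHighest C c) {m : M}
    (hm : m ∈ Submodule.span (UG 𝕜) (C : Set M)) (hw : m ∈ wt M c) : m ∈ C :=
  hC.mem_layer (r := 0) hm (by simpa using hw)

end Weights

/-! ### The `H`-submodule of a highest weight vector. -/

section HighestVector

/-- The `H`-submodule generated by a vector, with the coefficients restricted to an ideal. -/
def uhSpan (I : Submodule 𝕜 (UH 𝕜)) (w : M) : Submodule 𝕜 M :=
  I.map ((Algebra.lsmul 𝕜 𝕜 M).toLinearMap.flip w ∘ₗ incUH.toLinearMap)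

theorem mem_uhSpan {I : Submodule 𝕜 (UH 𝕜)} {w m : M} :
    m ∈ uhSpan I w ↔ ∃ y ∈ I, incUH y • w = m := by
  simp [uhSpan]

theorem incUH_smul_mem_wt {c : 𝕜} {w : M} (hw : w ∈ wt M c) (y : UH 𝕜) :
    incUH y • w ∈ wt M c := by
  have h1 : (wt M c).comap ((Algebra.lsmul 𝕜 𝕜 M).toLinearMap.flip w ∘ₗ incUH.toLinearMap) = ⊤ :=
    uh_eq_top _ (by simpa using hw) fun k u hu => by
      have := uH_smul_mem_wt k hu
      simpa [mul_smul] using this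
  have h2 : y ∈ (wt M c).comap
    ((Algebra.lsmul 𝕜 𝕜 M).toLinearMap.flip w ∘ₗ incUH.toLinearMap) := h1 ▸ Submodule.mem_top
  simpa using h2

/-- The commutator of `h(k)` with `e(l)` is again a multiple of some `e(k+l)`, so being killed by
all of `E` is preserved by `H`. -/
theorem uE_incUH_smul {w : M} (hw : ∀ k, (uE k : UG 𝕜) • w = 0) (y : UH 𝕜) :
    ∀ k, (uE k : UG 𝕜) • incUH y • w = 0 := by
  let S : Submodule 𝕜 (UH 𝕜) :=
    { carrier := {y | ∀ k, (uE k : UG 𝕜) • incUH y • w = 0}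
      add_mem' := fun {a b} ha hb k => by rw [map_add, add_smul, smul_add, ha k, hb k, add_zero]
      zero_mem' := fun k => by simp
      smul_mem' := fun a y hy k => by rw [map_smul, smul_assoc, smul_comm, hy k, smul_zero] }
  have h1 : S = ⊤ := uh_eq_top _ (fun k => by simpa using hw k) fun k y hy l => by
    have h2 := uH_mul_uE (𝕜 := 𝕜) k l
    rw [← sub_eq_iff_eq_add] at h2
    rw [map_mul, incUH_yH, mul_smul, ← mul_smul, ← h2, sub_smul, mul_smul, hy l, smul_assoc, hy,
      smul_zero, smul_zero, sub_zero]
  have h2 : y ∈ S := h1 ▸ Submodule.mem_top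
  exact h2

theorem isHighest_uhSpan {c : 𝕜} {w : M} (hw : w ∈ wt M c) (he : ∀ k, (uE k : UG 𝕜) • w = 0)
    {I : Submodule 𝕜 (UH 𝕜)} (hI : ∀ k, ∀ y ∈ I, yH k * y ∈ I) : IsHighest (uhSpan I w) c where
  uH_mem k m hm := by
    obtain ⟨y, hy, rfl⟩ := mem_uhSpan.1 hm
    exact mem_uhSpan.2 ⟨yH k * y, hI k y hy, by rw [map_mul, incUH_yH, mul_smul]⟩
  uE_eq_zero k m hm := by
    obtain ⟨y, hy, rfl⟩ := mem_uhSpan.1 hm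
    exact uE_incUH_smul he y k
  le_wt := by
    intro m hm
    obtain ⟨y, hy, rfl⟩ := mem_uhSpan.1 hm
    exact incUH_smul_mem_wt hw y

end HighestVector

end Modules

/-! ### The automorphism `x(k) ↦ 2ᵏ x(k)`, which detects degrees. -/

section Scaling

variable [CharZero 𝕜]

/-- The automorphism `tᵏ ↦ 2ᵏ tᵏ` of the ring of Laurent polynomials. -/
def scaleLaurent : 𝕜[T;T⁻¹] →ₐ[𝕜] 𝕜[T;T⁻¹] :=
  AddMonoidAlgebra.lift 𝕜 𝕜[T;T⁻¹] ℤ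
    { toFun := fun k => (2 : 𝕜) ^ k.toAdd • (LaurentPolynomial.T k.toAdd : 𝕜[T;T⁻¹])
      map_one' := by simp
      map_mul' := fun k l => by
        rw [toAdd_mul, LaurentPolynomial.T_add, zpow_add₀ two_ne_zero, smul_mul_smul_comm] }

@[simp]
theorem scaleLaurent_T (k : ℤ) :
    scaleLaurent (LaurentPolynomial.T k : 𝕜[T;T⁻¹]) = (2 : 𝕜) ^ k • LaurentPolynomial.T k := by
  rw [scaleLaurent, LaurentPolynomial.T, AddMonoidAlgebra.lift_single, one_smul]
  rfl

theorem lieRing_zero_lie {L : Type*} [LieRing L] (y : L) : ⁅(0 : L), y⁆ = 0 := zero_lie y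

theorem lieRing_lie_zero {L : Type*} [LieRing L] (y : L) : ⁅y, (0 : L)⁆ = 0 := lie_zero y

theorem rTensor_scaleLaurent_lie (x y : G 𝕜) :
    LinearMap.rTensor (Sl2 𝕜) (scaleLaurent (𝕜 := 𝕜)).toLinearMap ⁅x, y⁆ =
      ⁅LinearMap.rTensor (Sl2 𝕜) (scaleLaurent (𝕜 := 𝕜)).toLinearMap x,
        LinearMap.rTensor (Sl2 𝕜) (scaleLaurent (𝕜 := 𝕜)).toLinearMap y⁆ := by
  induction x using TensorProduct.induction_on with
  | zero => rw [map_zero, lieRing_zero_lie, lieRing_zero_lie, map_zero]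
  | add x₁ x₂ h₁ h₂ => rw [LieRing.add_lie, map_add, h₁, h₂, map_add, LieRing.add_lie]
  | tmul p x =>
    induction y using TensorProduct.induction_on with
    | zero => rw [map_zero, lieRing_lie_zero, lieRing_lie_zero, map_zero]
    | add y₁ y₂ h₁ h₂ => rw [LieRing.lie_add, map_add, h₁, h₂, map_add, LieRing.lie_add]
    | tmul q y => simp [LieAlgebra.ExtendScalars.bracket_tmul]

/-- The automorphism `x(k) ↦ 2ᵏ x(k)` of the loop algebra. -/
def scaleG : G 𝕜 →ₗ⁅𝕜⁆ G 𝕜 :=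
  { LinearMap.rTensor (Sl2 𝕜) (scaleLaurent (𝕜 := 𝕜)).toLinearMap with
    map_lie' := fun {x y} => rTensor_scaleLaurent_lie x y }

theorem scaleG_loop (x : Sl2 𝕜) (k : ℤ) : scaleG (𝕜 := 𝕜) (loop x k) = (2 : 𝕜) ^ k • loop x k := by
  change LinearMap.rTensor (Sl2 𝕜) (scaleLaurent (𝕜 := 𝕜)).toLinearMap (loop x k) = _
  rw [loop, LinearMap.rTensor_tmul, AlgHom.toLinearMap_apply, scaleLaurent_T,
    TensorProduct.smul_tmul']

/-- The automorphism of `U(𝔤)` which multiplies elements of degree `d` by `2ᵈ`. -/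
def scaleUG : UG 𝕜 →ₐ[𝕜] UG 𝕜 :=
  UniversalEnvelopingAlgebra.lift 𝕜 ((UniversalEnvelopingAlgebra.ι 𝕜).comp scaleG)

theorem scaleUG_loop (x : Sl2 𝕜) (k : ℤ) :
    scaleUG (𝕜 := 𝕜) (toUG (loop x k)) = (2 : 𝕜) ^ k • toUG (loop x k) := by
  rw [← toUG_smul, ← scaleG_loop]
  exact UniversalEnvelopingAlgebra.lift_ι_apply 𝕜 _ _

theorem scaleUG_of_mem {d : ℤ} {u : UG 𝕜} (hu : u ∈ ugGrading (𝕜 := 𝕜) d) :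
    scaleUG u = (2 : 𝕜) ^ d • u := by
  induction hu using Submodule.span_induction with
  | mem u hu =>
    obtain ⟨l, rfl, rfl⟩ := hu
    induction l with
    | nil => simp
    | cons p l ih =>
      simp only [List.map_cons, List.prod_cons, List.sum_cons, map_mul] at ih ⊢
      rw [ih, scaleUG_loop, zpow_add₀ two_ne_zero, smul_mul_smul_comm]
  | zero => simp
  | add u v _ _ hu hv => rw [map_add, hu, hv, smul_add]
  | smul a u _ hu => rw [map_smul, hu, smul_comm]

theorem scaleUG_surjective : Function.Surjective (scaleUG (𝕜 := 𝕜)) := by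
  rw [← AlgHom.range_eq_top]
  refine ug_subalgebra_eq_top _ fun x k => ⟨(2 : 𝕜) ^ (-k) • toUG (loop x k), ?_⟩
  have h1 : scaleUG ((2 : 𝕜) ^ (-k) • toUG (loop x k)) = toUG (loop x k) := by
    rw [map_smul, scaleUG_loop, smul_smul, ← zpow_add₀ two_ne_zero, neg_add_cancel, zpow_zero,
      one_smul]
  exact h1

end Scaling

/-! ### Maps that are linear up to an endomorphism of `U(𝔤)`. -/

section Semilinear

variable {M N : Type*} [AddCommGroup M] [Module 𝕜 M] [Module (UG 𝕜) M] [IsScalarTower 𝕜 (UG 𝕜) M]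
  [AddCommGroup N] [Module 𝕜 N] [Module (UG 𝕜) N] [IsScalarTower 𝕜 (UG 𝕜) N]

/-- A map which is linear up to an endomorphism of `U(𝔤)` descends to a quotient. -/
theorem exists_lift_quotient (τ : UG 𝕜 →ₐ[𝕜] UG 𝕜) (g : M →ₗ[𝕜] N)
    (hg : ∀ (u : UG 𝕜) m, g (u • m) = τ u • g m) (Q : Submodule (UG 𝕜) M)
    (hQ : ∀ m ∈ Q, g m = 0) :
    ∃ g' : (M ⧸ Q) →ₗ[𝕜] N, (∀ m, g' (Q.mkQ m) = g m) ∧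
      ∀ (u : UG 𝕜) m, g' (u • m) = τ u • g' m := by
  let g₁ : M →ₛₗ[(τ : UG 𝕜 →+* UG 𝕜)] N :=
    { toFun := g, map_add' := map_add g, map_smul' := hg }
  let g₂ := Q.liftQ g₁ hQ
  refine ⟨{ toFun := g₂, map_add' := map_add g₂, map_smul' := fun c m => ?_ }, fun m => rfl,
    fun u m => map_smulₛₗ g₂ u m⟩
  rw [← algebraMap_smul (UG 𝕜) c m, map_smulₛₗ]
  simp

end Semilinear

/-! ### Induced modules and the quotient `F(Λ)`. -/

section Induced

variable {Λ : Type*} [AddCommGroup Λ] [Module 𝕜 Λ] {σ : UH 𝕜 →ₐ[𝕜] Module.End 𝕜 Λ}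
variable {M : Type*} [AddCommGroup M] [Module 𝕜 M] [Module (UG 𝕜) M] [IsScalarTower 𝕜 (UG 𝕜) M]

/-- The universal property of induced modules, for maps which are linear up to an endomorphism of
`U(𝔤)`. -/
theorem exists_induced_lift (τ : UG 𝕜 →ₐ[𝕜] UG 𝕜) (g : Λ →ₗ[𝕜] M)
    (hh : ∀ k v, τ (uH k) • g v = g (σ (yH k) v)) (he : ∀ k v, τ (uE k) • g v = 0) :
    ∃ g' : Induced σ →ₗ[𝕜] M, (∀ v, g' (inducedInc σ v) = g v) ∧
      ∀ (u : UG 𝕜) m, g' (u • m) = τ u • g' m := by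
  let g₀ : UG 𝕜 ⊗[𝕜] Λ →ₗ[𝕜] M :=
    TensorProduct.lift (((Algebra.lsmul 𝕜 𝕜 M).toLinearMap ∘ₗ τ.toLinearMap).compl₂ g)
  have hg₀ : ∀ u v, g₀ (u ⊗ₜ[𝕜] v) = τ u • g v := fun u v => by simp [g₀]
  have hsmul : ∀ (u : UG 𝕜) m, g₀ (u • m) = τ u • g₀ m := by
    intro u m
    induction m using TensorProduct.induction_on with
    | zero => simp
    | add x y hx hy => rw [smul_add, map_add, hx, hy, map_add, smul_add]
    | tmul v x => rw [TensorProduct.smul_tmul', hg₀, hg₀, smul_eq_mul, map_mul, mul_smul]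
  have hker : ∀ m ∈ inducedRel σ, g₀ m = 0 := by
    intro m hm
    induction hm using Submodule.span_induction with
    | zero => exact map_zero _
    | add x y _ _ hx hy => rw [map_add, hx, hy, add_zero]
    | smul u m _ hm => rw [hsmul, hm, smul_zero]
    | mem m hm =>
      rcases hm with ⟨y, v, rfl⟩ | ⟨⟨_, p, rfl⟩, v, rfl⟩
      · rw [map_sub, hg₀, hg₀, map_one, one_smul, sub_eq_zero]
        induction y using hH_induction with
        | hadd x y hx hy =>
          have h1 : toUH (x + y) = toUH x + toUH y := map_add _ _ _
          rw [h1, map_add, LinearMap.add_apply, map_add, ← hx, ← hy, ← add_smul, ← map_add,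
            ← toUG_add]
          rfl
        | hsmul c x hx =>
          have h1 : toUH (c • x) = c • toUH x := map_smul _ _ _
          rw [h1, map_smul, LinearMap.smul_apply, map_smul, ← hx, ← smul_assoc, ← map_smul τ,
            ← toUG_smul]
          rfl
        | hh k => exact hh k v
      · rw [hg₀]
        let A : Submodule 𝕜 (UG 𝕜) := LinearMap.ker
          ((Algebra.lsmul 𝕜 𝕜 M).toLinearMap.flip (g v) ∘ₗ τ.toLinearMap)
        have h1 : toUG (p ⊗ₜ[𝕜] e 𝕜) ∈ A := toUG_tmul p (e 𝕜) A fun k => by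
          simpa [A, uE] using he k v
        simpa [A] using h1
  obtain ⟨g', h1, h2⟩ := exists_lift_quotient τ g₀ hsmul (inducedRel σ) hker
  refine ⟨g', fun v => ?_, h2⟩
  have h3 := h1 (1 ⊗ₜ[𝕜] v)
  rw [hg₀, map_one, one_smul] at h3
  exact h3

theorem mkQ_tmul (u : UG 𝕜) (v : Λ) :
    (inducedRel σ).mkQ (u ⊗ₜ[𝕜] v) = u • inducedInc σ v := by
  have h1 : inducedInc σ v = (inducedRel σ).mkQ ((1 : UG 𝕜) ⊗ₜ[𝕜] v) := rfl
  rw [h1, ← map_smul, TensorProduct.smul_tmul', smul_eq_mul, mul_one]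

theorem uH_smul_inducedInc (k : ℤ) (v : Λ) :
    (uH k : UG 𝕜) • inducedInc σ v = inducedInc σ (σ (yH k) v) := by
  have h0 : ∀ z : UG 𝕜 ⊗[𝕜] Λ, (∃ (y : H 𝕜) (v : Λ),
      z = toUG (y : G 𝕜) ⊗ₜ[𝕜] v - 1 ⊗ₜ[𝕜] (σ (toUH y) v)) → z ∈ inducedRel σ :=
    fun z hz => Submodule.subset_span (Or.inl hz)
  have h1 := h0 _ ⟨hH k, v, rfl⟩
  rw [← Submodule.ker_mkQ (inducedRel σ), LinearMap.mem_ker, map_sub, mkQ_tmul, mkQ_tmul,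
    one_smul, sub_eq_zero] at h1
  exact h1

theorem loop_e_mem (k : ℤ) : loop (e 𝕜) k ∈ E 𝕜 :=
  LinearMap.mem_range.2 ⟨LaurentPolynomial.T k, rfl⟩

theorem uE_smul_inducedInc (k : ℤ) (v : Λ) : (uE k : UG 𝕜) • inducedInc σ v = 0 := by
  have h0 : ∀ z : UG 𝕜 ⊗[𝕜] Λ, (∃ (y : E 𝕜) (v : Λ), z = toUG (y : G 𝕜) ⊗ₜ[𝕜] v) →
      z ∈ inducedRel σ := fun z hz => Submodule.subset_span (Or.inr hz)
  have h1 := h0 _ ⟨⟨loop (e 𝕜) k, loop_e_mem k⟩, v, rfl⟩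
  rw [← Submodule.ker_mkQ (inducedRel σ), LinearMap.mem_ker, mkQ_tmul] at h1
  exact h1

theorem incUH_smul_inducedInc (y : UH 𝕜) (v : Λ) :
    incUH y • inducedInc σ v = inducedInc σ (σ y v) := by
  let S : Submodule 𝕜 (UH 𝕜) := LinearMap.eqLocus
    ((Algebra.lsmul 𝕜 𝕜 (Induced σ)).toLinearMap.flip (inducedInc σ v) ∘ₗ incUH.toLinearMap)
    (inducedInc σ ∘ₗ σ.toLinearMap.flip v)
  have hS : ∀ y, y ∈ S ↔ incUH y • inducedInc σ v = inducedInc σ (σ y v) := fun y => Iff.rfl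
  have h1 : S = ⊤ := uh_eq_top S ((hS 1).2 (by simp)) fun k u hu => by
    rw [hS] at *
    rw [map_mul, mul_smul, hu, incUH_yH, uH_smul_inducedInc, map_mul, Module.End.mul_apply]
  exact (hS y).1 (h1 ▸ Submodule.mem_top)

theorem induced_eq_span : Submodule.span (UG 𝕜) (LinearMap.range (inducedInc σ) : Set (Induced σ)) =
    ⊤ := by
  refine eq_top_iff.2 fun m _ => ?_
  obtain ⟨z, rfl⟩ := Submodule.mkQ_surjective _ m
  induction z using TensorProduct.induction_on with
  | zero => rw [map_zero]; exact Submodule.zero_mem _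
  | add x y hx hy => rw [map_add]; exact Submodule.add_mem _ (hx trivial) (hy trivial)
  | tmul u v =>
    rw [mkQ_tmul]
    exact Submodule.smul_mem _ _ (Submodule.subset_span ⟨v, rfl⟩)

theorem isHighest_inducedInc {c : 𝕜} (hc : ∀ v, σ (yH 0) v = c • v) :
    IsHighest (LinearMap.range (inducedInc σ)) c where
  uH_mem k m hm := by
    obtain ⟨v, rfl⟩ := hm
    exact ⟨_, (uH_smul_inducedInc k v).symm⟩
  uE_eq_zero k m hm := by
    obtain ⟨v, rfl⟩ := hm
    exact uE_smul_inducedInc k v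
  le_wt := by
    rintro _ ⟨v, rfl⟩
    rw [mem_wt, uH_smul_inducedInc, hc, map_smul]

variable (M) in
/-- The sum of the weight spaces of weight `c - 2, c - 4, …`. -/
def low (c : 𝕜) : Submodule 𝕜 M := ⨆ r : ℕ, wt M (c - 2 * ((r : 𝕜) + 1))

theorem disjoint_wt_low [CharZero 𝕜] (c : 𝕜) : Disjoint (wt M c) (low M c) := by
  have h1 : ∀ c, wt M c = Module.End.eigenspace (Algebra.lsmul 𝕜 𝕜 M (uH 0 : UG 𝕜)) c := fun c => by
    ext m
    rw [Module.End.mem_eigenspace_iff]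
    rfl
  have h2 := Module.End.eigenspaces_iSupIndep (Algebra.lsmul 𝕜 𝕜 M (uH 0 : UG 𝕜)) c
  rw [← h1] at h2
  refine h2.mono_right (iSup_le fun r => ?_)
  rw [h1]
  refine le_iSup₂_of_le (c - 2 * ((r : 𝕜) + 1)) ?_ le_rfl
  intro h
  have h3 : (2 : 𝕜) * ((r : 𝕜) + 1) = 0 := by linear_combination -h
  rcases mul_eq_zero.1 h3 with h4 | h4
  · exact two_ne_zero h4
  · exact Nat.cast_add_one_ne_zero r h4

variable [CharZero 𝕜] {c : 𝕜} (hc : ∀ v, σ (yH 0) v = c • v)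
include hc

/-- A submodule contains the weight components of its elements, and the component of top weight lies
in the image of `Λ`, hence is zero. -/
theorem le_low_of_inf_eq_bot {Q : Submodule (UG 𝕜) (Induced σ)}
    (hQ : Q.restrictScalars 𝕜 ⊓ LinearMap.range (inducedInc σ) = ⊥) :
    Q.restrictScalars 𝕜 ≤ low (Induced σ) c := by
  intro m hm
  have hC := isHighest_inducedInc hc
  obtain ⟨g, hg, rfl⟩ := hC.exists_sum (induced_eq_span (σ := σ) ▸ Submodule.mem_top (x := m))
  have h1 := weight_component_mem (Q := Q) (fun r => hC.layer_le_wt r (hg r)) hm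
  have h0 : g 0 = 0 := by
    have : g 0 ∈ Q.restrictScalars 𝕜 ⊓ LinearMap.range (inducedInc σ) := ⟨h1 0, hg 0⟩
    rw [hQ] at this
    exact this
  refine Submodule.sum_mem _ fun r hr => ?_
  cases r with
  | zero => exact absurd h0 (Finsupp.mem_support_iff.1 hr)
  | succ r =>
    have h2 := hC.layer_le_wt _ (hg (r + 1))
    refine Submodule.mem_iSup_of_mem r ?_
    push_cast at h2
    exact h2

/-- Each submodule in the sum that defines `maxSub` lies in `low`, which is closed under sums and
meets the top weight space trivially. Hence the sum itself still meets `Λ` trivially. -/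
theorem maxSub_le_low : (maxSub σ).restrictScalars 𝕜 ≤ low (Induced σ) c := by
  intro m hm
  have h1 : ∀ m ∈ maxSub σ, m ∈ low (Induced σ) c := by
    intro m hm
    rw [maxSub, sSup_eq_iSup'] at hm
    induction hm using Submodule.iSup_induction' with
    | zero => exact Submodule.zero_mem _
    | add x y _ _ hx hy => exact Submodule.add_mem _ hx hy
    | mem Q m hm => exact le_low_of_inf_eq_bot hc Q.2 hm
  exact h1 m hm

/-- A description by weights alone, which makes it visible that operators preserving weights and
normalising `U(𝔤)` preserve `maxSub`. -/
theorem mem_maxSub_iff {m : Induced σ} :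
    m ∈ maxSub σ ↔ ∀ u : UG 𝕜, u • m ∈ low (Induced σ) c := by
  refine ⟨fun hm u => maxSub_le_low hc ((maxSub σ).smul_mem u hm), fun hm => ?_⟩
  let Q : Submodule (UG 𝕜) (Induced σ) :=
    { carrier := {m | ∀ u : UG 𝕜, u • m ∈ low (Induced σ) c}
      add_mem' := fun {a b} ha hb u => by
        rw [smul_add]; exact Submodule.add_mem _ (ha u) (hb u)
      zero_mem' := fun u => by rw [smul_zero]; exact Submodule.zero_mem _
      smul_mem' := fun v m hm u => by rw [← mul_smul]; exact hm _ }
  have hQ : Q ≤ maxSub σ := by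
    refine le_sSup (eq_bot_iff.2 ?_)
    rintro x ⟨hx, hx'⟩
    have h1 : x ∈ low (Induced σ) c := by simpa using hx 1
    exact (disjoint_wt_low c).le_bot ⟨(isHighest_inducedInc hc).le_wt hx', h1⟩
  exact hQ hm

theorem eq_zero_of_mkQ_inducedInc {v : Λ} (hv : (maxSub σ).mkQ (inducedInc σ v) = 0) :
    inducedInc σ v = 0 := by
  rw [Submodule.mkQ_apply, Submodule.Quotient.mk_eq_zero] at hv
  exact (disjoint_wt_low c).le_bot
    ⟨(isHighest_inducedInc hc).le_wt ⟨v, rfl⟩, maxSub_le_low hc hv⟩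

/-- Non-zero submodules of `F(Λ)` meet `Λ`. -/
theorem exists_inducedInc_mem {Q : Submodule (UG 𝕜) (FMod σ)} (hQ : Q ≠ ⊥) :
    ∃ v, (maxSub σ).mkQ (inducedInc σ v) ∈ Q ∧ (maxSub σ).mkQ (inducedInc σ v) ≠ 0 := by
  by_contra! hcon
  apply hQ
  -- If `Q` missed `Λ`, its preimage would meet the image of `Λ` trivially and so be contained in
  -- `maxSub`.
  have h1 : Q.comap (maxSub σ).mkQ ≤ maxSub σ := by
    refine le_sSup (eq_bot_iff.2 ?_)
    rintro _ ⟨hx, v, rfl⟩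
    exact eq_zero_of_mkQ_inducedInc hc (hcon v hx)
  refine eq_bot_iff.2 fun x hx => ?_
  obtain ⟨m, rfl⟩ := Submodule.mkQ_surjective _ x
  exact (Submodule.Quotient.mk_eq_zero _).2 (h1 hx)

end Induced

/-! ### The gradings of `Ind Λ` and `F(Λ)`. -/

section InducedGrading

variable {Λ : Type*} [AddCommGroup Λ] [Module 𝕜 Λ] {σ : UH 𝕜 →ₐ[𝕜] Module.End 𝕜 Λ}
  {𝓛 : ℤ → Submodule 𝕜 Λ}

theorem ug_smul_mem_inducedGrading {i d : ℤ} {u : UG 𝕜} (hu : u ∈ ugGrading (𝕜 := 𝕜) i)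
    {m : Induced σ} (hm : m ∈ inducedGrading σ 𝓛 d) : u • m ∈ inducedGrading σ 𝓛 (d + i) := by
  induction hm using Submodule.span_induction with
  | mem m hm =>
    obtain ⟨j, l, rfl, u', hu', v, hv, rfl⟩ := hm
    exact Submodule.subset_span ⟨i + j, l, by ring, u * u', mul_mem_ugGrading hu hu', v, hv,
      (mul_smul _ _ _).symm⟩
  | zero => rw [smul_zero]; exact Submodule.zero_mem _
  | add x y _ _ hx hy => rw [smul_add]; exact Submodule.add_mem _ hx hy
  | smul a x _ hx => rw [smul_comm]; exact Submodule.smul_mem _ a hx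

theorem inducedInc_mem {d : ℤ} {v : Λ} (hv : v ∈ 𝓛 d) : inducedInc σ v ∈ inducedGrading σ 𝓛 d :=
  Submodule.subset_span ⟨0, d, zero_add d, 1, one_mem_ugGrading, v, hv, (one_smul _ _).symm⟩

theorem iSup_inducedGrading (htop : ⨆ d, 𝓛 d = ⊤) : ⨆ d, inducedGrading σ 𝓛 d = ⊤ := by
  refine eq_top_iff.2 fun m _ => ?_
  have hm : m ∈ Submodule.span (UG 𝕜) (LinearMap.range (inducedInc σ) : Set (Induced σ)) :=
    induced_eq_span (σ := σ) ▸ Submodule.mem_top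
  have hS : ∀ (x : Sl2 𝕜) (k : ℤ), ∀ m ∈ ⨆ d, inducedGrading σ 𝓛 d,
      toUG (loop x k) • m ∈ ⨆ d, inducedGrading σ 𝓛 d := by
    intro x k m hm
    induction hm using Submodule.iSup_induction' with
    | zero => rw [smul_zero]; exact Submodule.zero_mem _
    | add x y _ _ hx hy => rw [smul_add]; exact Submodule.add_mem _ hx hy
    | mem d m hm =>
      exact Submodule.mem_iSup_of_mem _
        (ug_smul_mem_inducedGrading (toUG_mem_ugGrading x k) hm)
  induction hm using Submodule.span_induction with
  | zero => exact Submodule.zero_mem _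
  | add x y _ _ hx hy => exact Submodule.add_mem _ (hx trivial) (hy trivial)
  | smul u m _ hm => exact ug_smul_mem hS u (hm trivial)
  | mem m hm =>
    obtain ⟨v, rfl⟩ := hm
    have hv : v ∈ ⨆ d, 𝓛 d := htop ▸ Submodule.mem_top
    clear! m
    induction hv using Submodule.iSup_induction' with
    | zero => rw [map_zero]; exact Submodule.zero_mem _
    | add x y _ _ hx hy => rw [map_add]; exact Submodule.add_mem _ (hx trivial) (hy trivial)
    | mem d v hv =>
      exact Submodule.mem_iSup_of_mem d (inducedInc_mem hv)

/-- An operator on an `H`-module that multiplies elements of degree `d` by `2ᵈ`. -/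
structure IsScaling (σ : UH 𝕜 →ₐ[𝕜] Module.End 𝕜 Λ) (𝓛 : ℤ → Submodule 𝕜 Λ)
    (t : Module.End 𝕜 Λ) : Prop where
  commute : ∀ k v, (2 : 𝕜) ^ k • σ (yH k) (t v) = t (σ (yH k) v)
  eigen : ∀ d, ∀ v ∈ 𝓛 d, t v = (2 : 𝕜) ^ d • v
  iSup_eq_top : ⨆ d, 𝓛 d = ⊤

variable [CharZero 𝕜] {t : Module.End 𝕜 Λ}

/-- The scaling of `Λ` and that of `U(𝔤)` are compatible with the defining relations, so together
they act on `Ind Λ`. -/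
theorem IsScaling.exists_induced (ht : IsScaling σ 𝓛 t) :
    ∃ D : Module.End 𝕜 (Induced σ), (∀ (u : UG 𝕜) m, D (u • m) = scaleUG u • D m) ∧
      ∀ d, ∀ m ∈ inducedGrading σ 𝓛 d, D m = (2 : 𝕜) ^ d • m := by
  obtain ⟨D, h1, h2⟩ := exists_induced_lift (σ := σ) scaleUG (inducedInc σ ∘ₗ t)
    (fun k v => by
      rw [uH, scaleUG_loop, smul_assoc, LinearMap.comp_apply, LinearMap.comp_apply,
        ← ht.commute, map_smul, ← uH_smul_inducedInc, uH])
    (fun k v => by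
      rw [uE, scaleUG_loop, smul_assoc, LinearMap.comp_apply, ← uE, uE_smul_inducedInc, smul_zero])
  refine ⟨D, h2, fun d m hm => ?_⟩
  induction hm using Submodule.span_induction with
  | mem m hm =>
    obtain ⟨j, l, rfl, u', hu', v, hv, rfl⟩ := hm
    rw [h2, h1, LinearMap.comp_apply, ht.eigen l v hv, scaleUG_of_mem hu', map_smul, smul_assoc,
      smul_comm u', smul_smul, zpow_add₀ two_ne_zero]
  | zero => simp
  | add x y _ _ hx hy => rw [map_add, hx, hy, smul_add]
  | smul a x _ hx => rw [map_smul, hx, smul_comm]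

theorem IsScaling.isGrading_induced (ht : IsScaling σ 𝓛 t) : IsGrading (inducedGrading σ 𝓛) := by
  obtain ⟨D, -, h2⟩ := ht.exists_induced
  exact isGrading_of_eigen D h2 (iSup_inducedGrading ht.iSup_eq_top) fun x k d m hm =>
    ug_smul_mem_inducedGrading (toUG_mem_ugGrading x k) hm

/-- The scaling operator fixes the action of `h(0)`, so it preserves `low`, hence `maxSub`, and
descends to `F(Λ)`. -/
theorem IsScaling.isGrading_fGrading (ht : IsScaling σ 𝓛 t) {c : 𝕜}
    (hc : ∀ v, σ (yH 0) v = c • v) : IsGrading (fGrading σ 𝓛) := by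
  obtain ⟨D, h1, h2⟩ := ht.exists_induced
  have hlow : ∀ m ∈ low (Induced σ) c, D m ∈ low (Induced σ) c := by
    intro m hm
    induction hm using Submodule.iSup_induction' with
    | zero => rw [map_zero]; exact Submodule.zero_mem _
    | add x y _ _ hx hy => rw [map_add]; exact Submodule.add_mem _ hx hy
    | mem r m hm =>
      refine Submodule.mem_iSup_of_mem r ?_
      rw [mem_wt] at hm ⊢
      rw [← map_smul D, ← hm, h1, uH, scaleUG_loop, zpow_zero, one_smul]
  have hmax : ∀ m ∈ maxSub σ, D m ∈ maxSub σ := by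
    intro m hm
    rw [mem_maxSub_iff hc] at hm ⊢
    intro u
    -- Writing the multiplier as a scaled element lets `D` be pulled out of the product.
    obtain ⟨u, rfl⟩ := scaleUG_surjective u
    rw [← h1]
    exact hlow _ (hm u)
  obtain ⟨D', h3, -⟩ := exists_lift_quotient scaleUG
    ((maxSub σ).mkQ.restrictScalars 𝕜 ∘ₗ D) (fun u m => by simp [h1]) (maxSub σ)
    (fun m hm => (Submodule.Quotient.mk_eq_zero _).2 (hmax m hm))
  refine isGrading_of_eigen D' ?_ ?_ ?_
  · intro d y hy
    obtain ⟨m, hm, rfl⟩ := Submodule.mem_map.1 hy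
    refine (h3 m).trans ?_
    rw [LinearMap.comp_apply, h2 d m hm, map_smul]
  · have h4 : ⨆ d, fGrading σ 𝓛 d =
        (⨆ d, inducedGrading σ 𝓛 d).map ((maxSub σ).mkQ.restrictScalars 𝕜) :=
      (Submodule.map_iSup _ _).symm
    rw [h4, iSup_inducedGrading ht.iSup_eq_top]
    refine eq_top_iff.2 fun y _ => ?_
    obtain ⟨m, rfl⟩ := Submodule.mkQ_surjective _ y
    exact Submodule.mem_map_of_mem (f := (maxSub σ).mkQ.restrictScalars 𝕜) Submodule.mem_top
  · intro x k d y hy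
    obtain ⟨m, hm, rfl⟩ := Submodule.mem_map.1 hy
    have h5 := ug_smul_mem_inducedGrading (toUG_mem_ugGrading x k) hm
    have h6 := Submodule.mem_map_of_mem (f := (maxSub σ).mkQ.restrictScalars 𝕜) h5
    rw [LinearMap.restrictScalars_apply, map_smul] at h6
    exact h6

end InducedGrading

/-! ### A realisation of the loop algebra on functions of finite multisets of points. -/

section FunctionModel

open scoped Classical in
/-- Evaluation of Laurent polynomials at a non-zero scalar. -/
def evalAt (z : 𝕜ˣ) : 𝕜[T;T⁻¹] →ₐ[𝕜] 𝕜 :=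
  AddMonoidAlgebra.lift 𝕜 𝕜 ℤ ((Units.coeHom 𝕜).comp (zpowersHom 𝕜ˣ z))

@[simp]
theorem evalAt_T (z : 𝕜ˣ) (k : ℤ) :
    evalAt z (LaurentPolynomial.T k : 𝕜[T;T⁻¹]) = ((z ^ k : 𝕜ˣ) : 𝕜) := by
  rw [evalAt, LaurentPolynomial.T, AddMonoidAlgebra.lift_single]
  simp

variable (𝕜) in
/-- Functions on finite multisets of non-zero scalars. -/
def MFun : Type _ := Multiset 𝕜ˣ → 𝕜

instance : AddCommGroup (MFun 𝕜) := inferInstanceAs (AddCommGroup (Multiset 𝕜ˣ → 𝕜))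

instance : Module 𝕜 (MFun 𝕜) := inferInstanceAs (Module 𝕜 (Multiset 𝕜ˣ → 𝕜))

/-- A function on multisets as an element of `MFun`. -/
def MFun.mk (g : Multiset 𝕜ˣ → 𝕜) : MFun 𝕜 := g

@[simp] theorem MFun.mk_apply (g : Multiset 𝕜ˣ → 𝕜) (S : Multiset 𝕜ˣ) : MFun.mk g S = g S := rfl

theorem MFun.ext {Ψ Φ : MFun 𝕜} (h : ∀ S : Multiset 𝕜ˣ, Ψ S = Φ S) : Ψ = Φ := funext h

@[simp] theorem MFun.add_apply (Ψ Φ : MFun 𝕜) (S : Multiset 𝕜ˣ) : (Ψ + Φ) S = Ψ S + Φ S := rfl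

@[simp] theorem MFun.sub_apply (Ψ Φ : MFun 𝕜) (S : Multiset 𝕜ˣ) : (Ψ - Φ) S = Ψ S - Φ S := rfl

@[simp] theorem MFun.smul_apply (c : 𝕜) (Ψ : MFun 𝕜) (S : Multiset 𝕜ˣ) :
    (c • Ψ) S = c * Ψ S := rfl

@[simp] theorem MFun.zero_apply (S : Multiset 𝕜ˣ) : (0 : MFun 𝕜) S = 0 := rfl

/-- The sum of the values of a Laurent polynomial over a multiset. -/
def powSum (p : 𝕜[T;T⁻¹]) (S : Multiset 𝕜ˣ) : 𝕜 := (S.map fun z => evalAt z p).sum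

/-- The action of `p ⊗ e` on functions of multisets. -/
def opE : 𝕜[T;T⁻¹] →ₗ[𝕜] Module.End 𝕜 (MFun 𝕜) :=
  LinearMap.mk₂ 𝕜 (fun p Ψ => MFun.mk fun S => -(S.map fun z => evalAt z p * Ψ (z ::ₘ S)).sum)
    (fun p q Ψ => MFun.ext fun S => by simp [add_mul]; ring)
    (fun c p Ψ => MFun.ext fun S => by simp [mul_assoc, Multiset.sum_map_mul_left])
    (fun p Ψ Φ => MFun.ext fun S => by simp [mul_add]; ring)
    (fun c p Ψ => MFun.ext fun S => by simp [mul_left_comm, Multiset.sum_map_mul_left])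

/-- The action of `p ⊗ h` on functions of multisets. -/
def opH : 𝕜[T;T⁻¹] →ₗ[𝕜] Module.End 𝕜 (MFun 𝕜) :=
  LinearMap.mk₂ 𝕜 (fun p Ψ => MFun.mk fun S => -2 * powSum p S * Ψ S)
    (fun p q Ψ => MFun.ext fun S => by simp [powSum]; ring)
    (fun c p Ψ => MFun.ext fun S => by simp [powSum, Multiset.sum_map_mul_left]; ring)
    (fun p Ψ Φ => MFun.ext fun S => by simp; ring)
    (fun c p Ψ => MFun.ext fun S => by simp; ring)

open scoped Classical in
/-- The action of `p ⊗ f` on functions of multisets. -/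
def opF : 𝕜[T;T⁻¹] →ₗ[𝕜] Module.End 𝕜 (MFun 𝕜) :=
  LinearMap.mk₂ 𝕜 (fun p Ψ => MFun.mk fun S => (S.map fun z => evalAt z p * Ψ (S.erase z)).sum)
    (fun p q Ψ => MFun.ext fun S => by simp [add_mul])
    (fun c p Ψ => MFun.ext fun S => by simp [mul_assoc, Multiset.sum_map_mul_left])
    (fun p Ψ Φ => MFun.ext fun S => by simp [mul_add])
    (fun c p Ψ => MFun.ext fun S => by simp [mul_left_comm, Multiset.sum_map_mul_left])

theorem opE_apply (p : 𝕜[T;T⁻¹]) (Ψ : MFun 𝕜) (S : Multiset 𝕜ˣ) :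
    opE p Ψ S = -(S.map fun z => evalAt z p * Ψ (z ::ₘ S)).sum := rfl

theorem opH_apply (p : 𝕜[T;T⁻¹]) (Ψ : MFun 𝕜) (S : Multiset 𝕜ˣ) :
    opH p Ψ S = -2 * powSum p S * Ψ S := rfl

open scoped Classical in
theorem opF_apply (p : 𝕜[T;T⁻¹]) (Ψ : MFun 𝕜) (S : Multiset 𝕜ˣ) :
    opF p Ψ S = (S.map fun z => evalAt z p * Ψ (S.erase z)).sum := rfl

theorem neg_sum_map (S : Multiset 𝕜ˣ) (g : 𝕜ˣ → 𝕜) :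
    -(S.map g).sum = (S.map fun z => -g z).sum := by
  simp

theorem powSum_cons (p : 𝕜[T;T⁻¹]) (z : 𝕜ˣ) (S : Multiset 𝕜ˣ) :
    powSum p (z ::ₘ S) = evalAt z p + powSum p S := by simp [powSum]

open scoped Classical in
theorem sum_map_erase_eq {S : Multiset 𝕜ˣ} {w : 𝕜ˣ} (hw : w ∈ S) (g : 𝕜ˣ → 𝕜) :
    ((S.erase w).map g).sum = (S.map g).sum - g w := by
  rw [← Multiset.sum_map_erase hw]
  ring

/-- After `z` is doubled, the second point runs over `z ::ₘ S`: this gives a double sum over `S` and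
a diagonal term, both symmetric under exchanging `p` and `q`. -/
theorem opE_mul_opE (p q : 𝕜[T;T⁻¹]) : opE p * opE q = opE q * opE p := by
  have key : ∀ (p q : 𝕜[T;T⁻¹]) (Ψ : MFun 𝕜) (S : Multiset 𝕜ˣ), opE p (opE q Ψ) S =
      (S.map fun z => (S.map fun w => evalAt z p * evalAt w q * Ψ (w ::ₘ z ::ₘ S)).sum).sum +
      (S.map fun z => evalAt z p * evalAt z q * Ψ (z ::ₘ z ::ₘ S)).sum := by
    intro p q Ψ S
    rw [opE_apply, neg_sum_map, ← Multiset.sum_map_add]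
    refine congrArg _ (Multiset.map_congr rfl fun z _ => ?_)
    rw [opE_apply, Multiset.map_cons, Multiset.sum_cons]
    simp only [mul_assoc, Multiset.sum_map_mul_left]
    ring
  refine LinearMap.ext fun Ψ => MFun.ext fun S => ?_
  rw [Module.End.mul_apply, Module.End.mul_apply, key, key, Multiset.sum_map_sum_map]
  congr 1
  · refine congrArg _ (Multiset.map_congr rfl fun z _ => ?_)
    refine congrArg _ (Multiset.map_congr rfl fun w _ => ?_)
    rw [Multiset.cons_swap, mul_comm (evalAt w p)]
  · refine congrArg _ (Multiset.map_congr rfl fun z _ => ?_)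
    ring

/-- As for `opE`, except that the second point runs over `S.erase z`, so the diagonal term is
subtracted. -/
theorem opF_mul_opF (p q : 𝕜[T;T⁻¹]) : opF p * opF q = opF q * opF p := by
  classical
  have key : ∀ (p q : 𝕜[T;T⁻¹]) (Ψ : MFun 𝕜) (S : Multiset 𝕜ˣ), opF p (opF q Ψ) S =
      (S.map fun z => (S.map fun w =>
        evalAt z p * evalAt w q * Ψ ((S.erase z).erase w)).sum).sum -
      (S.map fun z => evalAt z p * evalAt z q * Ψ ((S.erase z).erase z)).sum := by
    intro p q Ψ S
    rw [opF_apply, ← Multiset.sum_map_sub]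
    refine congrArg _ (Multiset.map_congr rfl fun z hz => ?_)
    rw [opF_apply, sum_map_erase_eq hz]
    simp only [mul_assoc, Multiset.sum_map_mul_left]
    ring
  refine LinearMap.ext fun Ψ => MFun.ext fun S => ?_
  rw [Module.End.mul_apply, Module.End.mul_apply, key, key, Multiset.sum_map_sum_map]
  congr 1
  · refine congrArg _ (Multiset.map_congr rfl fun z _ => ?_)
    refine congrArg _ (Multiset.map_congr rfl fun w _ => ?_)
    rw [Multiset.erase_comm, mul_comm (evalAt w p)]
  · refine congrArg _ (Multiset.map_congr rfl fun z _ => ?_)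
    ring

theorem opH_mul_opH (p q : 𝕜[T;T⁻¹]) : opH p * opH q = opH q * opH p := by
  refine LinearMap.ext fun Ψ => MFun.ext fun S => ?_
  rw [Module.End.mul_apply, Module.End.mul_apply, opH_apply, opH_apply, opH_apply, opH_apply]
  ring

theorem opH_mul_opE (p q : 𝕜[T;T⁻¹]) :
    opH p * opE q - opE q * opH p = (2 : 𝕜) • opE (p * q) := by
  refine LinearMap.ext fun Ψ => MFun.ext fun S => ?_
  rw [LinearMap.sub_apply, MFun.sub_apply, Module.End.mul_apply, Module.End.mul_apply,
    LinearMap.smul_apply, MFun.smul_apply, opH_apply, opE_apply, opE_apply, opE_apply,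
    mul_neg, sub_neg_eq_add, mul_neg, ← Multiset.sum_map_mul_left, ← Multiset.sum_map_mul_left,
    neg_sum_map, neg_sum_map, ← Multiset.sum_map_add]
  refine congrArg _ (Multiset.map_congr rfl fun z _ => ?_)
  rw [opH_apply, powSum_cons, map_mul]
  ring

theorem opH_mul_opF (p q : 𝕜[T;T⁻¹]) :
    opH p * opF q - opF q * opH p = (-2 : 𝕜) • opF (p * q) := by
  classical
  refine LinearMap.ext fun Ψ => MFun.ext fun S => ?_
  rw [LinearMap.sub_apply, MFun.sub_apply, Module.End.mul_apply, Module.End.mul_apply,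
    LinearMap.smul_apply, MFun.smul_apply, opH_apply, opF_apply, opF_apply, opF_apply,
    ← Multiset.sum_map_mul_left, ← Multiset.sum_map_mul_left, ← Multiset.sum_map_sub]
  refine congrArg _ (Multiset.map_congr rfl fun z hz => ?_)
  rw [opH_apply, map_mul, powSum, powSum, sum_map_erase_eq hz]
  ring

/-- The double sums over an adjoined point `z` and a deleted point `w` cancel. In one order `w` may
be the adjoined copy of `z`, in the other the term `z = w` is missing; each effect contributes
`-powSum (p * q)`, whence the factor `-2` of `opH`. -/
theorem opE_mul_opF (p q : 𝕜[T;T⁻¹]) : opE p * opF q - opF q * opE p = opH (p * q) := by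
  classical
  refine LinearMap.ext fun Ψ => MFun.ext fun S => ?_
  have h1 : opE p (opF q Ψ) S = -(powSum (p * q) S * Ψ S) - (S.map fun z => (S.map fun w =>
      evalAt z p * evalAt w q * Ψ (z ::ₘ S.erase w)).sum).sum := by
    rw [opE_apply, powSum, ← Multiset.sum_map_mul_right, ← neg_add', ← Multiset.sum_map_add]
    refine congrArg _ (congrArg _ (Multiset.map_congr rfl fun z _ => ?_))
    rw [opF_apply, Multiset.map_cons, Multiset.sum_cons, Multiset.erase_cons_head, map_mul]
    have h2 : (S.map fun w => evalAt w q * Ψ ((z ::ₘ S).erase w)).sum =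
        (S.map fun w => evalAt w q * Ψ (z ::ₘ S.erase w)).sum :=
      congrArg _ (Multiset.map_congr rfl fun w hw => by rw [Multiset.erase_cons_tail_of_mem hw])
    rw [h2]
    simp only [mul_assoc, Multiset.sum_map_mul_left]
    ring
  have h3 : opF q (opE p Ψ) S = (powSum (p * q) S * Ψ S) - (S.map fun w => (S.map fun z =>
      evalAt z p * evalAt w q * Ψ (z ::ₘ S.erase w)).sum).sum := by
    rw [opF_apply, powSum, ← Multiset.sum_map_mul_right, ← Multiset.sum_map_sub]
    refine congrArg _ (Multiset.map_congr rfl fun w hw => ?_)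
    rw [opE_apply, sum_map_erase_eq hw, Multiset.cons_erase hw, map_mul]
    simp only [mul_assoc, mul_left_comm _ (evalAt w q), Multiset.sum_map_mul_left]
    ring
  rw [LinearMap.sub_apply, MFun.sub_apply, Module.End.mul_apply, Module.End.mul_apply, h1, h3,
    opH_apply, Multiset.sum_map_sum_map]
  ring

/-- The action of the loop algebra on functions of multisets, as a linear map. -/
def repLin : G 𝕜 →ₗ[𝕜] Module.End 𝕜 (MFun 𝕜) :=
  TensorProduct.lift (LinearMap.mk₂ 𝕜
    (fun (p : 𝕜[T;T⁻¹]) (x : Sl2 𝕜) =>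
      x.val 0 1 • opE p + x.val 0 0 • opH p + x.val 1 0 • opF p)
    (fun p q x => by simp only [map_add]; module)
    (fun c p x => by simp only [map_smul]; module)
    (fun p x y => by
      have h1 : (x + y).val = x.val + y.val := rfl
      simp only [h1, Matrix.add_apply]; module)
    (fun c p x => by
      have h1 : (c • x).val = c • x.val := rfl
      simp only [h1, Matrix.smul_apply, smul_eq_mul]; module))

theorem repLin_tmul (p : 𝕜[T;T⁻¹]) (x : Sl2 𝕜) : repLin (p ⊗ₜ[𝕜] x) =
    x.val 0 1 • opE p + x.val 0 0 • opH p + x.val 1 0 • opF p := by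
  rw [repLin, TensorProduct.lift.tmul, LinearMap.mk₂_apply]

theorem sl2_trace (x : Sl2 𝕜) : x.val 1 1 = -x.val 0 0 := by
  have h1 : Matrix.trace x.val = 0 := (LinearMap.mem_ker).1 x.2
  rw [Matrix.trace_fin_two] at h1
  linear_combination h1

theorem repLin_lie (x y : G 𝕜) :
    repLin ⁅x, y⁆ = repLin x * repLin y - repLin y * repLin x := by
  induction x using TensorProduct.induction_on with
  | zero => rw [lieRing_zero_lie, map_zero, zero_mul, mul_zero, sub_zero]
  | add x₁ x₂ h₁ h₂ => rw [LieRing.add_lie, map_add, h₁, h₂, map_add, add_mul, mul_add]; abel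
  | tmul p x =>
    induction y using TensorProduct.induction_on with
    | zero => rw [lieRing_lie_zero, map_zero, zero_mul, mul_zero, sub_zero]
    | add y₁ y₂ h₁ h₂ => rw [LieRing.lie_add, map_add, h₁, h₂, map_add, add_mul, mul_add]; abel
    | tmul q y =>
      rw [LieAlgebra.ExtendScalars.bracket_tmul, repLin_tmul, repLin_tmul, repLin_tmul]
      simp only [LieAlgebra.SpecialLinear.sl_bracket, Matrix.sub_apply, Matrix.mul_apply,
        Fin.sum_univ_two, sl2_trace, add_mul, mul_add, smul_mul_smul_comm]
      have hEE := opE_mul_opE p q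
      have hFF := opF_mul_opF p q
      have hHH := opH_mul_opH p q
      have hEF := opE_mul_opF p q
      have hEF' := opE_mul_opF q p
      have hHE := opH_mul_opE p q
      have hHE' := opH_mul_opE q p
      have hHF := opH_mul_opF p q
      have hHF' := opH_mul_opF q p
      rw [mul_comm q p] at hEF' hHE' hHF'
      linear_combination (norm := module) (-(x.val 0 1 * y.val 0 1)) • hEE
        - (x.val 1 0 * y.val 1 0) • hFF - (x.val 0 0 * y.val 0 0) • hHH
        - (x.val 0 1 * y.val 1 0) • hEF + (x.val 1 0 * y.val 0 1) • hEF'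
        - (x.val 0 0 * y.val 0 1) • hHE + (x.val 0 1 * y.val 0 0) • hHE'
        - (x.val 0 0 * y.val 1 0) • hHF + (x.val 1 0 * y.val 0 0) • hHF'

/-- The action of `U(𝔤)` on functions of multisets. -/
def repU : UG 𝕜 →ₐ[𝕜] Module.End 𝕜 (MFun 𝕜) :=
  UniversalEnvelopingAlgebra.lift 𝕜
    { repLin with
      map_lie' := fun {x y} => (repLin_lie x y).trans (LieRing.of_associative_ring_bracket _ _).symm }

instance : Module (UG 𝕜) (MFun 𝕜) := Module.compHom _ (repU (𝕜 := 𝕜)).toRingHom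

theorem smul_eq_repU (u : UG 𝕜) (Ψ : MFun 𝕜) : u • Ψ = repU u Ψ := rfl

instance : IsScalarTower 𝕜 (UG 𝕜) (MFun 𝕜) where
  smul_assoc c u Ψ := by rw [smul_eq_repU, map_smul, LinearMap.smul_apply, smul_eq_repU]

theorem toUG_smul_eq (x : G 𝕜) (Ψ : MFun 𝕜) : toUG x • Ψ = repLin x Ψ :=
  congrArg (fun g : Module.End 𝕜 (MFun 𝕜) => g Ψ) (UniversalEnvelopingAlgebra.lift_ι_apply 𝕜 _ x)

theorem uE_smul_MFun (k : ℤ) (Ψ : MFun 𝕜) :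
    (uE k : UG 𝕜) • Ψ = opE (LaurentPolynomial.T k) Ψ := by
  rw [uE, toUG_smul_eq, loop, repLin_tmul]
  simp [e, Matrix.single]

theorem uH_smul_MFun (k : ℤ) (Ψ : MFun 𝕜) :
    (uH k : UG 𝕜) • Ψ = opH (LaurentPolynomial.T k) Ψ := by
  rw [uH, toUG_smul_eq, loop, repLin_tmul]
  simp [h, Matrix.single]

theorem uF_smul_MFun (k : ℤ) (Ψ : MFun 𝕜) :
    (uF k : UG 𝕜) • Ψ = opF (LaurentPolynomial.T k) Ψ := by
  rw [uF, toUG_smul_eq, loop, repLin_tmul]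
  simp [f, Matrix.single]

end FunctionModel

/-! ### Homomorphisms from `U(H)` to commutative algebras. -/

section UHLift

variable {A : Type*} [CommRing A] [Algebra 𝕜 A]

/-- The linear map `H → A` with `h(k) ↦ a k`. -/
def hLin (a : ℤ → A) : H 𝕜 →ₗ[𝕜] A :=
  ((AddMonoidAlgebra.basis ℤ 𝕜).constr 𝕜 a) ∘ₗ
    (TensorProduct.rid 𝕜 𝕜[T;T⁻¹]).toLinearMap ∘ₗ
      ((Matrix.entryLinearMap 𝕜 𝕜 (0 : Fin 2) (0 : Fin 2) ∘ₗ
        (LieAlgebra.SpecialLinear.sl (Fin 2) 𝕜).toSubmodule.subtype).lTensor 𝕜[T;T⁻¹]) ∘ₗ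
        (H 𝕜).toSubmodule.subtype

theorem hLin_hH (a : ℤ → A) (k : ℤ) : hLin a (hH k : H 𝕜) = a k := by
  have h2 : (AddMonoidAlgebra.basis ℤ 𝕜 k : 𝕜[T;T⁻¹]) = LaurentPolynomial.T k :=
    AddMonoidAlgebra.basis_apply 𝕜 k
  have h3 : hLin a (hH k : H 𝕜) = (AddMonoidAlgebra.basis ℤ 𝕜).constr 𝕜 a
      ((h 𝕜).val 0 0 • (LaurentPolynomial.T k : 𝕜[T;T⁻¹])) := rfl
  have h4 : (h 𝕜).val 0 0 = 1 := by simp [h]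
  rw [h3, h4, one_smul, ← h2, Module.Basis.constr_basis]

/-- The algebra homomorphism `U(H) → A` with `h(k) ↦ a k`. -/
def uhLift (a : ℤ → A) : UH 𝕜 →ₐ[𝕜] A :=
  UniversalEnvelopingAlgebra.lift 𝕜
    { hLin a with
      map_lie' := by
        intro x y
        have h1 : (hLin a) ⁅x, y⁆ = 0 := by rw [lie_eq_zero, map_zero]
        have h2 : ⁅hLin a x, hLin a y⁆ = 0 := by
          rw [LieRing.of_associative_ring_bracket, mul_comm, sub_self]
        exact h1.trans h2.symm }

@[simp]
theorem uhLift_yH (a : ℤ → A) (k : ℤ) : uhLift a (yH k : UH 𝕜) = a k :=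
  (UniversalEnvelopingAlgebra.lift_ι_apply 𝕜 _ _).trans (hLin_hH a k)

end UHLift

/-! ### Laurent polynomials in `n` variables and the map `psi`. -/

section LaurentTuples

variable (𝕜) in
/-- Laurent polynomials in `n` variables. -/
abbrev Lau (n : ℕ) : Type _ := AddMonoidAlgebra 𝕜 (Fin n → ℤ)

variable {A : Type*} [CommRing A] [Algebra 𝕜 A] {n : ℕ}

/-- Evaluation of Laurent polynomials in `n` variables at a tuple of units. -/
def tupleHom (x : Fin n → Aˣ) : Lau 𝕜 n →ₐ[𝕜] A :=
  AddMonoidAlgebra.lift 𝕜 A (Fin n → ℤ)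
    { toFun := fun l => ((∏ i, x i ^ l.toAdd i : Aˣ) : A)
      map_one' := by simp
      map_mul' := fun l m => by
        rw [← Units.val_mul, ← Finset.prod_mul_distrib]
        simp [zpow_add] }

theorem tupleHom_single (x : Fin n → Aˣ) (l : Fin n → ℤ) (a : 𝕜) :
    tupleHom x (AddMonoidAlgebra.single l a : Lau 𝕜 n) = a • ((∏ i, x i ^ l i : Aˣ) : A) := by
  rw [tupleHom, AddMonoidAlgebra.lift_single]
  rfl

/-- The monomial `zᵢᵏ`. -/
def zpowL (i : Fin n) (k : ℤ) : Lau 𝕜 n := AddMonoidAlgebra.single (Pi.single i k) 1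

@[simp]
theorem tupleHom_zpowL (x : Fin n → Aˣ) (i : Fin n) (k : ℤ) :
    tupleHom x (zpowL i k : Lau 𝕜 n) = ((x i ^ k : Aˣ) : A) := by
  rw [zpowL, tupleHom_single, one_smul]
  congr 1
  rw [Finset.prod_eq_single i]
  · simp
  · intro j _ hj
    simp [Pi.single_eq_of_ne hj]
  · simp

theorem zpowL_mul (i : Fin n) (k l : ℤ) : (zpowL i k * zpowL i l : Lau 𝕜 n) = zpowL i (k + l) := by
  rw [zpowL, zpowL, zpowL, AddMonoidAlgebra.single_mul_single, one_mul, Pi.single_add]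

theorem zpowL_zero (i : Fin n) : (zpowL i 0 : Lau 𝕜 n) = 1 := by
  rw [zpowL, Pi.single_zero]
  rfl

theorem zpowL_pow (i : Fin n) (k : ℤ) (r : ℕ) : (zpowL i k ^ r : Lau 𝕜 n) = zpowL i (r * k) := by
  induction r with
  | zero => simp [zpowL_zero]
  | succ r ih => rw [pow_succ, ih, zpowL_mul]; push_cast; ring_nf

variable (𝕜) in
/-- The power sum `z₁ᵏ + ⋯ + zₙᵏ`. -/
def powL (n : ℕ) (k : ℤ) : Lau 𝕜 n := ∑ i, zpowL i k

variable (𝕜) in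
/-- The homomorphism from `U(H)` to Laurent polynomials with `h(k) ↦ -2(z₁ᵏ + ⋯ + zₙᵏ)`. -/
def psi (n : ℕ) : UH 𝕜 →ₐ[𝕜] Lau 𝕜 n := uhLift fun k => (-2 : 𝕜) • powL 𝕜 n k

@[simp]
theorem psi_yH (k : ℤ) : psi 𝕜 n (yH k) = (-2 : 𝕜) • powL 𝕜 n k := uhLift_yH _ k

theorem zpow_two_injective [CharZero 𝕜] : Function.Injective fun d : ℤ => (2 : 𝕜) ^ d := by
  intro a b hab
  have h1 : (((2 : ℚ) ^ a : ℚ) : 𝕜) = (((2 : ℚ) ^ b : ℚ) : 𝕜) := by push_cast; exact hab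
  exact zpow_right_injective₀ (by norm_num) (by norm_num) (Rat.cast_injective h1)

/-- A Laurent polynomial that vanishes at all tuples of units is zero. -/
theorem eq_zero_of_tupleHom [CharZero 𝕜] {Q : Lau 𝕜 n}
    (hQ : ∀ z : Fin n → 𝕜ˣ, tupleHom z Q = 0) : Q = 0 := by
  let χ : (Fin n → ℤ) → ((Fin n → 𝕜ˣ) →* 𝕜) := fun l =>
    { toFun := fun z => ((∏ i, z i ^ l i : 𝕜ˣ) : 𝕜)
      map_one' := by simp
      map_mul' := fun z w => by
        rw [← Units.val_mul, ← Finset.prod_mul_distrib]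
        simp [mul_zpow] }
  -- The tuple with `2` in position `i` and `1` elsewhere reads off the `i`-th exponent.
  have hχ : Function.Injective χ := by
    intro l m hlm
    funext i
    let z : Fin n → 𝕜ˣ := Function.update 1 i (Units.mk0 2 two_ne_zero)
    have h1 : ∀ l : Fin n → ℤ, χ l z = (2 : 𝕜) ^ l i := by
      intro l
      change ((∏ j, z j ^ l j : 𝕜ˣ) : 𝕜) = _
      rw [Finset.prod_eq_single i]
      · simp [z]
      · intro j _ hj
        simp [z, Function.update_of_ne hj]
      · simp
    have h2 := DFunLike.congr_fun hlm z
    rw [h1, h1] at h2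
    exact zpow_two_injective h2
  -- Distinct monomials are distinct characters of the torus, hence linearly independent by
  -- Dedekind's theorem.
  have hind := (linearIndependent_monoidHom (Fin n → 𝕜ˣ) 𝕜).comp χ hχ
  have h3 : Q.coeff = 0 := by
    refine linearIndependent_iff.1 hind Q.coeff ?_
    funext z
    have h4 := hQ z
    rw [tupleHom, AddMonoidAlgebra.lift_apply] at h4
    rw [Finsupp.linearCombination_apply, Finsupp.sum, Finset.sum_apply]
    exact h4
  cases Q
  exact congrArg _ h3

/-- The unit `αt` of the ring of Laurent polynomials. -/
def unitT (α : 𝕜ˣ) : 𝕜[T;T⁻¹]ˣ :=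
  MonoidHom.toHomUnits
    ({ toFun := fun k => ((α ^ k.toAdd : 𝕜ˣ) : 𝕜) • (LaurentPolynomial.T k.toAdd : 𝕜[T;T⁻¹])
       map_one' := by simp
       map_mul' := fun k l => by
        rw [toAdd_mul, LaurentPolynomial.T_add, zpow_add, Units.val_mul, smul_mul_smul_comm] } :
      Multiplicative ℤ →* 𝕜[T;T⁻¹]) (Multiplicative.ofAdd 1)

theorem unitT_zpow (α : 𝕜ˣ) (k : ℤ) :
    ((unitT α ^ k : 𝕜[T;T⁻¹]ˣ) : 𝕜[T;T⁻¹]) =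
      ((α ^ k : 𝕜ˣ) : 𝕜) • (LaurentPolynomial.T k : 𝕜[T;T⁻¹]) := by
  rw [unitT, ← map_zpow, MonoidHom.coe_toHomUnits]
  simp

/-- For `φ(k) = -2 ∑ αᵢᵏ`, the map `φ̃` is evaluation at `zᵢ = αᵢ t`. -/
theorem tilde_eq {φ : ℤ → 𝕜} {α : Fin n → 𝕜ˣ} (hφ : ∀ k, φ k = -2 * ∑ i, ((α i ^ k : 𝕜ˣ) : 𝕜)) :
    tilde φ = (tupleHom fun i => unitT (α i)).comp (psi 𝕜 n) := by
  refine uh_hom_ext fun k => ?_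
  rw [AlgHom.comp_apply, psi_yH, yH, tilde_h, map_smul, powL, map_sum, hφ, mul_smul,
    Finset.sum_smul]
  simp [unitT_zpow]

theorem exists_units_of_mem_Exp {φ : ℤ → 𝕜} (hφ : φ ∈ Exp 𝕜) :
    ∃ (n : ℕ) (α : Fin n → 𝕜ˣ), ∀ k, φ k = -2 * ∑ i, ((α i ^ k : 𝕜ˣ) : 𝕜) := by
  obtain ⟨n, α, hα, h1⟩ := hφ
  exact ⟨n, fun i => Units.mk0 (α i) (hα i), fun k => by simp [h1 k]⟩

end LaurentTuples

/-! ### The discriminant as a highest weight vector. -/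

section Discriminant

variable {n : ℕ}

/-- The multiset of entries of a tuple. -/
def toMultiset (z : Fin n → 𝕜ˣ) : Multiset 𝕜ˣ := Finset.univ.val.map z

theorem exists_toMultiset {S : Multiset 𝕜ˣ} (hS : S.card = n) :
    ∃ z : Fin n → 𝕜ˣ, S = toMultiset z := by
  subst hS
  induction S using Quotient.inductionOn with
  | _ l =>
    refine ⟨fun i => l.get i, ?_⟩
    rw [toMultiset, Fin.univ_val_map]
    exact congrArg _ (List.ofFn_get l).symm

theorem card_toMultiset (z : Fin n → 𝕜ˣ) : (toMultiset z).card = n := by simp [toMultiset]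

/-- The character of `U(H)` by which it acts on functions at a multiset `S`. -/
def evU (S : Multiset 𝕜ˣ) : UH 𝕜 →ₐ[𝕜] 𝕜 :=
  uhLift fun k => -2 * powSum (LaurentPolynomial.T k) S

theorem incUH_smul_MFun (y : UH 𝕜) (Ψ : MFun 𝕜) (S : Multiset 𝕜ˣ) :
    (incUH y • Ψ) S = evU S y * Ψ S := by
  let K : Submodule 𝕜 (UH 𝕜) :=
    { carrier := {y | (incUH y • Ψ) S = evU S y * Ψ S}
      add_mem' := fun {a b} ha hb => by
        change _ = _ at ha hb ⊢
        rw [map_add, add_smul, MFun.add_apply, ha, hb, map_add, add_mul]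
      zero_mem' := by
        change _ = _
        rw [map_zero, zero_smul, map_zero, zero_mul, MFun.zero_apply]
      smul_mem' := fun a y hy => by
        change _ = _ at hy ⊢
        rw [map_smul, smul_assoc, MFun.smul_apply, hy, map_smul, smul_eq_mul, mul_assoc] }
  have h1 : K = ⊤ := uh_eq_top K (by
      change _ = _
      rw [map_one, one_smul, map_one, one_mul]) fun k y hy => by
    change _ = _ at hy ⊢
    rw [map_mul, mul_smul, incUH_yH, uH_smul_MFun, opH_apply, hy, map_mul, evU, uhLift_yH]
    ring
  have h2 : y ∈ K := h1 ▸ Submodule.mem_top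
  exact h2

theorem powSum_toMultiset (z : Fin n → 𝕜ˣ) (k : ℤ) :
    powSum (LaurentPolynomial.T k) (toMultiset z) = ∑ i, ((z i ^ k : 𝕜ˣ) : 𝕜) := by
  rw [powSum, toMultiset, Multiset.map_map]
  simp [Finset.sum]

theorem evU_toMultiset (z : Fin n → 𝕜ˣ) (y : UH 𝕜) :
    evU (toMultiset z) y = tupleHom z (psi 𝕜 n y) := by
  have h1 : evU (toMultiset z) = (tupleHom z).comp (psi 𝕜 n) := uh_hom_ext fun k => by
    rw [AlgHom.comp_apply, psi_yH, evU, uhLift_yH, powSum_toMultiset, map_smul, powL, map_sum]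
    simp
  rw [h1, AlgHom.comp_apply]

variable (𝕜) in
/-- An element of `U(H)` of degree zero mapped by `psi` to the determinant of the power sums
`z₁^(i-j) + ⋯ + zₙ^(i-j)`. -/
def discElt (n : ℕ) : UH 𝕜 :=
  ∑ σ : Equiv.Perm (Fin n), Equiv.Perm.sign σ •
    (List.ofFn fun i : Fin n => (-2⁻¹ : 𝕜) • yH (((σ i : ℕ) : ℤ) - ((i : ℕ) : ℤ))).prod

theorem psi_discElt [CharZero 𝕜] : psi 𝕜 n (discElt 𝕜 n) =
    Matrix.det (Matrix.of fun i j : Fin n => powL 𝕜 n (((i : ℕ) : ℤ) - ((j : ℕ) : ℤ))) := by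
  rw [Matrix.det_apply, discElt, map_sum]
  refine Finset.sum_congr rfl fun σ _ => ?_
  rw [Units.smul_def, Units.smul_def, map_zsmul, map_list_prod, List.map_ofFn, List.prod_ofFn]
  congr 1
  refine Finset.prod_congr rfl fun i _ => ?_
  rw [Function.comp_apply, map_smul, psi_yH, smul_smul]
  simp

/-- The power sum of exponent `i - j` is `∑ₘ zₘⁱ zₘ⁻ʲ`, so the matrix is a product of two
Vandermonde matrices, in the `zₘ` and in their inverses. -/
theorem tupleHom_psi_discElt [CharZero 𝕜] (z : Fin n → 𝕜ˣ) :
    tupleHom z (psi 𝕜 n (discElt 𝕜 n)) =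
      (Matrix.vandermonde fun i => (z i : 𝕜)).det *
        (Matrix.vandermonde fun i => ((z i)⁻¹ : 𝕜)).det := by
  rw [psi_discElt, AlgHom.map_det, ← Matrix.det_transpose (Matrix.vandermonde fun i => (z i : 𝕜)),
    ← Matrix.det_mul]
  congr 1
  ext i j
  simp only [AlgHom.mapMatrix_apply, Matrix.map_apply, Matrix.of_apply, Matrix.mul_apply,
    Matrix.transpose_apply, Matrix.vandermonde_apply, powL, map_sum, tupleHom_zpowL]
  refine Finset.sum_congr rfl fun m _ => ?_
  rw [Units.val_zpow_eq_zpow_val, zpow_sub₀ (Units.ne_zero _), zpow_natCast, zpow_natCast, inv_pow,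
    div_eq_mul_inv]

/-- Every term of the Leibniz expansion has degree `∑ (σ i - i) = 0`. This is the reason for the
exponents `i - j`: the discriminant vector stays in degree zero. -/
theorem incUH_discElt_mem : incUH (discElt 𝕜 n) ∈ ugGrading (𝕜 := 𝕜) 0 := by
  rw [discElt, map_sum]
  refine Submodule.sum_mem _ fun σ _ => ?_
  rw [Units.smul_def, map_zsmul]
  refine zsmul_mem ?_ _
  have key : ∀ (m : ℕ) (a : Fin m → ℤ), incUH (List.ofFn fun i : Fin m =>
      (-2⁻¹ : 𝕜) • (yH (a i) : UH 𝕜)).prod ∈ ugGrading (𝕜 := 𝕜) (∑ i, a i) := by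
    intro m
    induction m with
    | zero => intro a; simpa using one_mem_ugGrading
    | succ m ih =>
      intro a
      rw [List.ofFn_succ, List.prod_cons, Fin.sum_univ_succ, map_mul, map_smul, incUH_yH]
      exact mul_mem_ugGrading (Submodule.smul_mem _ _ (toUG_mem_ugGrading (h 𝕜) _))
        (ih fun i => a i.succ)
  have h1 := key n fun i => ((σ i : ℕ) : ℤ) - ((i : ℕ) : ℤ)
  rwa [Finset.sum_sub_distrib, Equiv.sum_comp σ fun i : Fin n => ((i : ℕ) : ℤ), sub_self] at h1

variable (𝕜) in
/-- The function supported on the empty multiset. -/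
def deltaFun : MFun 𝕜 := MFun.mk fun S => if S.card = 0 then 1 else 0

theorem uE_smul_deltaFun (k : ℤ) : (uE k : UG 𝕜) • deltaFun 𝕜 = 0 := by
  refine MFun.ext fun S => ?_
  rw [uE_smul_MFun, opE_apply]
  simp [deltaFun]

theorem uH_smul_deltaFun (k : ℤ) : (uH k : UG 𝕜) • deltaFun 𝕜 = 0 := by
  refine MFun.ext fun S => ?_
  rw [uH_smul_MFun, opH_apply]
  by_cases hS : S = 0 <;> simp [deltaFun, hS, powSum]

/-- On a multiset with `n + 1` elements, each of the `n + 1` deletions contributes `n!`. -/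
theorem uF_pow_smul_deltaFun (n : ℕ) : ((uF 0 : UG 𝕜) ^ n) • deltaFun 𝕜 =
    MFun.mk fun S => if S.card = n then (n.factorial : 𝕜) else 0 := by
  classical
  induction n with
  | zero => simp [deltaFun]
  | succ n ih =>
    refine MFun.ext fun S => ?_
    rw [pow_succ', mul_smul, ih, uF_smul_MFun, opF_apply]
    have h1 : (S.map fun z => evalAt z (LaurentPolynomial.T 0 : 𝕜[T;T⁻¹]) *
        (MFun.mk fun S => if S.card = n then (n.factorial : 𝕜) else 0) (S.erase z)) =
        S.map fun _ => if S.card = n + 1 then (n.factorial : 𝕜) else 0 := by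
      refine Multiset.map_congr rfl fun z hz => ?_
      have h2 := Multiset.card_erase_add_one hz
      simp [← h2]
    rw [h1]
    by_cases hS : S.card = n + 1
    · simp [hS, Nat.factorial_succ]
      ring
    · simp [hS]

variable (𝕜) in
/-- The highest weight vector of weight `-2n`: the discriminant in `n` variables. -/
def discFun (n : ℕ) : MFun 𝕜 := incUH (discElt 𝕜 n) • ((uF 0 : UG 𝕜) ^ n) • deltaFun 𝕜

theorem discFun_apply (S : Multiset 𝕜ˣ) : discFun 𝕜 n S =
    evU S (discElt 𝕜 n) * if S.card = n then (n.factorial : 𝕜) else 0 := by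
  rw [discFun, incUH_smul_MFun, uF_pow_smul_deltaFun, MFun.mk_apply]

theorem discFun_mem_wt : discFun 𝕜 n ∈ wt (MFun 𝕜) (-2 * (n : 𝕜)) := by
  rw [mem_wt]
  refine MFun.ext fun S => ?_
  rw [uH_smul_MFun, opH_apply, MFun.smul_apply, discFun_apply]
  by_cases hS : S.card = n
  · simp [hS, powSum]
  · simp [hS]

variable [CharZero 𝕜]

/-- `e(k)` evaluates the function at multisets `w ::ₘ S` with `w ∈ S`; these have a repeated point,
where the discriminant vanishes. -/
theorem uE_smul_discFun (k : ℤ) : (uE k : UG 𝕜) • discFun 𝕜 n = 0 := by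
  refine MFun.ext fun S => ?_
  rw [uE_smul_MFun, opE_apply, MFun.zero_apply, neg_eq_zero]
  refine Multiset.sum_eq_zero fun x hx => ?_
  obtain ⟨w, hw, rfl⟩ := Multiset.mem_map.1 hx
  rw [discFun_apply]
  by_cases hS : (w ::ₘ S).card = n
  · obtain ⟨z, hz⟩ := exists_toMultiset hS
    have h1 : ¬ Function.Injective fun i => (z i : 𝕜) := by
      intro hinj
      have h2 : Function.Injective z := fun i j hij => hinj (congrArg Units.val hij)
      have h3 : (w ::ₘ S).Nodup := hz ▸ Finset.univ.nodup.map h2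
      exact (Multiset.nodup_cons.1 h3).1 hw
    have h4 : (Matrix.vandermonde fun i => (z i : 𝕜)).det = 0 := by
      by_contra hne
      exact h1 (Matrix.det_vandermonde_ne_zero_iff.1 hne)
    rw [hz, evU_toMultiset, tupleHom_psi_discElt, h4]
    ring
  · rw [if_neg hS]
    ring

theorem psi_discElt_ne_zero : psi 𝕜 n (discElt 𝕜 n) ≠ 0 := by
  intro h0
  -- The points `1, …, n` are distinct in characteristic zero, and so are their inverses.
  let z : Fin n → 𝕜ˣ := fun i => Units.mk0 ((i : ℕ) + 1 : 𝕜) (Nat.cast_add_one_ne_zero _)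
  have h1 := tupleHom_psi_discElt z
  rw [h0, map_zero, eq_comm, mul_eq_zero] at h1
  have hz : Function.Injective fun i => (z i : 𝕜) := by
    intro i j hij
    have h2 : ((i : ℕ) : 𝕜) + 1 = ((j : ℕ) : 𝕜) + 1 := hij
    exact Fin.ext (Nat.cast_injective (add_right_cancel h2))
  rcases h1 with h1 | h1
  · exact Matrix.det_vandermonde_ne_zero_iff.2 hz h1
  · exact Matrix.det_vandermonde_ne_zero_iff.2 (inv_injective.comp hz) h1

/-- `U(H)` acts on the discriminant through a faithful action of symmetric Laurent polynomials. -/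
theorem psi_eq_zero_of_smul_discFun {y : UH 𝕜} (hy : incUH y • discFun 𝕜 n = 0) :
    psi 𝕜 n y = 0 := by
  -- At a tuple the function `discFun` is `n!` times the discriminant, so the product vanishes at
  -- all tuples; the Laurent polynomials have no zero divisors.
  have h1 : psi 𝕜 n y * psi 𝕜 n (discElt 𝕜 n) = 0 := eq_zero_of_tupleHom fun z => by
    have h2 := congrArg (fun Ψ : MFun 𝕜 => Ψ (toMultiset z)) hy
    simp only [MFun.zero_apply] at h2
    rw [incUH_smul_MFun, discFun_apply, if_pos (card_toMultiset z), evU_toMultiset,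
      evU_toMultiset, ← mul_assoc, ← map_mul] at h2
    exact (mul_eq_zero.1 h2).resolve_right (Nat.cast_ne_zero.2 n.factorial_ne_zero)
  exact (mul_eq_zero.1 h1).resolve_right psi_discElt_ne_zero

end Discriminant

/-! ### Newton's identities and integrality. -/

section Newton

variable [CharZero 𝕜] {A : Type*} [CommRing A] [Algebra 𝕜 A] {n : ℕ}

/-- A subalgebra that contains the power sums of a tuple contains its elementary symmetric
functions. -/
theorem esymm_mem_of_powerSum_mem (R : Subalgebra 𝕜 A) (x : Fin n → A)
    (hx : ∀ k : ℕ, 0 < k → ∑ i, x i ^ k ∈ R) (k : ℕ) : (Finset.univ.val.map x).esymm k ∈ R := by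
  induction k using Nat.strong_induction_on with
  | _ k ih =>
    rcases Nat.eq_zero_or_pos k with rfl | hk
    · simp [Multiset.esymm, R.one_mem]
    have h1 := congrArg (MvPolynomial.aeval x) (MvPolynomial.mul_esymm_eq_sum (Fin n) 𝕜 k)
    simp only [map_mul, map_sum, map_pow, map_neg, map_one, map_natCast,
      MvPolynomial.aeval_esymm_eq_multiset_esymm, MvPolynomial.psum, MvPolynomial.aeval_X] at h1
    have h2 : (k : A) * (Finset.univ.val.map x).esymm k ∈ R := by
      rw [h1]
      refine R.mul_mem (R.pow_mem (R.neg_mem R.one_mem) _) (R.sum_mem fun a ha => ?_)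
      rw [Finset.mem_filter, Finset.HasAntidiagonal.mem_antidiagonal] at ha
      exact R.mul_mem (R.mul_mem (R.pow_mem (R.neg_mem R.one_mem) _) (ih _ ha.2))
        (hx _ (by omega))
    -- Newton's identity gives `k` times the symmetric function; characteristic zero allows division
    -- by `k`.
    have h3 := R.smul_mem h2 ((k : 𝕜)⁻¹)
    rwa [← map_natCast (algebraMap 𝕜 A), ← Algebra.smul_def, smul_smul,
      inv_mul_cancel₀ (Nat.cast_ne_zero.2 hk.ne'), one_smul] at h3

theorem prod_mem_of_powerSum_mem (R : Subalgebra 𝕜 A) (x : Fin n → A)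
    (hx : ∀ k : ℕ, 0 < k → ∑ i, x i ^ k ∈ R) : ∏ i, x i ∈ R := by
  have h1 := esymm_mem_of_powerSum_mem R x hx n
  rw [Finset.esymm_map_val] at h1
  have h2 : Finset.powersetCard n (Finset.univ : Finset (Fin n)) = {Finset.univ} := by
    simpa using Finset.powersetCard_self (Finset.univ : Finset (Fin n))
  rwa [h2, Finset.sum_singleton] at h1

/-- `x i` is a root of `∏ (X - x j)`, whose coefficients are, up to sign, elementary symmetric
functions and so lie in `R`. -/
theorem isIntegral_of_powerSum_mem (R : Subalgebra 𝕜 A) (x : Fin n → A)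
    (hx : ∀ k : ℕ, 0 < k → ∑ i, x i ^ k ∈ R) (i : Fin n) : IsIntegral R (x i) := by
  classical
  let p : Polynomial A := ((Finset.univ.val.map x).map fun t => Polynomial.X - Polynomial.C t).prod
  have hp : p.Monic := Polynomial.monic_multiset_prod_of_monic _ _ fun t _ =>
    Polynomial.monic_X_sub_C t
  have hlift : p ∈ Polynomial.lifts (algebraMap R A) := by
    have h1 : p = _ := Multiset.prod_X_sub_X_eq_sum_esymm (Finset.univ.val.map x)
    rw [h1]
    refine Subsemiring.sum_mem _ fun j _ => ?_
    have hX : (Polynomial.X : Polynomial A) ∈ Polynomial.lifts (algebraMap R A) :=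
      ⟨Polynomial.X, by simp⟩
    have hneg : (-1 : Polynomial A) ∈ Polynomial.lifts (algebraMap R A) := ⟨-1, by simp⟩
    have hC : Polynomial.C ((Finset.univ.val.map x).esymm j) ∈
        Polynomial.lifts (algebraMap R A) :=
      ⟨Polynomial.C ⟨_, esymm_mem_of_powerSum_mem R x hx j⟩, by simp⟩
    exact Subsemiring.mul_mem _ (Subsemiring.pow_mem _ hneg _)
      (Subsemiring.mul_mem _ hC (Subsemiring.pow_mem _ hX _))
  obtain ⟨q, hq, -, hqm⟩ := Polynomial.lifts_and_natDegree_eq_and_monic hlift hp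
  refine ⟨q, hqm, ?_⟩
  rw [← Polynomial.eval_map, hq]
  have h2 : Polynomial.X - Polynomial.C (x i) ∣ p :=
    Multiset.dvd_prod (Multiset.mem_map_of_mem _ (Multiset.mem_map_of_mem _ (Finset.mem_univ i)))
  obtain ⟨r, hr⟩ := h2
  rw [hr]
  simp

end Newton

theorem exists_comp_map_eq {M Λ : Type*} [AddCommGroup M] [Module 𝕜 M] [Module (UG 𝕜) M]
    [IsScalarTower 𝕜 (UG 𝕜) M] [AddCommGroup Λ] [Module 𝕜 Λ] {𝓜 : ℤ → Submodule 𝕜 M}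
    (hM : IsGrading 𝓜) {𝓛 : ℤ → Submodule 𝕜 Λ} (g : Λ →ₗ[𝕜] M) (hg : ∀ d, ∀ v ∈ 𝓛 d, g v ∈ 𝓜 d)
    (htop : ⨆ d, 𝓛 d = ⊤) (d : ℤ) (v : Λ) : ∃ v' ∈ 𝓛 d, comp hM d (g v) = g v' := by
  have hv : v ∈ ⨆ d, 𝓛 d := htop ▸ Submodule.mem_top
  induction hv using Submodule.iSup_induction' with
  | zero => exact ⟨0, Submodule.zero_mem _, by simp⟩
  | add p q _ _ hp hq =>
    obtain ⟨p', hp', hp⟩ := hp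
    obtain ⟨q', hq', hq⟩ := hq
    exact ⟨p' + q', Submodule.add_mem _ hp' hq', by rw [map_add, map_add, hp, hq, map_add]⟩
  | mem i p hp =>
    by_cases hi : i = d
    · subst hi
      exact ⟨p, hp, comp_of_mem _ (hg _ _ hp)⟩
    · exact ⟨0, Submodule.zero_mem _, by rw [comp_of_mem_ne _ (hg _ _ hp) hi, map_zero]⟩

/-! ### The modules `P(φ)` and `F(φ)`. -/

section PPhi

variable (φ : ℤ → 𝕜)

theorem pRep_yH_zero (p : P φ) : pRep φ (yH 0) p = φ 0 • p := by
  apply Subtype.ext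
  change tilde φ (yH 0) * (p : 𝕜[T;T⁻¹]) = φ 0 • (p : 𝕜[T;T⁻¹])
  rw [yH, tilde_h]
  simp

theorem pRep_one (y : UH 𝕜) : pRep φ y 1 = (tilde φ).rangeRestrict y := mul_one _

theorem mem_pGrading {d : ℤ} {p : P φ} :
    p ∈ pGrading φ d ↔ ∃ a : 𝕜, a • (LaurentPolynomial.T d : 𝕜[T;T⁻¹]) = p := by
  rw [pGrading, Submodule.mem_comap, Submodule.mem_span_singleton]
  rfl

theorem one_mem_pGrading : (1 : P φ) ∈ pGrading φ 0 :=
  (mem_pGrading φ).2 ⟨1, by simp⟩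

theorem iSup_pGrading : ⨆ d, pGrading φ d = ⊤ := by
  have h1 : (⨆ d, pGrading φ d).comap (tilde φ).rangeRestrict.toLinearMap = ⊤ := by
    refine uh_eq_top _ ?_ fun k y hy => ?_
    · refine Submodule.mem_iSup_of_mem 0 ?_
      rw [AlgHom.toLinearMap_apply, map_one]
      exact one_mem_pGrading φ
    · rw [Submodule.mem_comap, AlgHom.toLinearMap_apply] at hy ⊢
      rw [map_mul]
      generalize (tilde φ).rangeRestrict y = p at hy
      induction hy using Submodule.iSup_induction' with
      | zero => rw [mul_zero]; exact Submodule.zero_mem _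
      | add p q _ _ hp hq => rw [mul_add]; exact Submodule.add_mem _ hp hq
      | mem d p hp =>
        obtain ⟨a, ha⟩ := (mem_pGrading φ).1 hp
        refine Submodule.mem_iSup_of_mem (k + d) ((mem_pGrading φ).2 ⟨φ k * a, ?_⟩)
        change _ = tilde φ (yH k) * (p : 𝕜[T;T⁻¹])
        rw [yH, tilde_h, ← ha, smul_mul_smul_comm, LaurentPolynomial.T_add]
  refine eq_top_iff.2 fun p _ => ?_
  obtain ⟨y, rfl⟩ := (tilde φ).rangeRestrict_surjective p
  have h2 : y ∈ (⨆ d, pGrading φ d).comap (tilde φ).rangeRestrict.toLinearMap :=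
    h1 ▸ Submodule.mem_top
  exact h2

theorem scaleLaurent_mem [CharZero 𝕜] {p : 𝕜[T;T⁻¹]} (hp : p ∈ (tilde φ).range) :
    scaleLaurent p ∈ (tilde φ).range := by
  have h1 : (⊤ : Subalgebra 𝕜 (UH 𝕜)) ≤
      ((tilde φ).range.comap scaleLaurent).comap (tilde φ) := by
    refine (uh_subalgebra_eq_top _ fun k => ?_).ge
    change scaleLaurent (tilde φ (yH k)) ∈ (tilde φ).range
    have h2 : scaleLaurent (tilde φ (yH k)) = tilde φ ((2 : 𝕜) ^ k • yH k) := by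
      rw [map_smul, yH, tilde_h, map_smul, scaleLaurent_T, smul_comm]
    rw [h2]
    exact ⟨_, rfl⟩
  obtain ⟨y, rfl⟩ := hp
  exact h1 (Algebra.mem_top (x := y))

/-- The operator on `P(φ)` multiplying elements of degree `d` by `2ᵈ`. -/
def scaleP [CharZero 𝕜] : Module.End 𝕜 (P φ) where
  toFun p := ⟨scaleLaurent p, scaleLaurent_mem φ p.2⟩
  map_add' p q := Subtype.ext (map_add scaleLaurent _ _)
  map_smul' a p := Subtype.ext (map_smul scaleLaurent _ _)

theorem isScaling_scaleP [CharZero 𝕜] : IsScaling (pRep φ) (pGrading φ) (scaleP φ) where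
  commute k p := by
    apply Subtype.ext
    change (2 : 𝕜) ^ k • (tilde φ (yH k) * scaleLaurent (p : 𝕜[T;T⁻¹])) =
      scaleLaurent (tilde φ (yH k) * (p : 𝕜[T;T⁻¹]))
    rw [map_mul, yH, tilde_h, map_smul, scaleLaurent_T, ← smul_mul_assoc, smul_comm]
  eigen d p hp := by
    obtain ⟨a, ha⟩ := (mem_pGrading φ).1 hp
    apply Subtype.ext
    change scaleLaurent (p : 𝕜[T;T⁻¹]) = (2 : 𝕜) ^ d • (p : 𝕜[T;T⁻¹])
    rw [← ha, map_smul, scaleLaurent_T, smul_comm]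
  iSup_eq_top := iSup_pGrading φ

theorem isGrading_fPhiGrading [CharZero 𝕜] : IsGrading (fPhiGrading φ) :=
  (isScaling_scaleP φ).isGrading_fGrading (pRep_yH_zero φ)

/-- The image of `P(φ)` in `F(φ)`. -/
def incF : P φ →ₗ[𝕜] FPhi φ := (maxSub (pRep φ)).mkQ.restrictScalars 𝕜 ∘ₗ inducedInc (pRep φ)

theorem incF_apply (p : P φ) : incF φ p = (maxSub (pRep φ)).mkQ (inducedInc (pRep φ) p) := rfl

theorem incUH_smul_incF (y : UH 𝕜) (p : P φ) : incUH y • incF φ p = incF φ (pRep φ y p) := by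
  rw [incF_apply, ← map_smul, incUH_smul_inducedInc, incF_apply]

theorem incUH_smul_incF_one (y : UH 𝕜) :
    incUH y • incF φ 1 = incF φ ((tilde φ).rangeRestrict y) := by
  rw [incUH_smul_incF, pRep_one]

theorem uE_smul_incF (k : ℤ) (p : P φ) : (uE k : UG 𝕜) • incF φ p = 0 := by
  rw [incF_apply, ← map_smul, uE_smul_inducedInc, map_zero]

theorem incF_mem_wt (p : P φ) : incF φ p ∈ wt (FPhi φ) (φ 0) := by
  rw [mem_wt, ← incUH_yH, incUH_smul_incF, pRep_yH_zero, map_smul]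

theorem incF_mem_fPhiGrading {d : ℤ} {p : P φ} (hp : p ∈ pGrading φ d) :
    incF φ p ∈ fPhiGrading φ d :=
  Submodule.mem_map_of_mem (f := (maxSub (pRep φ)).mkQ.restrictScalars 𝕜) (inducedInc_mem hp)

theorem exists_smul_incF_one (x : FPhi φ) : ∃ u : UG 𝕜, u • incF φ 1 = x := by
  have h1 : Submodule.span (UG 𝕜)
      (LinearMap.range (inducedInc (pRep φ)) : Set (Induced (pRep φ))) ≤
      (Submodule.span (UG 𝕜) {incF φ 1}).comap (maxSub (pRep φ)).mkQ := by
    refine Submodule.span_le.2 ?_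
    rintro _ ⟨p, rfl⟩
    obtain ⟨y, rfl⟩ := (tilde φ).rangeRestrict_surjective p
    exact Submodule.mem_span_singleton.2 ⟨incUH y, incUH_smul_incF_one φ y⟩
  obtain ⟨m, rfl⟩ := Submodule.mkQ_surjective _ x
  rw [induced_eq_span] at h1
  exact Submodule.mem_span_singleton.1 (h1 (Submodule.mem_top (x := m)))

variable {φ} [CharZero 𝕜]

theorem exists_incF_mem {Q : Submodule (UG 𝕜) (FPhi φ)} (hQ : Q ≠ ⊥) :
    ∃ p, incF φ p ∈ Q ∧ incF φ p ≠ 0 :=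
  exists_inducedInc_mem (pRep_yH_zero φ) hQ

/-! ### Comparison of annihilators of highest weight vectors. -/

section Key

variable {M : Type*} [AddCommGroup M] [Module 𝕜 M] [Module (UG 𝕜) M] [IsScalarTower 𝕜 (UG 𝕜) M]

/-- Comparison of annihilators of highest weight vectors `w` and `v`, when every submodule of the
module of `v` has a vector of the same weight as `v`. -/
theorem smul_eq_zero_of_highest {F : Type*} [AddCommGroup F] [Module 𝕜 F] [Module (UG 𝕜) F]
    [IsScalarTower 𝕜 (UG 𝕜) F] {c : 𝕜} {w : M} {v : F} (hw : w ∈ wt M c) (hv : v ∈ wt F c)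
    (hew : ∀ k, (uE k : UG 𝕜) • w = 0) (hev : ∀ k, (uE k : UG 𝕜) • v = 0)
    (hF : ∀ Q : Submodule (UG 𝕜) F, Q ≠ ⊥ → ∃ p ∈ Q, p ≠ 0 ∧ p ∈ wt F c)
    (hy : ∀ y : UH 𝕜, incUH y • w = 0 → incUH y • v = 0) {u : UG 𝕜} (hu : u • w = 0) :
    u • v = 0 := by
  -- `Q` is the annihilator of `w` applied to `v`; the claim is `Q = ⊥`.
  let Q : Submodule (UG 𝕜) F :=
    { carrier := {x | ∃ u : UG 𝕜, u • w = 0 ∧ u • v = x}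
      add_mem' := by
        rintro _ _ ⟨u, hu, rfl⟩ ⟨v, hv, rfl⟩
        exact ⟨u + v, by rw [add_smul, hu, hv, add_zero], add_smul _ _ _⟩
      zero_mem' := ⟨0, zero_smul _ _, zero_smul _ _⟩
      smul_mem' := by
        rintro a _ ⟨u, hu, rfl⟩
        exact ⟨a * u, by rw [mul_smul, hu, smul_zero], mul_smul _ _ _⟩ }
  by_contra hne
  have hQ : Q ≠ ⊥ := fun h0 => hne ((Submodule.mem_bot (UG 𝕜)).1 (h0 ▸ ⟨u, hu, rfl⟩))
  obtain ⟨p, ⟨a, ha, hap⟩, hp, hpw⟩ := hF Q hQ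
  -- The pair `(w, v)` is a highest weight vector, and `(0, p) = a (w, v)` has its weight, so `(0,
  -- p) = y (w, v)` with `y ∈ U(H)`. Then `y w = 0` forces `p = y v = 0`.
  have hww : (w, v) ∈ wt (M × F) c := Prod.ext hw hv
  have hC : IsHighest (uhSpan (⊤ : Submodule 𝕜 (UH 𝕜)) (w, v)) c :=
    isHighest_uhSpan hww (fun k => Prod.ext (hew k) (hev k)) fun _ _ _ => trivial
  have hmem : ((0 : M), p) ∈ uhSpan (⊤ : Submodule 𝕜 (UH 𝕜)) (w, v) := by
    refine hC.mem_of_mem_wt ?_ (Prod.ext ?_ hpw)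
    · have h2 : ((0 : M), p) = a • (w, v) := Prod.ext ha.symm hap.symm
      rw [h2]
      exact Submodule.smul_mem _ _ (Submodule.subset_span
        (mem_uhSpan.2 ⟨1, trivial, by rw [map_one, one_smul]⟩))
    · change _ • (0 : M) = _ • (0 : M)
      rw [smul_zero, smul_zero]
  obtain ⟨y, -, hy'⟩ := mem_uhSpan.1 hmem
  have h3 := hy y (congrArg Prod.fst hy')
  exact hp ((congrArg Prod.snd hy').symm.trans h3)

/-- A highest weight vector whose annihilator in `U(H)` is contained in that of `1 ∈ P(φ)` generates
a module that maps onto `F(φ)`. -/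
theorem smul_incF_eq_zero {c : 𝕜} {w : M} (hw : w ∈ wt M c) (he : ∀ k, (uE k : UG 𝕜) • w = 0)
    (hy : ∀ y : UH 𝕜, incUH y • w = 0 → tilde φ y = 0) {u : UG 𝕜} (hu : u • w = 0) :
    u • incF φ 1 = 0 := by
  have hc : φ 0 = c := by
    -- `h(0) - c` annihilates `w`, so `φ̃` maps it to zero.
    have h1 := hy (yH 0 - algebraMap 𝕜 _ c) (by
      rw [map_sub, incUH_yH, AlgHom.commutes, sub_smul, hw, algebraMap_smul, sub_self])
    rw [map_sub, yH, tilde_h, AlgHom.commutes, LaurentPolynomial.T_zero,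
      ← Algebra.algebraMap_eq_smul_one, sub_eq_zero] at h1
    exact (algebraMap 𝕜 𝕜[T;T⁻¹]).injective h1
  subst hc
  refine smul_eq_zero_of_highest hw (incF_mem_wt φ 1) he (fun k => uE_smul_incF φ k 1)
    (fun Q hQ => ?_) (fun y hyw => ?_) hu
  · obtain ⟨p, hp, hp0⟩ := exists_incF_mem hQ
    exact ⟨_, hp, hp0, incF_mem_wt φ p⟩
  · rw [incUH_smul_incF_one, (Subtype.ext (hy y hyw) : (tilde φ).rangeRestrict y = 0),
      map_zero (incF φ)]

end Key

/-! ### Irreducibility of `F(φ)` for `φ ∈ Exp`. -/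

section Exp

variable {n : ℕ} {α : Fin n → 𝕜ˣ} (hφ : ∀ k, φ k = -2 * ∑ i, ((α i ^ k : 𝕜ˣ) : 𝕜))
include hφ

theorem tilde_eq_zero_of_smul_discFun {y : UH 𝕜} (hy : incUH y • discFun 𝕜 n = 0) :
    tilde φ y = 0 := by
  rw [tilde_eq hφ, AlgHom.comp_apply, psi_eq_zero_of_smul_discFun hy, map_zero]

/-- It suffices that `1 ∈ P(φ)` survives in `Ind P(φ)`. This is tested by a map to the multiset
functions modulo the submodule generated by `ker φ̃` applied to the discriminant. -/
theorem incF_one_ne_zero : incF φ 1 ≠ 0 := by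
  intro h0
  have h1 : inducedInc (pRep φ) 1 = 0 := eq_zero_of_mkQ_inducedInc (pRep_yH_zero φ) h0
  let I : Submodule 𝕜 (UH 𝕜) := LinearMap.ker (tilde φ).toLinearMap
  have hI : ∀ y, y ∈ I ↔ tilde φ y = 0 := fun y => Iff.rfl
  let C := uhSpan I (discFun 𝕜 n)
  have hC : IsHighest C (-2 * (n : 𝕜)) := isHighest_uhSpan discFun_mem_wt uE_smul_discFun
    fun k y hy => by
      rw [hI] at *
      rw [map_mul, hy, mul_zero]
  let B := Submodule.span (UG 𝕜) (C : Set (MFun 𝕜))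
  let w := B.mkQ (discFun 𝕜 n)
  have hw : ∀ y, tilde φ y = 0 → incUH y • w = 0 := fun y hy => by
    rw [← map_smul]
    exact (Submodule.Quotient.mk_eq_zero _).2
      (Submodule.subset_span (mem_uhSpan.2 ⟨y, hy, rfl⟩))
  -- A linear section of `φ̃` suffices to define `p ↦ s(p) w`: elements of the kernel of `φ̃` kill
  -- `w`.
  obtain ⟨s, hs⟩ := (tilde φ).rangeRestrict.toLinearMap.exists_rightInverse_of_surjective
    (LinearMap.range_eq_top.2 (tilde φ).rangeRestrict_surjective)
  have hs' : ∀ p : P φ, tilde φ (s p) = p := fun p =>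
    congrArg Subtype.val (LinearMap.congr_fun hs p)
  obtain ⟨g, hg, -⟩ := exists_induced_lift (σ := pRep φ) (AlgHom.id 𝕜 (UG 𝕜))
    ((Algebra.lsmul 𝕜 𝕜 (MFun 𝕜 ⧸ B)).toLinearMap.flip w ∘ₗ incUH.toLinearMap ∘ₗ s)
    (fun k p => by
      change (uH k : UG 𝕜) • incUH (s p) • w = incUH (s (pRep φ (yH k) p)) • w
      rw [← sub_eq_zero, ← mul_smul, ← incUH_yH, ← map_mul, ← sub_smul, ← map_sub]
      refine hw _ ?_
      rw [map_sub, map_mul, hs', hs', sub_eq_zero]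
      rfl)
    (fun k p => by
      change (uE k : UG 𝕜) • incUH (s p) • w = 0
      refine uE_incUH_smul (fun k => ?_) _ k
      rw [← map_smul, uE_smul_discFun, map_zero])
  have h2 := hg 1
  rw [h1, map_zero] at h2
  have h3 : incUH (s 1) • w = 0 := h2.symm
  have h4 : w = 0 := by
    have h5 := hw (s 1 - 1) (by rw [map_sub, hs', map_one]; exact sub_self _)
    rwa [map_sub, sub_smul, h3, map_one, one_smul, zero_sub, neg_eq_zero] at h5
  -- If `w = 0`, the discriminant lies in the top weight part `C` and equals `y` times itself with
  -- `φ̃(y) = 0`. Then `φ̃(1 - y) = 0` as well, so `1 = 0`.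
  have h6 := hC.mem_of_mem_wt ((Submodule.Quotient.mk_eq_zero _).1 h4) discFun_mem_wt
  obtain ⟨y, hy, hy'⟩ := mem_uhSpan.1 h6
  have h7 := tilde_eq_zero_of_smul_discFun hφ (y := 1 - y)
    (by rw [map_sub, sub_smul, hy', map_one, one_smul, sub_self])
  rw [map_sub, (hI y).1 hy, map_one, sub_zero] at h7
  exact one_ne_zero h7

/-- `P(φ)` contains the inverses of its homogeneous elements. -/
theorem T_neg_mem_range {d : ℤ} (hd : (LaurentPolynomial.T d : 𝕜[T;T⁻¹]) ∈ (tilde φ).range) :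
    (LaurentPolynomial.T (-d) : 𝕜[T;T⁻¹]) ∈ (tilde φ).range := by
  -- For `n = 0` the image of `φ̃` consists of constants, so `d = 0`.
  rcases Nat.eq_zero_or_pos n with rfl | hn
  · have h1 : (tilde φ).range ≤ ⊥ := by
      rintro _ ⟨y, rfl⟩
      have h2 : y ∈ (⊥ : Subalgebra 𝕜 𝕜[T;T⁻¹]).comap (tilde φ) := by
        rw [uh_subalgebra_eq_top ((⊥ : Subalgebra 𝕜 𝕜[T;T⁻¹]).comap (tilde φ)) fun k => ?_]
        · exact Algebra.mem_top
        · rw [Subalgebra.mem_comap, yH, tilde_h, hφ]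
          simp
      exact h2
    obtain ⟨a, ha⟩ := Algebra.mem_bot.1 (h1 hd)
    have h3 : ∀ z : 𝕜ˣ, a = ((z ^ d : 𝕜ˣ) : 𝕜) := fun z => by
      rw [← evalAt_T, ← ha, AlgHom.commutes]
      rfl
    have hd0 : d = 0 := by
      have h4 := (h3 1).symm.trans (h3 (Units.mk0 2 two_ne_zero))
      refine zpow_two_injective (𝕜 := 𝕜) ?_
      simpa using h4.symm
    rw [hd0, neg_zero, ← hd0]
    exact hd
  have hpow : ∀ k : ℤ, ∑ i, ((α i ^ k : 𝕜ˣ) : 𝕜) • (LaurentPolynomial.T k : 𝕜[T;T⁻¹]) ∈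
      (tilde φ).range := by
    intro k
    have h1 : tilde φ ((-2⁻¹ : 𝕜) • yH k) ∈ (tilde φ).range := ⟨_, rfl⟩
    rw [map_smul, yH, tilde_h, hφ, smul_smul, ← mul_assoc] at h1
    simpa [Finset.sum_smul] using h1
  -- The product of the `(αᵢ t)ʳ` is `t^(n r)` up to a non-zero scalar, and its factors have power
  -- sums in `P(φ)`.
  have hprod : ∀ r : ℤ, (LaurentPolynomial.T (n * r) : 𝕜[T;T⁻¹]) ∈ (tilde φ).range := by
    intro r
    have h1 := prod_mem_of_powerSum_mem (tilde φ).range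
      (fun i => ((unitT (α i) ^ r : 𝕜[T;T⁻¹]ˣ) : 𝕜[T;T⁻¹])) (fun k _ => by
        have h2 := hpow (r * k)
        refine (congrArg (· ∈ (tilde φ).range) (Finset.sum_congr rfl fun i _ => ?_)).mp h2
        rw [← unitT_zpow, zpow_mul, zpow_natCast, Units.val_pow_eq_pow_val])
    simp only [unitT_zpow] at h1
    rw [Finset.prod_smul, Finset.prod_const, Finset.card_univ, Fintype.card_fin,
      LaurentPolynomial.T_pow] at h1
    exact ((tilde φ).range.toSubmodule.smul_mem_iff
      (Finset.prod_ne_zero_iff.2 fun i _ => Units.ne_zero _)).1 h1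
  -- The exponents satisfy `-d = (n - 1) d + n (-d)`.
  have h1 := (tilde φ).range.mul_mem ((tilde φ).range.pow_mem hd (n - 1)) (hprod (-d))
  rw [LaurentPolynomial.T_pow, ← LaurentPolynomial.T_add] at h1
  convert h1 using 2
  push_cast [Nat.cast_sub hn]
  ring

omit hφ in
theorem comp_incF (d : ℤ) (p : P φ) :
    ∃ p' ∈ pGrading φ d, comp (isGrading_fPhiGrading φ) d (incF φ p) = incF φ p' := by
  exact exists_comp_map_eq _ (incF φ) (fun d p hp => incF_mem_fPhiGrading φ hp) (iSup_pGrading φ) d p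

/-- A non-zero graded submodule contains the image of a non-zero homogeneous element of `P(φ)`, a
multiple of some `tᵈ`. Multiplication by `t⁻ᵈ ∈ P(φ)` brings it to the generator. -/
theorem isGradedIrreducible_fPhi : IsGradedIrreducible (fPhiGrading φ) where
  isGrading := isGrading_fPhiGrading φ
  nontrivial := ⟨⟨_, _, incF_one_ne_zero hφ⟩⟩
  eq_bot_or_eq_top Q hQ := by
    by_cases h0 : Q = ⊥
    · exact Or.inl h0
    refine Or.inr (eq_top_iff.2 fun x _ => ?_)
    obtain ⟨p, hp, hne⟩ := exists_incF_mem h0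
    have hgr := isGrading_fPhiGrading φ
    obtain ⟨d, hd⟩ : ∃ d, comp hgr d (incF φ p) ≠ 0 := by
      by_contra! hcon
      exact hne (eq_zero_of_comp hgr hcon)
    have hdQ := (isGradedSubmodule_iff hgr).1 hQ _ hp d
    obtain ⟨p', hp', hpp'⟩ := comp_incF d p
    rw [hpp'] at hd hdQ
    obtain ⟨a, ha⟩ := (mem_pGrading φ).1 hp'
    have ha0 : a ≠ 0 := by
      rintro rfl
      rw [zero_smul] at ha
      exact hd (by rw [(Subtype.ext ha.symm : p' = 0), map_zero])
    have hT : (LaurentPolynomial.T d : 𝕜[T;T⁻¹]) ∈ (tilde φ).range :=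
      ((tilde φ).range.toSubmodule.smul_mem_iff ha0).1 (ha ▸ p'.2)
    obtain ⟨y, hy⟩ := T_neg_mem_range hφ hT
    have h1 : incUH y • incF φ p' = a • incF φ 1 := by
      rw [incUH_smul_incF, ← map_smul]
      congr 1
      apply Subtype.ext
      change tilde φ y * (p' : 𝕜[T;T⁻¹]) = a • (1 : 𝕜[T;T⁻¹])
      have hy' : tilde φ y = LaurentPolynomial.T (-d) := hy
      rw [hy', ← ha, mul_smul_comm, ← LaurentPolynomial.T_add, neg_add_cancel,
        LaurentPolynomial.T_zero]
    have h2 : a • incF φ 1 ∈ Q := h1 ▸ Q.smul_mem _ hdQ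
    have h3 : incF φ 1 ∈ Q := ((Q.restrictScalars 𝕜).smul_mem_iff ha0).1 h2
    obtain ⟨u, rfl⟩ := exists_smul_incF_one φ x
    exact Q.smul_mem u h3

end Exp

end PPhi

/-! ### Cyclic graded modules and their annihilators. -/

section Cyclic

variable {M N : Type*} [AddCommGroup M] [Module 𝕜 M] [Module (UG 𝕜) M] [IsScalarTower 𝕜 (UG 𝕜) M]
  [AddCommGroup N] [Module 𝕜 N] [Module (UG 𝕜) N] [IsScalarTower 𝕜 (UG 𝕜) N]

/-- Homogeneous components in two cyclic modules at once. -/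
theorem exists_comp_smul_eq₂ {𝓜 : ℤ → Submodule 𝕜 M} (hM : IsGrading 𝓜) {𝓝 : ℤ → Submodule 𝕜 N}
    (hN : IsGrading 𝓝) {s t : ℤ} {w : M} {v : N} (hw : w ∈ 𝓜 s) (hv : v ∈ 𝓝 t) (u : UG 𝕜) (d : ℤ) :
    ∃ u' ∈ ugGrading (𝕜 := 𝕜) d, comp hM (s + d) (u • w) = u' • w ∧
      comp hN (t + d) (u • v) = u' • v := by
  have hu : u ∈ ⨆ i, ugGrading (𝕜 := 𝕜) i := iSup_ugGrading (𝕜 := 𝕜) ▸ Submodule.mem_top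
  induction hu using Submodule.iSup_induction' with
  | mem i u hu =>
    have h1 := hM.ug_smul_mem hu hw
    have h2 := hN.ug_smul_mem hu hv
    by_cases hi : i = d
    · subst hi
      exact ⟨u, hu, comp_of_mem hM h1, comp_of_mem hN h2⟩
    · exact ⟨0, Submodule.zero_mem _, by rw [comp_of_mem_ne hM h1 (by omega), zero_smul],
        by rw [comp_of_mem_ne hN h2 (by omega), zero_smul]⟩
  | zero => exact ⟨0, Submodule.zero_mem _, by simp, by simp⟩
  | add u v _ _ hu hv =>
    obtain ⟨u', hu', hu₁, hu₂⟩ := hu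
    obtain ⟨v', hv', hv₁, hv₂⟩ := hv
    exact ⟨u' + v', Submodule.add_mem _ hu' hv', by rw [add_smul, map_add, hu₁, hv₁, add_smul],
      by rw [add_smul, map_add, hu₂, hv₂, add_smul]⟩

/-- Cyclic modules with the same annihilator are isomorphic. -/
theorem exists_cyclic_equiv {w : M} {v : N} (hw : ∀ m, ∃ u : UG 𝕜, u • w = m)
    (hv : ∀ m, ∃ u : UG 𝕜, u • v = m) (h : ∀ u : UG 𝕜, u • w = 0 ↔ u • v = 0) :
    ∃ F : M ≃ₗ[UG 𝕜] N, ∀ u : UG 𝕜, F (u • w) = u • v := by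
  let a := LinearMap.toSpanSingleton (UG 𝕜) M w
  let b := LinearMap.toSpanSingleton (UG 𝕜) N v
  have ha : Function.Surjective a := hw
  have hb : Function.Surjective b := hv
  have hab : LinearMap.ker a = LinearMap.ker b := by
    ext u
    exact h u
  refine ⟨(a.quotKerEquivOfSurjective ha).symm.trans
    ((Submodule.quotEquivOfEq _ _ hab).trans (b.quotKerEquivOfSurjective hb)), fun u => ?_⟩
  have h1 : (a.quotKerEquivOfSurjective ha).symm (u • w) = Submodule.Quotient.mk u := by
    rw [LinearEquiv.symm_apply_eq]
    rfl
  rw [LinearEquiv.trans_apply, LinearEquiv.trans_apply, h1]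
  rfl

theorem gradedIso_of_cyclic {𝓜 : ℤ → Submodule 𝕜 M} {𝓝 : ℤ → Submodule 𝕜 N} {s t : ℤ} {w : M} {v : N}
    (hw : ∀ m, ∃ u : UG 𝕜, u • w = m) (hv : ∀ m, ∃ u : UG 𝕜, u • v = m)
    (h : ∀ u : UG 𝕜, u • w = 0 ↔ u • v = 0)
    (hM : ∀ d m, m ∈ 𝓜 (s + d) ↔ ∃ u ∈ ugGrading (𝕜 := 𝕜) d, u • w = m)
    (hN : ∀ d m, m ∈ 𝓝 (t + d) ↔ ∃ u ∈ ugGrading (𝕜 := 𝕜) d, u • v = m) :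
    GradedIso (t - s) 𝓜 𝓝 := by
  obtain ⟨F, hF⟩ := exists_cyclic_equiv hw hv h
  refine ⟨F, fun d m => ?_⟩
  rw [show d = s + (d - s) by ring, hM, show s + (d - s) + (t - s) = t + (d - s) by ring, hN]
  constructor
  · rintro ⟨u, hu, rfl⟩
    exact ⟨u, hu, (hF u).symm⟩
  · rintro ⟨u, hu, hum⟩
    exact ⟨u, hu, F.injective ((hF u).trans hum)⟩

theorem mem_grading_iff_of_cyclic {𝓜 : ℤ → Submodule 𝕜 M} (hM : IsGrading 𝓜) {s : ℤ} {w : M}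
    (hw : ∀ m, ∃ u : UG 𝕜, u • w = m) (hws : w ∈ 𝓜 s) (d : ℤ) (m : M) :
    m ∈ 𝓜 (s + d) ↔ ∃ u ∈ ugGrading (𝕜 := 𝕜) d, u • w = m := by
  constructor
  · intro hm
    obtain ⟨u, rfl⟩ := hw m
    obtain ⟨u', hu', h1, -⟩ := exists_comp_smul_eq₂ hM hM hws hws u d
    exact ⟨u', hu', by rw [← h1, comp_of_mem hM hm]⟩
  · rintro ⟨u, hu, rfl⟩
    exact hM.ug_smul_mem hu hws

/-- The vectors `u w` with `u v = 0`. -/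
def annMul (w : M) (v : N) : Submodule (UG 𝕜) M :=
  (LinearMap.ker (LinearMap.toSpanSingleton (UG 𝕜) N v)).map
    (LinearMap.toSpanSingleton (UG 𝕜) M w)

theorem mem_annMul {w : M} {v : N} {m : M} :
    m ∈ annMul (𝕜 := 𝕜) w v ↔ ∃ u : UG 𝕜, u • v = 0 ∧ u • w = m := by
  simp [annMul]

/-- The same homogeneous part of `u` computes the components of both `u w` and `u v`. -/
theorem isGradedSubmodule_annMul {𝓜 : ℤ → Submodule 𝕜 M} (hM : IsGrading 𝓜)
    {𝓝 : ℤ → Submodule 𝕜 N} (hN : IsGrading 𝓝) {s t : ℤ} {w : M} {v : N} (hw : w ∈ 𝓜 s)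
    (hv : v ∈ 𝓝 t) : IsGradedSubmodule 𝓜 (annMul (𝕜 := 𝕜) w v) := by
  refine (isGradedSubmodule_iff hM).2 fun m hm d => ?_
  obtain ⟨u, hu, rfl⟩ := mem_annMul.1 hm
  obtain ⟨u', -, h1, h2⟩ := exists_comp_smul_eq₂ hM hN hw hv u (d - s)
  rw [hu, map_zero] at h2
  rw [show s + (d - s) = d by ring] at h1
  exact mem_annMul.2 ⟨u', h2.symm, h1.symm⟩

theorem isGradedSubmodule_span_singleton {𝓜 : ℤ → Submodule 𝕜 M} (hM : IsGrading 𝓜) {s : ℤ} {w : M}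
    (hw : w ∈ 𝓜 s) : IsGradedSubmodule 𝓜 (Submodule.span (UG 𝕜) {w}) := by
  refine (isGradedSubmodule_iff hM).2 fun m hm d => ?_
  obtain ⟨u, rfl⟩ := Submodule.mem_span_singleton.1 hm
  obtain ⟨u', -, h1⟩ := exists_comp_smul_eq hM hw u d
  rw [h1]
  exact Submodule.mem_span_singleton.2 ⟨u', rfl⟩

/-- A cyclic graded module is a subquotient of `M` if the annihilator of its generator contains the
annihilator of a homogeneous element of `M` of the same degree. -/
theorem isGradedSubquotient_of_cyclic {𝓜 : ℤ → Submodule 𝕜 M} (hM : IsGrading 𝓜)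
    {𝓝 : ℤ → Submodule 𝕜 N} (hN : IsGrading 𝓝) {s : ℤ} {w : M} {v : N} (hw : w ∈ 𝓜 s)
    (hv : v ∈ 𝓝 s) (hvtop : ∀ m, ∃ u : UG 𝕜, u • v = m)
    (h : ∀ u : UG 𝕜, u • w = 0 → u • v = 0) : IsGradedSubquotient 𝓝 𝓜 := by
  let A : Submodule (UG 𝕜) M := Submodule.span (UG 𝕜) {w}
  let B : Submodule (UG 𝕜) M := annMul (𝕜 := 𝕜) w v
  have hwA : w ∈ A := Submodule.mem_span_singleton_self w
  have hBA : B ≤ A := fun m hm => by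
    obtain ⟨u, -, rfl⟩ := mem_annMul.1 hm
    exact A.smul_mem u hwA
  refine ⟨A, B, hBA, isGradedSubmodule_span_singleton hM hw, isGradedSubmodule_annMul hM hN hw hv, ?_⟩
  let w' : A ⧸ B.submoduleOf A := (B.submoduleOf A).mkQ ⟨w, hwA⟩
  have hw' : ∀ u : UG 𝕜, u • w' = (B.submoduleOf A).mkQ ⟨u • w, A.smul_mem u hwA⟩ := fun u => rfl
  have hiso : GradedIso (s - s) 𝓝 (subquotientGrading 𝓜 A B) := by
    refine gradedIso_of_cyclic (v := w') hvtop (fun m => ?_) (fun u => ?_)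
      (mem_grading_iff_of_cyclic hN hvtop hv) (fun d m => ?_)
    · obtain ⟨⟨a, ha⟩, rfl⟩ := Submodule.mkQ_surjective _ m
      obtain ⟨u, rfl⟩ := Submodule.mem_span_singleton.1 ha
      exact ⟨u, hw' u⟩
    · rw [hw', Submodule.mkQ_apply, Submodule.Quotient.mk_eq_zero]
      change _ ↔ u • w ∈ B
      constructor
      · intro hu
        exact mem_annMul.2 ⟨u, hu, rfl⟩
      · intro hu
        -- If `u w = u' w` with `u' v = 0`, then `u - u'` kills `w`, hence `v`.
        obtain ⟨u', hu', h1⟩ := mem_annMul.1 hu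
        have h2 := h (u - u') (by rw [sub_smul, h1, sub_self])
        rwa [sub_smul, hu', sub_zero] at h2
    · constructor
      · intro hm
        obtain ⟨⟨a, ha⟩, ha', rfl⟩ := Submodule.mem_map.1 hm
        obtain ⟨u, rfl⟩ := Submodule.mem_span_singleton.1 ha
        obtain ⟨u', hu', h1, -⟩ := exists_comp_smul_eq₂ hM hM hw hw u d
        have h2 : u • w ∈ 𝓜 (s + d) := ha'
        rw [comp_of_mem hM h2] at h1
        refine ⟨u', hu', ?_⟩
        rw [hw']
        exact congrArg (B.submoduleOf A).mkQ (Subtype.ext h1.symm)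
      · rintro ⟨u, hu, rfl⟩
        rw [hw']
        exact Submodule.mem_map.2 ⟨⟨u • w, A.smul_mem u hwA⟩, hM.ug_smul_mem hu hw, rfl⟩
  rwa [sub_self] at hiso

/-- An irreducible graded module is isomorphic to a cyclic graded module if the annihilator of one
of its homogeneous vectors is contained in the annihilator of the generator. -/
theorem gradedIso_of_irreducible {𝓜 : ℤ → Submodule 𝕜 M} (hM : IsGrading 𝓜)
    {𝓝 : ℤ → Submodule 𝕜 N} (hN : IsGradedIrreducible 𝓝) {s t : ℤ} {w : M} {x : N} (hw : w ∈ 𝓜 t)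
    (hx : x ∈ 𝓝 s) (hx0 : x ≠ 0) (hw0 : w ≠ 0) (hwtop : ∀ m, ∃ u : UG 𝕜, u • w = m)
    (h : ∀ u : UG 𝕜, u • x = 0 → u • w = 0) : GradedIso (t - s) 𝓝 𝓜 := by
  have hxtop : ∀ m, ∃ u : UG 𝕜, u • x = m := by
    intro m
    rcases hN.eq_bot_or_eq_top _ (isGradedSubmodule_span_singleton hN.isGrading hx) with h1 | h1
    · exact absurd (Submodule.span_singleton_eq_bot.1 h1) hx0
    · exact Submodule.mem_span_singleton.1 (h1 ▸ Submodule.mem_top)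
  have hK : annMul (𝕜 := 𝕜) x w = ⊥ := by
    refine (hN.eq_bot_or_eq_top _
      (isGradedSubmodule_annMul hN.isGrading hM hx hw)).resolve_right fun htop => ?_
    -- Otherwise some `u` has `u w = 0` and `u x = x`; then `1 - u` kills `x`, hence `w`, and `w =
    -- 0`.
    obtain ⟨u, hu, hux⟩ := mem_annMul.1 (htop ▸ Submodule.mem_top : x ∈ annMul (𝕜 := 𝕜) x w)
    have h1 := h (1 - u) (by rw [sub_smul, hux, one_smul, sub_self])
    rw [sub_smul, hu, one_smul, sub_zero] at h1
    exact hw0 h1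
  refine gradedIso_of_cyclic hxtop hwtop (fun u => ⟨h u, fun hu => ?_⟩)
    (mem_grading_iff_of_cyclic hN.isGrading hxtop hx) (mem_grading_iff_of_cyclic hM hwtop hw)
  have h1 : u • x ∈ annMul (𝕜 := 𝕜) x w := mem_annMul.2 ⟨u, hu, rfl⟩
  rwa [hK, Submodule.mem_bot] at h1

end Cyclic

/-! ### `F(φ)` as a subquotient of `M̄(0)`. -/

section MBar

theorem trivialRep_yH (k : ℤ) : trivialRep (𝕜 := 𝕜) (yH k) = 0 :=
  UniversalEnvelopingAlgebra.lift_ι_apply 𝕜 _ _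

theorem trivialRep_yH_zero (v : 𝕜) : trivialRep (yH 0) v = (0 : 𝕜) • v := by
  rw [trivialRep_yH, zero_smul, LinearMap.zero_apply]

theorem isScaling_trivial : IsScaling (trivialRep (𝕜 := 𝕜)) (trivialGrading 𝕜) LinearMap.id where
  commute k v := by simp [trivialRep_yH]
  eigen d v hv := by
    by_cases hd : d = 0
    · simp [hd]
    · rw [trivialGrading, if_neg hd, Submodule.mem_bot] at hv
      simp [hv]
  iSup_eq_top := by
    refine eq_top_iff.2 (le_iSup_of_le 0 ?_)
    rw [trivialGrading, if_pos rfl]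

variable (𝕜) in
/-- The generator of `M̄(0)`. -/
def vBar : MBar 𝕜 := inducedInc (trivialRep (𝕜 := 𝕜)) 1

theorem vBar_mem : vBar 𝕜 ∈ mBarGrading 𝕜 0 :=
  inducedInc_mem (by rw [trivialGrading, if_pos rfl]; exact Submodule.mem_top)

theorem uH_smul_vBar (k : ℤ) : (uH k : UG 𝕜) • vBar 𝕜 = 0 := by
  rw [vBar, uH_smul_inducedInc, trivialRep_yH, LinearMap.zero_apply, map_zero]

variable [CharZero 𝕜]

theorem isGrading_mBar : IsGrading (mBarGrading 𝕜) := isScaling_trivial.isGrading_induced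

theorem exists_mBar_to_MFun : ∃ g : MBar 𝕜 →ₗ[𝕜] MFun 𝕜, g (vBar 𝕜) = deltaFun 𝕜 ∧
    ∀ (u : UG 𝕜) m, g (u • m) = u • g m := by
  obtain ⟨g, h1, h2⟩ := exists_induced_lift (σ := trivialRep (𝕜 := 𝕜)) (AlgHom.id 𝕜 (UG 𝕜))
    (LinearMap.toSpanSingleton 𝕜 (MFun 𝕜) (deltaFun 𝕜))
    (fun k v => by
      rw [trivialRep_yH, LinearMap.zero_apply, map_zero, AlgHom.id_apply,
        LinearMap.toSpanSingleton_apply, smul_comm, uH_smul_deltaFun, smul_zero])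
    (fun k v => by
      rw [AlgHom.id_apply, LinearMap.toSpanSingleton_apply, smul_comm, uE_smul_deltaFun,
        smul_zero])
  exact ⟨g, (h1 1).trans (one_smul _ _), h2⟩

theorem uF_pow_mem_ugGrading (n : ℕ) : (uF 0 : UG 𝕜) ^ n ∈ ugGrading (𝕜 := 𝕜) 0 := by
  induction n with
  | zero => rw [pow_zero]; exact one_mem_ugGrading (𝕜 := 𝕜)
  | succ n ih =>
    have h1 : (uF 0 : UG 𝕜) ∈ ugGrading (𝕜 := 𝕜) 0 := toUG_mem_ugGrading (f 𝕜) 0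
    have h2 := mul_mem_ugGrading ih h1
    rw [add_zero] at h2
    rwa [pow_succ]

theorem discElt_smul_mem {M : Type*} [AddCommGroup M] [Module 𝕜 M] [Module (UG 𝕜) M]
    [IsScalarTower 𝕜 (UG 𝕜) M] {𝓜 : ℤ → Submodule 𝕜 M} (hM : IsGrading 𝓜) {v : M} (hv : v ∈ 𝓜 0)
    (n : ℕ) : incUH (discElt 𝕜 n) • (uF 0 : UG 𝕜) ^ n • v ∈ 𝓜 0 := by
  have h1 := hM.ug_smul_mem (uF_pow_mem_ugGrading n) hv
  rw [add_zero] at h1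
  have h2 := hM.ug_smul_mem (incUH_discElt_mem (n := n)) h1
  rwa [add_zero] at h2

/-- The vector `w` is the same element of `U(𝔤)` applied to the generator of `M̄(0)`, and `discFun`
is its image under the map to multiset functions. -/
theorem exists_mBar_discFun (n : ℕ) : ∃ w ∈ mBarGrading 𝕜 0,
    ∀ u : UG 𝕜, u • w = 0 → u • discFun 𝕜 n = 0 := by
  obtain ⟨g, hg, hgs⟩ := exists_mBar_to_MFun (𝕜 := 𝕜)
  refine ⟨_, discElt_smul_mem isGrading_mBar vBar_mem n, fun u hu => ?_⟩
  have h1 := hgs u (incUH (discElt 𝕜 n) • (uF 0 : UG 𝕜) ^ n • vBar 𝕜)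
  rw [hu, map_zero g, hgs, hgs, hg] at h1
  exact h1.symm

theorem isGradedSubquotient_fPhi {φ : ℤ → 𝕜} {n : ℕ} {α : Fin n → 𝕜ˣ}
    (hφ : ∀ k, φ k = -2 * ∑ i, ((α i ^ k : 𝕜ˣ) : 𝕜)) :
    IsGradedSubquotient (fPhiGrading φ) (mBarGrading 𝕜) := by
  obtain ⟨w, hw, h⟩ := exists_mBar_discFun (𝕜 := 𝕜) n
  exact isGradedSubquotient_of_cyclic isGrading_mBar (isGrading_fPhiGrading φ) hw
    (incF_mem_fPhiGrading φ (one_mem_pGrading φ)) (exists_smul_incF_one φ) fun u hu =>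
      smul_incF_eq_zero discFun_mem_wt uE_smul_discFun
        (fun y hy => tilde_eq_zero_of_smul_discFun hφ hy) (h u hu)

end MBar

/-! ### Laurent polynomials as a model of the weight spaces of `M̄(0)`. -/

section Monomials

variable {M : Type*} [AddCommGroup M] [Module 𝕜 M] [Module (UG 𝕜) M] [IsScalarTower 𝕜 (UG 𝕜) M]

/-- The vector `f(l₁) ⋯ f(lₙ) v`. -/
def mono (v : M) {n : ℕ} (l : Fin n → ℤ) : M := (List.ofFn fun i => (uF (l i) : UG 𝕜)).prod • v

theorem mono_cons (v : M) {n : ℕ} (k : ℤ) (l : Fin n → ℤ) :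
    mono (𝕜 := 𝕜) v (Fin.cons k l) = (uF k : UG 𝕜) • mono (𝕜 := 𝕜) v l := by
  rw [mono, List.ofFn_succ, List.prod_cons, mul_smul]
  rfl

/-- Commuting `h(k)` through the product raises one exponent at a time by `k`, with factor `-2`, and
`h(k)` kills `v`. -/
theorem uH_smul_mono {v : M} (hv : ∀ k, (uH k : UG 𝕜) • v = 0) (k : ℤ) {n : ℕ} (l : Fin n → ℤ) :
    (uH k : UG 𝕜) • mono (𝕜 := 𝕜) v l =
      (-2 : 𝕜) • ∑ i, mono (𝕜 := 𝕜) v (Pi.single i k + l) := by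
  induction n with
  | zero => simp [mono, hv]
  | succ n ih =>
    obtain ⟨a, l, rfl⟩ : ∃ a l', l = Fin.cons a l' := ⟨l 0, Fin.tail l, (Fin.cons_self_tail l).symm⟩
    have h1 : (Pi.single 0 k + Fin.cons a l : Fin (n + 1) → ℤ) = Fin.cons (k + a) l := by
      funext i
      refine Fin.cases ?_ (fun i => ?_) i <;> simp
    have h2 : ∀ i : Fin n, (Pi.single i.succ k + Fin.cons a l : Fin (n + 1) → ℤ) =
        Fin.cons a (Pi.single i k + l) := by
      intro i
      funext j
      refine Fin.cases ?_ (fun j => ?_) j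
      · simp
      · by_cases hij : j = i
        · subst hij; simp
        · simp [Pi.single_eq_of_ne hij, Pi.single_eq_of_ne (Fin.succ_injective n |>.ne hij)]
    rw [Fin.sum_univ_succ, h1, mono_cons, mono_cons, ← mul_smul, uH_mul_uF, sub_smul, mul_smul,
      ih l, smul_assoc, smul_add, smul_comm (uF a), Finset.smul_sum]
    simp only [h2, mono_cons]
    rw [neg_smul, neg_smul]
    abel

/-- The map `z₁^l₁ ⋯ zₙ^lₙ ↦ f(l₁) ⋯ f(lₙ) v`. -/
def monoMap (v : M) (n : ℕ) : Lau 𝕜 n →ₗ[𝕜] M :=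
  (AddMonoidAlgebra.basis (Fin n → ℤ) 𝕜).constr 𝕜 fun l => mono (𝕜 := 𝕜) v l

theorem monoMap_single (v : M) {n : ℕ} (l : Fin n → ℤ) (a : 𝕜) :
    monoMap v n (AddMonoidAlgebra.single l a) = a • mono (𝕜 := 𝕜) v l := by
  have h1 : (AddMonoidAlgebra.single l a : Lau 𝕜 n) =
      a • AddMonoidAlgebra.basis (Fin n → ℤ) 𝕜 l := by
    rw [AddMonoidAlgebra.basis_apply, AddMonoidAlgebra.smul_single, smul_eq_mul, mul_one]
  rw [h1, map_smul, monoMap, Module.Basis.constr_basis]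

theorem uH_smul_monoMap {v : M} (hv : ∀ k, (uH k : UG 𝕜) • v = 0) (k : ℤ) {n : ℕ} (Q : Lau 𝕜 n) :
    (uH k : UG 𝕜) • monoMap v n Q = monoMap v n (psi 𝕜 n (yH k) * Q) := by
  induction Q using AddMonoidAlgebra.induction_linear with
  | zero => simp
  | add P Q hP hQ => rw [map_add, smul_add, hP, hQ, mul_add, map_add]
  | single l a =>
    rw [monoMap_single, smul_comm, uH_smul_mono hv, psi_yH, powL, smul_mul_assoc, Finset.sum_mul,
      map_smul, map_sum, smul_comm, Finset.smul_sum]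
    congr 1
    refine Finset.sum_congr rfl fun i _ => ?_
    rw [zpowL, AddMonoidAlgebra.single_mul_single, one_mul, monoMap_single]

/-- In particular the kernel of `psi 𝕜 n` annihilates the image of `monoMap v n`; this is how `psi`
enters the converse. -/
theorem incUH_smul_monoMap {v : M} (hv : ∀ k, (uH k : UG 𝕜) • v = 0) (y : UH 𝕜) {n : ℕ}
    (Q : Lau 𝕜 n) : incUH y • monoMap v n Q = monoMap v n (psi 𝕜 n y * Q) := by
  let S : Submodule 𝕜 (UH 𝕜) := LinearMap.eqLocus
    ((Algebra.lsmul 𝕜 𝕜 M).toLinearMap.flip (monoMap v n Q) ∘ₗ incUH.toLinearMap)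
    (monoMap v n ∘ₗ (LinearMap.mul 𝕜 (Lau 𝕜 n)).flip Q ∘ₗ (psi 𝕜 n).toLinearMap)
  have hS : ∀ y, y ∈ S ↔ incUH y • monoMap v n Q = monoMap v n (psi 𝕜 n y * Q) :=
    fun y => Iff.rfl
  have h1 : S = ⊤ := uh_eq_top S ((hS 1).2 (by simp)) fun k u hu => by
    rw [hS] at *
    rw [map_mul, mul_smul, hu, incUH_yH, uH_smul_monoMap hv, map_mul (psi 𝕜 n), mul_assoc]
  exact (hS y).1 (h1 ▸ Submodule.mem_top)

theorem layer_le_range_monoMap (v : M) {C : Submodule 𝕜 M} (hC : ∀ m ∈ C, ∃ a : 𝕜, m = a • v)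
    (n : ℕ) : layer C n ≤ LinearMap.range (monoMap v n) := by
  induction n with
  | zero =>
    intro m hm
    obtain ⟨a, rfl⟩ := hC m hm
    refine ⟨AddMonoidAlgebra.single 0 a, ?_⟩
    rw [monoMap_single]
    simp [mono]
  | succ n ih =>
    refine Submodule.span_le.2 ?_
    rintro _ ⟨k, x, hx, rfl⟩
    obtain ⟨Q, rfl⟩ := ih hx
    change _ ∈ LinearMap.range (monoMap v (n + 1))
    clear hx
    induction Q using AddMonoidAlgebra.induction_linear with
    | zero => rw [map_zero, smul_zero]; exact Submodule.zero_mem _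
    | add P Q hP hQ => rw [map_add, smul_add]; exact Submodule.add_mem _ hP hQ
    | single l a =>
      refine ⟨AddMonoidAlgebra.single (Fin.cons k l) a, ?_⟩
      rw [monoMap_single, monoMap_single, mono_cons, smul_comm]

end Monomials

/-! ### Characters of `U(H)` from maximal ideals of Laurent polynomials. -/

section Characters

theorem prod_zpowL {n : ℕ} (l : Fin n → ℤ) :
    (∏ i, zpowL i (l i) : Lau 𝕜 n) = AddMonoidAlgebra.single l 1 := by
  have h1 : ∀ s : Finset (Fin n), (∏ i ∈ s, zpowL i (l i) : Lau 𝕜 n) =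
      AddMonoidAlgebra.single (∑ i ∈ s, Pi.single i (l i)) 1 := by
    intro s
    induction s using Finset.induction_on with
    | empty => rfl
    | insert a s ha ih =>
      rw [Finset.prod_insert ha, Finset.sum_insert ha, ih, zpowL,
        AddMonoidAlgebra.single_mul_single, one_mul]
  rw [h1, Finset.univ_sum_single]

/-- The power sums of `z₁ᵏ, …, zₙᵏ` are again power sums of the variables, for negative `k` too, so
Newton's identities make every `zᵢᵏ` integral. -/
theorem isIntegral_psi_range [CharZero 𝕜] (n : ℕ) :
    Algebra.IsIntegral (psi 𝕜 n).range (Lau 𝕜 n) := by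
  have hp : ∀ k, powL 𝕜 n k ∈ (psi 𝕜 n).range := fun k => by
    refine ⟨(-2 : 𝕜)⁻¹ • yH k, ?_⟩
    change psi 𝕜 n _ = _
    rw [map_smul, psi_yH, inv_smul_smul₀ (neg_ne_zero.2 two_ne_zero)]
  have hz : ∀ (i : Fin n) (k : ℤ), IsIntegral (psi 𝕜 n).range (zpowL i k : Lau 𝕜 n) := fun i k =>
    isIntegral_of_powerSum_mem (psi 𝕜 n).range (fun i => zpowL i k) (fun r _ => by
      simp only [zpowL_pow]
      exact hp _) i
  refine ⟨fun Q => ?_⟩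
  induction Q using AddMonoidAlgebra.induction_linear with
  | zero => exact isIntegral_zero
  | add P Q hP hQ => exact hP.add hQ
  | single l a =>
    have h1 : (AddMonoidAlgebra.single l a : Lau 𝕜 n) =
        algebraMap (psi 𝕜 n).range (Lau 𝕜 n) (algebraMap 𝕜 _ a) * ∏ i, zpowL i (l i) := by
      rw [prod_zpowL, ← IsScalarTower.algebraMap_apply, ← Algebra.smul_def,
        AddMonoidAlgebra.smul_single, smul_eq_mul, mul_one]
    rw [h1]
    exact isIntegral_algebraMap.mul (IsIntegral.prod _ fun i _ => hz i _)

/-- A proper ideal of a subalgebra over which a finitely generated algebra is integral is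
annihilated by a character of the algebra. -/
theorem exists_algHom_of_isIntegral [IsAlgClosed 𝕜] {A : Type*} [CommRing A] [Algebra 𝕜 A]
    [Algebra.FiniteType 𝕜 A] (R : Subalgebra 𝕜 A) [Algebra.IsIntegral R A] {J : Ideal R}
    (hJ : J ≠ ⊤) : ∃ χ : A →ₐ[𝕜] 𝕜, ∀ z ∈ J, χ z = 0 := by
  obtain ⟨m, hm, hJm⟩ := Ideal.exists_le_maximal J hJ
  -- A maximal ideal lies over `m`; by the Nullstellensatz its residue field is finite over `𝕜`,
  -- hence equal to `𝕜`.
  obtain ⟨Q, hQ, hQm⟩ := Ideal.exists_ideal_over_maximal_of_isIntegral (S := A) m (by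
    rw [(RingHom.injective_iff_ker_eq_bot _).1 (FaithfulSMul.algebraMap_injective R A)]
    exact bot_le)
  let _ := Ideal.Quotient.field Q
  have h1 : Module.Finite 𝕜 (A ⧸ Q) := finite_of_finite_type_of_isJacobsonRing 𝕜 (A ⧸ Q)
  have h2 : Function.Bijective (algebraMap 𝕜 (A ⧸ Q)) :=
    IsAlgClosed.algebraMap_bijective_of_isIntegral
  let ε : 𝕜 ≃ₐ[𝕜] A ⧸ Q := AlgEquiv.ofBijective (Algebra.ofId 𝕜 (A ⧸ Q)) h2
  refine ⟨ε.symm.toAlgHom.comp (Ideal.Quotient.mkₐ 𝕜 Q), fun z hz => ?_⟩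
  have h3 : (z : A) ∈ Q := by
    have h4 : z ∈ Q.comap (algebraMap R A) := hQm ▸ hJm hz
    exact h4
  change ε.symm (Ideal.Quotient.mk Q z) = 0
  rw [Ideal.Quotient.eq_zero_iff_mem.2 h3, map_zero]

/-- A character of the Laurent polynomials is the evaluation at a tuple of units. -/
theorem exists_units_eq {n : ℕ} (χ : Lau 𝕜 n →ₐ[𝕜] 𝕜) :
    ∃ α : Fin n → 𝕜ˣ, ∀ i k, χ (zpowL i k) = ((α i ^ k : 𝕜ˣ) : 𝕜) := by
  let g : Fin n → Multiplicative ℤ →* 𝕜 := fun i =>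
    { toFun := fun k => χ (zpowL i k.toAdd)
      map_one' := by simp [zpowL_zero]
      map_mul' := fun k l => by rw [toAdd_mul, ← zpowL_mul, map_mul] }
  refine ⟨fun i => (g i).toHomUnits (Multiplicative.ofAdd 1), fun i k => ?_⟩
  rw [← map_zpow, ← ofAdd_zsmul, smul_eq_mul, mul_one, MonoidHom.coe_toHomUnits]
  rfl

variable {N : Type*} [AddCommGroup N] [Module 𝕜 N] [Module (UG 𝕜) N] [IsScalarTower 𝕜 (UG 𝕜) N]

/-- The annihilator of a vector in `U(H)`, as an ideal of the image of `U(H)` in the Laurent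
polynomials. -/
def annIdeal (n : ℕ) (x : N) : Ideal (psi 𝕜 n).range where
  carrier := {z | ∃ y, psi 𝕜 n y = z ∧ incUH y • x = 0}
  add_mem' := by
    rintro a b ⟨y, hy, hyx⟩ ⟨z, hz, hzx⟩
    exact ⟨y + z, by rw [map_add, hy, hz]; rfl, by rw [map_add, add_smul, hyx, hzx, add_zero]⟩
  zero_mem' := ⟨0, map_zero _, by rw [map_zero, zero_smul]⟩
  smul_mem' := by
    rintro ⟨_, y, rfl⟩ b ⟨z, hz, hzx⟩
    exact ⟨y * z, by rw [map_mul, hz]; rfl, by rw [map_mul, mul_smul, hzx, smul_zero]⟩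

/-- The annihilator ideal of `x` is proper: if it contained `1 = psi y` with `y x = 0`, then `y - 1`
would lie in the kernel of `psi` and `x` would vanish. -/
theorem exists_char_of_ne_zero [CharZero 𝕜] [IsAlgClosed 𝕜] {n : ℕ} {x : N} (hx : x ≠ 0)
    (hker : ∀ y, psi 𝕜 n y = 0 → incUH y • x = 0) :
    ∃ χ : Lau 𝕜 n →ₐ[𝕜] 𝕜, ∀ y, incUH y • x = 0 → χ (psi 𝕜 n y) = 0 := by
  have hJ : annIdeal (𝕜 := 𝕜) n x ≠ ⊤ := by
    rw [Ideal.ne_top_iff_one]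
    rintro ⟨y, hy, hyx⟩
    have h1 := hker (y - 1) (by rw [map_sub, hy, map_one]; exact sub_self _)
    rw [map_sub, map_one, sub_smul, hyx, one_smul, zero_sub, neg_eq_zero] at h1
    exact hx h1
  have := isIntegral_psi_range (𝕜 := 𝕜) n
  obtain ⟨χ, hχ⟩ := exists_algHom_of_isIntegral (psi 𝕜 n).range hJ
  exact ⟨χ, fun y hy => hχ ⟨psi 𝕜 n y, y, rfl⟩ ⟨y, rfl, hy⟩⟩

/-- On the degree `d` part of `U(H)` the homomorphism `φ̃` is the character `χ` times `t^d`; hence it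
vanishes on the annihilator of a homogeneous vector if `χ` does. -/
theorem tilde_eq_zero_of_smul {𝓝 : ℤ → Submodule 𝕜 N} (hN : IsGrading 𝓝) {s : ℤ} {x : N}
    (hx : x ∈ 𝓝 s) {φ : ℤ → 𝕜} (χ : UH 𝕜 →ₐ[𝕜] 𝕜) (hφ : ∀ k, χ (yH k) = φ k)
    (hχ : ∀ y, incUH y • x = 0 → χ y = 0) {y : UH 𝕜} (hy : incUH y • x = 0) : tilde φ y = 0 := by
  -- `V d` consists of elements of degree `d` on which `φ̃` equals `χ` times `tᵈ`.
  let V : ℤ → Submodule 𝕜 (UH 𝕜) := fun d => (ugGrading (𝕜 := 𝕜) d).comap incUH.toLinearMap ⊓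
    LinearMap.eqLocus (tilde φ).toLinearMap
      (LinearMap.toSpanSingleton 𝕜 𝕜[T;T⁻¹] (LaurentPolynomial.T d) ∘ₗ χ.toLinearMap)
  have hV : ∀ d y, y ∈ V d ↔ incUH y ∈ ugGrading (𝕜 := 𝕜) d ∧
      tilde φ y = χ y • (LaurentPolynomial.T d : 𝕜[T;T⁻¹]) := fun d y => Iff.rfl
  have htop : ⨆ d, V d = ⊤ := by
    refine uh_eq_top _ (Submodule.mem_iSup_of_mem 0 ((hV 0 1).2 ?_)) fun k u hu => ?_
    · rw [map_one, map_one, map_one, LaurentPolynomial.T_zero, one_smul]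
      exact ⟨one_mem_ugGrading, rfl⟩
    · induction hu using Submodule.iSup_induction' with
      | zero => rw [mul_zero]; exact Submodule.zero_mem _
      | add u v _ _ hu hv => rw [mul_add]; exact Submodule.add_mem _ hu hv
      | mem d u hu =>
        obtain ⟨h1, h2⟩ := (hV d u).1 hu
        refine Submodule.mem_iSup_of_mem (k + d) ((hV _ _).2 ⟨?_, ?_⟩)
        · rw [map_mul, incUH_yH]
          exact mul_mem_ugGrading (toUG_mem_ugGrading (h 𝕜) k) h1
        · rw [map_mul, map_mul, h2, hφ, yH, tilde_h, smul_mul_smul_comm, LaurentPolynomial.T_add]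
  obtain ⟨g, hg, rfl⟩ := (Submodule.mem_iSup_iff_exists_finsupp V y).1 (htop ▸ Submodule.mem_top)
  have h1 : ∀ d, incUH (g d) • x ∈ 𝓝 (s + d) := fun d => hN.ug_smul_mem ((hV d _).1 (hg d)).1 hx
  rw [Finsupp.sum, map_sum, Finset.sum_smul] at hy
  rw [Finsupp.sum, map_sum]
  refine Finset.sum_eq_zero fun d hd => ?_
  -- As `x` is homogeneous, every homogeneous part of `y` annihilates it separately.
  have h2 := congrArg (comp hN (s + d)) hy
  rw [map_zero, map_sum, Finset.sum_eq_single_of_mem d hd fun i _ hi =>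
    comp_of_mem_ne hN (h1 i) (by simpa using hi), comp_of_mem hN (h1 d)] at h2
  rw [((hV d _).1 (hg d)).2, hχ _ h2, zero_smul]

end Characters

/-! ### Irreducible subquotients of `M̄(0)`. -/

section Subquotients

variable [CharZero 𝕜]
variable {M N : Type*} [AddCommGroup M] [Module 𝕜 M] [Module (UG 𝕜) M] [IsScalarTower 𝕜 (UG 𝕜) M]
  [AddCommGroup N] [Module 𝕜 N] [Module (UG 𝕜) N] [IsScalarTower 𝕜 (UG 𝕜) N]

theorem exists_sum_of_surjective {C : Submodule 𝕜 M} {c : 𝕜} (hC : IsHighest C c)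
    (hspan : Submodule.span (UG 𝕜) (C : Set M) = ⊤) {A : Submodule (UG 𝕜) M} {G : A →ₗ[UG 𝕜] N}
    (hG : Function.Surjective G) (x : N) :
    ∃ g : ℕ →₀ N, (∀ r, ∃ a : A, (a : M) ∈ layer C r ∧ G a = g r) ∧ g.sum (fun _ x => x) = x := by
  obtain ⟨a, rfl⟩ := hG x
  obtain ⟨g, hg, hga⟩ := hC.exists_sum (hspan ▸ Submodule.mem_top (x := (a : M)))
  have hA : ∀ r, g r ∈ A := weight_component_mem (fun r => hC.layer_le_wt r (hg r))
    (hga ▸ a.2 : g.sum (fun _ x => x) ∈ A)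
  refine ⟨Finsupp.onFinset g.support (fun r => G ⟨g r, hA r⟩) fun r hr => ?_,
    fun r => ⟨⟨g r, hA r⟩, hg r, rfl⟩, ?_⟩
  · refine Finsupp.mem_support_iff.2 fun h0 => hr ?_
    rw [← map_zero G]
    exact congrArg G (Subtype.ext h0)
  · rw [Finsupp.onFinset_sum _ fun _ => rfl, ← map_sum]
    refine congrArg G (Subtype.ext ?_)
    rw [← hga, AddSubmonoidClass.coe_finsetSum]
    rfl

theorem map_mem_wt {A : Submodule (UG 𝕜) M} (G : A →ₗ[UG 𝕜] N) {c : 𝕜} {a : A}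
    (ha : (a : M) ∈ wt M c) : G a ∈ wt N c := by
  have h1 : (uH 0 : UG 𝕜) • a = algebraMap 𝕜 (UG 𝕜) c • a := Subtype.ext (by
    rw [Submodule.coe_smul, Submodule.coe_smul, algebraMap_smul]
    exact ha)
  rw [mem_wt, ← map_smul, h1, map_smul, algebraMap_smul]

/-- A non-zero module that is a sum of weight spaces with weights `c, c - 2, c - 4, …` has a highest
weight. -/
theorem exists_highest_weight [Nontrivial N] {c : 𝕜}
    (hN : ∀ x : N, ∃ g : ℕ →₀ N, (∀ r : ℕ, g r ∈ wt N (c - 2 * (r : 𝕜))) ∧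
      g.sum (fun _ x => x) = x) :
    ∃ n : ℕ, wt N (c - 2 * (n : 𝕜)) ≠ ⊥ ∧
      ∀ x ∈ wt N (c - 2 * (n : 𝕜)), ∀ k, (uE k : UG 𝕜) • x = 0 := by
  classical
  have hex : ∃ n : ℕ, wt N (c - 2 * (n : 𝕜)) ≠ ⊥ := by
    by_contra! h0
    obtain ⟨x, hx⟩ := exists_ne (0 : N)
    obtain ⟨g, hg, rfl⟩ := hN x
    refine hx (Finset.sum_eq_zero fun r _ => ?_)
    have h1 := hg r
    rwa [h0 r, Submodule.mem_bot] at h1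
  -- The least `n` gives the highest weight. The vector `e(k) x` has weight higher by `2`, but it is
  -- a sum of vectors of weight at most the highest one, so it is zero.
  refine ⟨Nat.find hex, Nat.find_spec hex, fun x hx k => ?_⟩
  have h1 := uE_smul_mem_wt k hx
  refine Submodule.disjoint_def.1 (disjoint_wt_low _) _ h1 ?_
  obtain ⟨g, hg, hgs⟩ := hN ((uE k : UG 𝕜) • x)
  rw [← hgs]
  refine Submodule.sum_mem _ fun r hr => ?_
  have h2 : Nat.find hex ≤ r := Nat.find_min' hex fun h0 => by
    have h3 := hg r
    rw [h0, Submodule.mem_bot] at h3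
    exact Finsupp.mem_support_iff.1 hr h3
  obtain ⟨j, rfl⟩ := Nat.exists_eq_add_of_le h2
  refine Submodule.mem_iSup_of_mem j ?_
  have h3 := hg (Nat.find hex + j)
  rwa [show c - 2 * ((Nat.find hex + j : ℕ) : 𝕜) =
    c - 2 * (Nat.find hex : 𝕜) + 2 - 2 * ((j : 𝕜) + 1) by push_cast; ring] at h3

/-- The structure of irreducible subquotients of a highest weight module whose generator is
annihilated by `H`. -/
theorem exists_vector_of_irreducible {v : M} {C : Submodule 𝕜 M} (hC : IsHighest C 0)
    (hCv : ∀ m ∈ C, ∃ a : 𝕜, m = a • v) (hv : ∀ k, (uH k : UG 𝕜) • v = 0)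
    (hspan : Submodule.span (UG 𝕜) (C : Set M) = ⊤) {A : Submodule (UG 𝕜) M} {G : A →ₗ[UG 𝕜] N}
    (hG : Function.Surjective G) {𝓝 : ℤ → Submodule 𝕜 N} (hN : IsGrading 𝓝) [Nontrivial N] :
    ∃ (n : ℕ) (c : 𝕜) (s : ℤ) (x : N), x ∈ 𝓝 s ∧ x ≠ 0 ∧ x ∈ wt N c ∧
      (∀ k, (uE k : UG 𝕜) • x = 0) ∧ ∀ y, psi 𝕜 n y = 0 → incUH y • x = 0 := by
  have hsum := exists_sum_of_surjective hC hspan hG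
  have hwt : ∀ {g : ℕ →₀ N}, (∀ r, ∃ a : A, (a : M) ∈ layer C r ∧ G a = g r) →
      ∀ r : ℕ, g r ∈ wt N (0 - 2 * (r : 𝕜)) := fun hg r => by
    obtain ⟨a, ha, hag⟩ := hg r
    rw [← hag]
    exact map_mem_wt G (hC.layer_le_wt r ha)
  obtain ⟨n, hn, he⟩ := exists_highest_weight (N := N) (c := (0 : 𝕜)) fun x => by
    obtain ⟨g, hg, hgx⟩ := hsum x
    exact ⟨g, hwt hg, hgx⟩
  obtain ⟨z, hz, hz0⟩ := Submodule.exists_mem_ne_zero_of_ne_bot hn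
  obtain ⟨s, hs⟩ : ∃ s, comp hN s z ≠ 0 := by
    by_contra! h0
    exact hz0 (eq_zero_of_comp hN h0)
  have hx := comp_mem_wt hN hz s
  refine ⟨n, _, s, comp hN s z, comp_mem hN s z, hs, hx, he _ hx, fun y hy => ?_⟩
  obtain ⟨g, hg, hgx⟩ := hsum (comp hN s z)
  rw [← hgx] at hx ⊢
  rw [eq_component_of_mem_wt (hwt hg) hx]
  obtain ⟨a, ha, hag⟩ := hg n
  -- The homogeneous vector lifts to the layer `n` of `M`, where `U(H)` acts through `psi 𝕜 n`.
  obtain ⟨Q, hQ⟩ := layer_le_range_monoMap v hCv n ha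
  have h1 : incUH y • a = 0 := Subtype.ext (by
    rw [Submodule.coe_smul, ← hQ, incUH_smul_monoMap hv, hy, zero_mul, map_zero]
    rfl)
  rw [← hag, ← map_smul, h1, map_zero]

/-- A character killing the annihilator of `x` is evaluation at a tuple `α`, which defines `φ`. Then
the annihilator of `x` lies in that of `1 ∈ F(φ)`, and irreducibility makes the resulting surjection
an isomorphism; the shift `0 - s` moves the degree of `x` to that of `1`. -/
theorem exists_gradedIso_fPhi [IsAlgClosed 𝕜] {𝓝 : ℤ → Submodule 𝕜 N} (hN : IsGradedIrreducible 𝓝)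
    {n : ℕ} {c : 𝕜} {s : ℤ} {x : N} (hx : x ∈ 𝓝 s) (hx0 : x ≠ 0) (hxc : x ∈ wt N c)
    (hxe : ∀ k, (uE k : UG 𝕜) • x = 0) (hker : ∀ y, psi 𝕜 n y = 0 → incUH y • x = 0) :
    ∃ φ ∈ Exp 𝕜, ∃ s : ℤ, GradedIso s 𝓝 (fPhiGrading φ) := by
  obtain ⟨χ, hχ⟩ := exists_char_of_ne_zero hx0 hker
  obtain ⟨α, hα⟩ := exists_units_eq χ
  let φ : ℤ → 𝕜 := fun k => -2 * ∑ i, ((α i ^ k : 𝕜ˣ) : 𝕜)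
  have hφ : ∀ k, χ.comp (psi 𝕜 n) (yH k) = φ k := fun k => by
    rw [AlgHom.comp_apply, psi_yH, map_smul, powL, map_sum, smul_eq_mul]
    exact congrArg _ (Finset.sum_congr rfl fun i _ => hα i k)
  refine ⟨φ, ⟨n, fun i => α i, fun i => (α i).ne_zero, fun k => ?_⟩, 0 - s,
    gradedIso_of_irreducible (isGrading_fPhiGrading φ) hN
      (incF_mem_fPhiGrading φ (one_mem_pGrading φ)) hx hx0 (incF_one_ne_zero (fun _ => rfl))
      (exists_smul_incF_one φ) fun u hu => smul_incF_eq_zero hxc hxe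
        (fun y hy => tilde_eq_zero_of_smul hN.isGrading hx _ hφ hχ hy) hu⟩
  simp only [φ, Units.val_zpow_eq_zpow_val]

theorem mBar_mem_range {m : MBar 𝕜} (hm : m ∈ LinearMap.range (inducedInc (trivialRep (𝕜 := 𝕜)))) :
    ∃ a : 𝕜, m = a • vBar 𝕜 := by
  obtain ⟨a, rfl⟩ := hm
  exact ⟨a, by rw [vBar, ← map_smul, smul_eq_mul, mul_one]⟩

theorem exists_gradedIso_of_subquotient [IsAlgClosed 𝕜] {𝓝 : ℤ → Submodule 𝕜 N}
    (hN : IsGradedIrreducible 𝓝) (h : IsGradedSubquotient 𝓝 (mBarGrading 𝕜)) :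
    ∃ φ ∈ Exp 𝕜, ∃ s : ℤ, GradedIso s 𝓝 (fPhiGrading φ) := by
  obtain ⟨A, B, -, -, -, F, -⟩ := h
  have := hN.nontrivial
  obtain ⟨n, c, s, x, hx, hx0, hxc, hxe, hker⟩ := exists_vector_of_irreducible
    (isHighest_inducedInc trivialRep_yH_zero) (fun m hm => mBar_mem_range hm) uH_smul_vBar
    induced_eq_span (G := F.symm.toLinearMap ∘ₗ (B.submoduleOf A).mkQ)
    (F.symm.surjective.comp (Submodule.mkQ_surjective _)) hN.isGrading
  exact exists_gradedIso_fPhi hN hx hx0 hxc hxe hker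

end Subquotients

end LoopSl2

end

theorem mainTheorem6 {𝕜 : Type*} [Field 𝕜] [CharZero 𝕜] :
    (∀ φ ∈ LoopSl2.Exp 𝕜,
      LoopSl2.IsGradedIrreducible (LoopSl2.fPhiGrading φ) ∧
      LoopSl2.IsGradedSubquotient (LoopSl2.fPhiGrading φ) (LoopSl2.mBarGrading 𝕜)) ∧
    (IsAlgClosed 𝕜 →
      ∀ (N : Type*) [AddCommGroup N] [Module 𝕜 N] [Module (LoopSl2.UG 𝕜) N]
        [IsScalarTower 𝕜 (LoopSl2.UG 𝕜) N] (𝓝 : ℤ → Submodule 𝕜 N),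
        LoopSl2.IsGradedIrreducible 𝓝 →
        LoopSl2.IsGradedSubquotient 𝓝 (LoopSl2.mBarGrading 𝕜) →
        ∃ φ ∈ LoopSl2.Exp 𝕜, ∃ s : ℤ, LoopSl2.GradedIso s 𝓝 (LoopSl2.fPhiGrading φ)) := by
  refine ⟨fun φ hφ => ?_, fun _ N _ _ _ _ 𝓝 hN h => LoopSl2.exists_gradedIso_of_subquotient hN h⟩
  obtain ⟨n, α, hα⟩ := LoopSl2.exists_units_of_mem_Exp hφ
  exact ⟨LoopSl2.isGradedIrreducible_fPhi hα, LoopSl2.isGradedSubquotient_fPhi hα⟩
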